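/- Let $\mathbb{F}_q$ be a finite field with $q$ elements, let $n \ge 4$, let $V$ be a vector space of dimension $2n$ over $\mathbb{F}_q$ equipped with a non-degenerate alternating bilinear form $\Psi$, and let $\Bbbk$ be a field of characteristic $0$. The orthogonality graph of $V$ has as vertices the $2$-dimensional subspaces of $V$ on which $\Psi$ is non-degenerate, and two vertices are adjacent if and only if they are orthogonal. The frame complex $\mathcal{F}(V)$ is the clique complex of this graph; its simplices are called frames. Let $\widehat{\mathcal{F}}(V)$ be the poset, ordered by inclusion, of the frames of size $\neq 0, n-1$; it is identified with its order complex. A simplicial complex $K$ is $m$-connected over $\Bbbk$ if its reduced homology satisfies $\widetilde{H}_i(K,\Bbbk)=0$ for all $i \le m$. It is spherical over $\Bbbk$ of dimension $e$ if it has dimension $e$ and is $(e-1)$-connected over $\Bbbk$. If $K$ has dimension $d$, it is Cohen–Macaulay over $\Bbbk$ if for every simplex $\sigma$ of $K$ (including $\sigma=\emptyset$) the link of $\sigma$ in $K$ is spherical over $\Bbbk$ of dimension $d-|\sigma|$. Then: 1. If $n < q+3$, then $\widehat{\mathcal{F}}(V)$ is Cohen–Macaulay over $\Bbbk$. 2.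 If $n < q^2+4$, then $\widehat{\mathcal{F}}(V)$ is $(n-4)$-connected over $\Bbbk$. 3. If $q \in \{2,3\}$ and $n \ge 7$, or $q \ge 4$ and $n \ge 5$, then $\mathcal{F}(V)$ is $\lfloor n/2 \rfloor$-connected over $\Bbbk$. -/

import Mathlib

/-! ### Simplicial complexes and reduced homology

Mathlib's `PreAbstractSimplicialComplex ι` lists only the nonempty simplices. The empty simplex is
implicitly a simplex of every complex, and the complex without nonempty simplices is `{∅}`. -/

namespace PreAbstractSimplicialComplex

variable {ι : Type*}

/-- `σ` is a simplex of `K`, where the empty simplex is allowed. -/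
def IsSimplex (K : PreAbstractSimplicialComplex ι) (σ : Finset ι) : Prop :=
  σ = ∅ ∨ σ ∈ K

/-- The ordered simplices of `K` with `j` vertices: the `j`-tuples (repetitions are allowed) whose
entries all lie in one simplex of `K`. For `j = 0` there is just the empty tuple. -/
abbrev OrderedSimplex (K : PreAbstractSimplicialComplex ι) (j : ℕ) : Type _ :=
  {v : Fin j → ι // ∃ σ, K.IsSimplex σ ∧ ∀ i, v i ∈ σ}

/-- The `i`-th face of an ordered simplex: the `i`-th entry is omitted. -/
def OrderedSimplex.face {K : PreAbstractSimplicialComplex ι} {j : ℕ}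
    (v : K.OrderedSimplex (j + 1)) (i : Fin (j + 1)) : K.OrderedSimplex j :=
  ⟨fun l => v.1 (i.succAbove l), v.2.imp fun _ h => ⟨h.1, fun _ => h.2 _⟩⟩

/-- The boundary map `v ↦ ∑ i, (-1) ^ i • (i-th face of v)` of the augmented ordered chain complex
of `K` with coefficients in `k`, from chains on `(j + 1)`-tuples (degree `j`) to chains on
`j`-tuples (degree `j - 1`). For `j = 0` it is the augmentation. -/
noncomputable def boundary (k : Type*) [CommRing k] (K : PreAbstractSimplicialComplex ι) (j : ℕ) :
    (K.OrderedSimplex (j + 1) →₀ k) →ₗ[k] (K.OrderedSimplex j →₀ k) :=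
  Finsupp.linearCombination k fun v =>
    ∑ i : Fin (j + 1), (-1 : k) ^ (i : ℕ) • Finsupp.single (v.face i) (1 : k)

/-- The cycles among the chains on `j`-tuples (degree `j - 1`). -/
noncomputable def cycles (k : Type*) [CommRing k] (K : PreAbstractSimplicialComplex ι) :
    (j : ℕ) → Submodule k (K.OrderedSimplex j →₀ k)
  | 0 => ⊤
  | j + 1 => LinearMap.ker (K.boundary k j)

/-- The quotient `Z / (Z ∩ B)` of two submodules of a module, so `Z / B` if `B ≤ Z`. -/
abbrev SubmoduleQuotient {k M : Type*} [CommRing k] [AddCommGroup M] [Module k M]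
    (Z B : Submodule k M) : Type _ :=
  Z ⧸ B.submoduleOf Z

/-- The reduced simplicial homology of `K` with coefficients in `k` in degree `j - 1`
(so that `j = 0` is degree `-1`). -/
abbrev ReducedHomology (k : Type*) [CommRing k] (K : PreAbstractSimplicialComplex ι) (j : ℕ) :
    Type _ :=
  SubmoduleQuotient (K.cycles k j) (LinearMap.range (K.boundary k j))

/-- `K` is `m`-connected over `k`: its reduced homology with coefficients in `k` vanishes in all
degrees `≤ m`. -/
def IsConnectedOver (k : Type*) [CommRing k] (K : PreAbstractSimplicialComplex ι) (m : ℤ) : Prop :=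
  ∀ j : ℕ, (j : ℤ) - 1 ≤ m → Subsingleton (K.ReducedHomology k j)

/-- `K` has dimension `d`: the largest dimension `|σ| - 1` of a simplex `σ` of `K` is `d`. -/
def HasDimension (K : PreAbstractSimplicialComplex ι) (d : ℤ) : Prop :=
  IsGreatest {e : ℤ | ∃ σ, K.IsSimplex σ ∧ e = (σ.card : ℤ) - 1} d

/-- `K` is spherical over `k` of dimension `d`. -/
def IsSpherical (k : Type*) [CommRing k] (K : PreAbstractSimplicialComplex ι) (d : ℤ) : Prop :=
  K.HasDimension d ∧ K.IsConnectedOver k (d - 1)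

open Classical in
/-- The link of `σ` in `K`: the simplices `τ` disjoint from `σ` such that `σ ∪ τ` is a simplex. -/
def link (K : PreAbstractSimplicialComplex ι) (σ : Finset ι) : PreAbstractSimplicialComplex ι where
  faces := {τ | τ.Nonempty ∧ Disjoint σ τ ∧ σ ∪ τ ∈ K}
  isRelLowerSet_faces := fun _ hτ => ⟨hτ.1, fun _ hρ hne =>
    ⟨hne, hτ.2.1.mono_right hρ, (K.isRelLowerSet_faces hτ.2.2).2
      (Finset.union_subset_union_right hρ) (hne.mono Finset.subset_union_right)⟩⟩

/-- `K` is Cohen–Macaulay over `k`: for `d = dim K`, the link of every simplex `σ` (including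
`σ = ∅`) is spherical over `k` of dimension `d - |σ|`. -/
def IsCohenMacaulay (k : Type*) [CommRing k] (K : PreAbstractSimplicialComplex ι) : Prop :=
  ∃ d : ℤ, K.HasDimension d ∧
    ∀ σ : Finset ι, K.IsSimplex σ → (K.link σ).IsSpherical k (d - σ.card)

end PreAbstractSimplicialComplex

/-- The order complex of a poset: its simplices are the finite chains. -/
def orderComplex (P : Type*) [PartialOrder P] : PreAbstractSimplicialComplex P where
  faces := {s | s.Nonempty ∧ IsChain (· ≤ ·) (s : Set P)}
  isRelLowerSet_faces := fun _ hs => ⟨hs.1, fun _ ht hne => ⟨hne, hs.2.mono (by exact_mod_cast ht)⟩⟩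

/-- The clique complex of a graph. -/
def SimpleGraph.cliqueComplex {α : Type*} (G : SimpleGraph α) : PreAbstractSimplicialComplex α where
  faces := {s | s.Nonempty ∧ G.IsClique (s : Set α)}
  isRelLowerSet_faces := fun _ hs => ⟨hs.1, fun _ ht hne => ⟨hne, Set.Pairwise.mono (by exact_mod_cast ht) hs.2⟩⟩

/-! ### The frame complex of a symplectic space -/

namespace Symplectic

variable {F V : Type*} [Field F] [AddCommGroup V] [Module F V]

/-- The `2`-dimensional non-degenerate subspaces of `V`. -/
abbrev NondegeneratePlane (Ψ : LinearMap.BilinForm F V) : Type _ :=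
  {S : Submodule F V // Module.finrank F S = 2 ∧ (Ψ.restrict S).Nondegenerate}

/-- The orthogonality graph of `V`. -/
def orthogonalityGraph (Ψ : LinearMap.BilinForm F V) (hΨ : Ψ.IsAlt) :
    SimpleGraph (NondegeneratePlane Ψ) where
  Adj S T := ∀ x ∈ S.1, ∀ y ∈ T.1, Ψ x y = 0
  symm := ⟨fun _ _ h x hx y hy => hΨ.isRefl y x (h y hy x hx)⟩
  loopless := ⟨fun S h => by
    have h0 : ∀ x : S.1, x = 0 := fun x => S.2.2.1 x fun y => h x x.2 y y.2
    have : Subsingleton S.1 := ⟨fun x y => (h0 x).trans (h0 y).symm⟩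
    have h2 := S.2.1
    rw [Module.finrank_zero_of_subsingleton] at h2
    exact absurd h2 (by decide)⟩

/-- The frame complex of `V`; its simplices are the frames. -/
def frameComplex (Ψ : LinearMap.BilinForm F V) (hΨ : Ψ.IsAlt) :
    PreAbstractSimplicialComplex (NondegeneratePlane Ψ) :=
  (orthogonalityGraph Ψ hΨ).cliqueComplex

/-- The poset, ordered by inclusion, of the frames of size `≠ 0, n - 1`, where `2n = dim V`. -/
abbrev FramePoset (Ψ : LinearMap.BilinForm F V) (hΨ : Ψ.IsAlt) : Type _ :=
  {σ : Finset (NondegeneratePlane Ψ) //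
    σ ∈ frameComplex Ψ hΨ ∧ σ.card + 1 ≠ Module.finrank F V / 2}

end Symplectic

/-! The homology of links in the frame complex is killed by Garland's method, and the passage to the
poset of frames is a sequence of elementary additions and removals of poset elements, each
controlled by Mayer–Vietoris.

Garland's method (`exactAt_of_link_gap`). On antisymmetric rational cycles, coning off from all
vertices of the link and taking the boundary gives `D • f` minus an operator whose quadratic form is
a sum of local terms, one for each simplex `τ` with one vertex fewer than the tuples in `f`. The
cycle condition makes the local function have sum zero on the link of `τ`, so a spectral bound `T`
for the graphs of these links bounds the form by `(m + 1) * T` times the squared norm. If this is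
less than `D`, the operator is injective on a finite-dimensional space of cycles, hence surjective,
and every cycle bounds. Positivity needs an ordered field; exactness over `ℚ` then transfers to
every field of characteristic 0 (`ExactAt.of_rat`).

The spectral bound (`sum_adjSum_mul_le`). The link of a frame is the frame complex of its orthogonal
complement, so one graph has to be understood: orthogonality of non-degenerate planes in dimension
`2m`. Functions on planes with sum zero split orthogonally into those induced from vectors and those
whose sums over the planes through each vector vanish. On the first part the adjacency operator
scales norms by exactly `q ^ (3m - 6)`, because orthogonality of vectors squares to a scalar on
functions with sum zero on projective points. On the second part, counting common neighbours of two
planes gives a bound that is at most as large when `3 ≤ m`.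

Consequence. With the exact number of planes in dimension `2(m - 1)`, degree `d` homology of the
link of `s` vanishes when `d + 1 ≤ q ^ (n - |s| - d - 2)` and `d + 3 ≤ n - |s|`. For `s = ∅` this
gives the third statement, except for one pair `(n, d)` with `q = 2`, where the sharper inequality
is used.

The poset. Simplices above `s` form a subdivision of the link of `s` (`acyclic_above`); each element
missing from a chain below its top `s` adds one to the connectivity (`acyclic_chainLink`). A frame
of size `n - 1` lies in a unique frame of size `n`, so its link is a cone and deleting all such
frames lowers the dimension by one without losing connectivity (`acyclic_chainLink_diff_of_small`).
Below a fixed frame of size `n` everything is Boolean, and deleting size `n - 1` costs one degree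
(`acyclic_chainLink_diff_of_mem`), which is just what Cohen–Macaulayness allows. -/

/-! ### Chains on tuples of vertices -/

namespace TupleChain

variable {ι : Type*} {k : Type*} [CommRing k]

/-- The boundary map on chains of arbitrary tuples. -/
noncomputable def bd (k : Type*) [CommRing k] (ι : Type*) (j : ℕ) :
    ((Fin (j + 1) → ι) →₀ k) →ₗ[k] ((Fin j → ι) →₀ k) :=
  Finsupp.linearCombination k fun v =>
    ∑ i : Fin (j + 1), (-1 : k) ^ (i : ℕ) • Finsupp.single (fun l => v (i.succAbove l)) (1 : k)

/-- The cycles among the chains on `j`-tuples. -/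
noncomputable def cyc (k : Type*) [CommRing k] (ι : Type*) :
    (j : ℕ) → Submodule k ((Fin j → ι) →₀ k)
  | 0 => ⊤
  | j + 1 => LinearMap.ker (bd k ι j)

/-- The cone operator, which puts a vertex in front of every tuple. -/
noncomputable def cone (k : Type*) [CommRing k] {ι : Type*} (a : ι) (j : ℕ) :
    ((Fin j → ι) →₀ k) →ₗ[k] ((Fin (j + 1) → ι) →₀ k) :=
  Finsupp.lmapDomain k k fun v => (Fin.cons a v : Fin (j + 1) → ι)

theorem bd_single (j : ℕ) (v : Fin (j + 1) → ι) (c : k) :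
    bd k ι j (Finsupp.single v c) =
      ∑ i : Fin (j + 1), (-1 : k) ^ (i : ℕ) • Finsupp.single (fun l => v (i.succAbove l)) c := by
  simp [bd, Finset.smul_sum, mul_comm]

theorem cone_single (a : ι) (j : ℕ) (v : Fin j → ι) (c : k) :
    cone k a j (Finsupp.single v c) = Finsupp.single (Fin.cons a v : Fin (j + 1) → ι) c := by
  simp [cone]

theorem bd_cone_zero (a : ι) (w : (Fin 0 → ι) →₀ k) : bd k ι 0 (cone k a 0 w) = w := by
  induction w using Finsupp.induction_linear with
  | zero => simp
  | add f g hf hg => simp [hf, hg]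
  | single v c =>
    rw [cone_single, bd_single]
    simp

/-- The cone is a contracting homotopy for chains of arbitrary tuples. All later exactness proofs
only check that some cone stays inside a prescribed family. -/
theorem bd_cone_succ (a : ι) (j : ℕ) (w : (Fin (j + 1) → ι) →₀ k) :
    bd k ι (j + 1) (cone k a (j + 1) w) = w - cone k a j (bd k ι j w) := by
  induction w using Finsupp.induction_linear with
  | zero => simp
  | add f g hf hg => simp only [map_add, hf, hg]; abel
  | single v c =>
    rw [cone_single, bd_single, bd_single, Fin.sum_univ_succ, map_sum, sub_eq_add_neg,
      ← Finset.sum_neg_distrib]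
    congr 1
    · simp
    · refine Finset.sum_congr rfl fun i _ => ?_
      rw [map_smul, cone_single, Fin.val_succ, pow_succ, mul_neg_one, neg_smul]
      congr 3
      ext l
      refine Fin.cases ?_ (fun l => ?_) l <;> simp

theorem single_eq_cone (j : ℕ) (v : Fin (j + 1) → ι) (c : k) :
    Finsupp.single v c = cone k (v 0) j (Finsupp.single (Fin.tail v) c) := by
  rw [cone_single, Fin.cons_self_tail]

/-- Every tuple is the cone from its first entry over its tail, so the cone formula and induction
replace the usual cancellation in a double sum. -/
theorem bd_bd (j : ℕ) (w : (Fin (j + 2) → ι) →₀ k) : bd k ι j (bd k ι (j + 1) w) = 0 := by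
  induction j with
  | zero =>
    induction w using Finsupp.induction_linear with
    | zero => simp
    | add f g hf hg => simp [hf, hg]
    | single v c => rw [single_eq_cone, bd_cone_succ, map_sub, bd_cone_zero, sub_self]
  | succ j ih =>
    induction w using Finsupp.induction_linear with
    | zero => simp
    | add f g hf hg => simp [hf, hg]
    | single v c => rw [single_eq_cone, bd_cone_succ, map_sub, bd_cone_succ, ih]; simp

theorem bd_mem_cyc (j : ℕ) (w : (Fin (j + 1) → ι) →₀ k) : bd k ι j w ∈ cyc k ι j := by
  cases j with
  | zero => exact Submodule.mem_top
  | succ j => exact LinearMap.mem_ker.2 (bd_bd j w)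

theorem bd_cone_of_mem_cyc (a : ι) (j : ℕ) {w : (Fin j → ι) →₀ k} (hw : w ∈ cyc k ι j) :
    bd k ι j (cone k a j w) = w := by
  cases j with
  | zero => exact bd_cone_zero a w
  | succ j => rw [bd_cone_succ, LinearMap.mem_ker.1 hw, map_zero, sub_zero]

/-! ### Families of tuples closed under faces -/

/-- A family of sets of tuples is closed under faces. -/
def FaceClosed (X : ∀ j, Set (Fin j → ι)) : Prop :=
  ∀ j, ∀ v ∈ X (j + 1), ∀ i : Fin (j + 1), (fun l => v (i.succAbove l)) ∈ X j

/-- The chain complex of a family of tuples is exact at the chains on `j`-tuples. -/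
def ExactAt (k : Type*) [CommRing k] (X : ∀ j, Set (Fin j → ι)) (j : ℕ) : Prop :=
  ∀ z ∈ Finsupp.supported k k (X j), z ∈ cyc k ι j →
    ∃ w ∈ Finsupp.supported k k (X (j + 1)), bd k ι j w = z

/-- The chain complex of a family of tuples is exact in all degrees `≤ t`, where `j`-tuples have
degree `j - 1`. -/
def Acyclic (k : Type*) [CommRing k] (X : ∀ j, Set (Fin j → ι)) (t : ℤ) : Prop :=
  ∀ j : ℕ, (j : ℤ) - 1 ≤ t → ExactAt k X j

theorem Acyclic.mono {X : ∀ j, Set (Fin j → ι)} {s t : ℤ} (h : Acyclic k X t) (hst : s ≤ t) :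
    Acyclic k X s := fun j hj => h j (hj.trans hst)

/-- A linear map on chains sends supported chains into a submodule if it does so on tuples. -/
theorem map_mem_of_single {α M : Type*} [AddCommGroup M] [Module k M] {s : Set α}
    (f : (α →₀ k) →ₗ[k] M) (N : Submodule k M)
    (h : ∀ v ∈ s, f (Finsupp.single v 1) ∈ N) {z : α →₀ k}
    (hz : z ∈ Finsupp.supported k k s) : f z ∈ N := by
  rw [Finsupp.supported_eq_span_single] at hz
  refine (Submodule.span_le (p := N.comap f)).2 ?_ hz
  rintro _ ⟨v, hv, rfl⟩
  exact h v hv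

theorem bd_mem_supported {X : ∀ j, Set (Fin j → ι)} (hX : FaceClosed X) {j : ℕ}
    {z : (Fin (j + 1) → ι) →₀ k} (hz : z ∈ Finsupp.supported k k (X (j + 1))) :
    bd k ι j z ∈ Finsupp.supported k k (X j) := by
  refine map_mem_of_single (bd k ι j) _ (fun v hv => ?_) hz
  rw [bd_single]
  exact Submodule.sum_mem _ fun i _ => Submodule.smul_mem _ _
    (Finsupp.single_mem_supported _ _ (hX j v hv i))

theorem cone_mem_supported {X Y : ∀ j, Set (Fin j → ι)} {a : ι} {j : ℕ}
    (h : ∀ v ∈ X j, (Fin.cons a v : Fin (j + 1) → ι) ∈ Y (j + 1))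
    {z : (Fin j → ι) →₀ k} (hz : z ∈ Finsupp.supported k k (X j)) :
    cone k a j z ∈ Finsupp.supported k k (Y (j + 1)) := by
  refine map_mem_of_single (cone k a j) _ (fun v hv => ?_) hz
  rw [cone_single]
  exact Finsupp.single_mem_supported _ _ (h v hv)

theorem acyclic_of_apex {X : ∀ j, Set (Fin j → ι)} (a : ι)
    (h : ∀ j, ∀ v ∈ X j, (Fin.cons a v : Fin (j + 1) → ι) ∈ X (j + 1)) (t : ℤ) :
    Acyclic k X t := fun j _ z hz hc =>
  ⟨cone k a j z, cone_mem_supported (h j) hz, bd_cone_of_mem_cyc a j hc⟩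

/-- If a union and the intersection are exact, then so are the two parts. -/
theorem ExactAt.of_union_of_inter {X Y : ∀ j, Set (Fin j → ι)} (hX : FaceClosed X)
    (hY : FaceClosed Y) {j : ℕ} (hu : ExactAt k (fun j => X j ∪ Y j) j)
    (hi : ExactAt k (fun j => X j ∩ Y j) j) : ExactAt k X j := by
  intro z hz hc
  obtain ⟨w, hw, rfl⟩ := hu z (Finsupp.supported_mono Set.subset_union_left hz) hc
  rw [Finsupp.supported_union, Submodule.mem_sup] at hw
  obtain ⟨a, ha, b, hb, rfl⟩ := hw
  have hbX : bd k ι j b ∈ Finsupp.supported k k (X j) := by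
    have := Submodule.sub_mem _ hz (bd_mem_supported hX ha)
    rwa [map_add, add_sub_cancel_left] at this
  obtain ⟨u, hu', hub⟩ := hi (bd k ι j b)
    (by rw [Finsupp.supported_inter]; exact ⟨hbX, bd_mem_supported hY hb⟩) (bd_mem_cyc j b)
  exact ⟨a + u, Submodule.add_mem _ ha (Finsupp.supported_mono Set.inter_subset_left hu'),
    by rw [map_add, map_add, hub]⟩

theorem ExactAt.union_zero {X Y : ∀ j, Set (Fin j → ι)} (hX : ExactAt k X 0)
    (hY : ExactAt k Y 0) : ExactAt k (fun j => X j ∪ Y j) 0 := by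
  intro z hz _
  rw [Finsupp.supported_union, Submodule.mem_sup] at hz
  obtain ⟨a, ha, b, hb, rfl⟩ := hz
  obtain ⟨u, hu, rfl⟩ := hX a ha Submodule.mem_top
  obtain ⟨v, hv, rfl⟩ := hY b hb Submodule.mem_top
  exact ⟨u + v, Submodule.add_mem _ (Finsupp.supported_mono Set.subset_union_left hu)
    (Finsupp.supported_mono Set.subset_union_right hv), map_add _ _ _⟩

/-- Mayer–Vietoris: if `a + b` is a cycle, the boundary of `a` lives on the intersection and bounds
some `c` there; then `a - c` and `b + c` are cycles in the two parts. -/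
theorem ExactAt.union_succ {X Y : ∀ j, Set (Fin j → ι)} (hXc : FaceClosed X) (hYc : FaceClosed Y)
    {j : ℕ} (hX : ExactAt k X (j + 1)) (hY : ExactAt k Y (j + 1))
    (hi : ExactAt k (fun j => X j ∩ Y j) j) : ExactAt k (fun j => X j ∪ Y j) (j + 1) := by
  intro z hz hc
  rw [Finsupp.supported_union, Submodule.mem_sup] at hz
  obtain ⟨a, ha, b, hb, rfl⟩ := hz
  have hc' : bd k ι j a + bd k ι j b = 0 := by rw [← map_add]; exact LinearMap.mem_ker.1 hc
  have hab : bd k ι j a = -bd k ι j b := eq_neg_of_add_eq_zero_left hc'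
  obtain ⟨c, hcs, hca⟩ := hi (bd k ι j a)
    (by rw [Finsupp.supported_inter]
        exact ⟨bd_mem_supported hXc ha, hab ▸ Submodule.neg_mem _ (bd_mem_supported hYc hb)⟩)
    (bd_mem_cyc j a)
  rw [Finsupp.supported_inter] at hcs
  obtain ⟨u, hu, hua⟩ := hX (a - c) (Submodule.sub_mem _ ha hcs.1)
    (LinearMap.mem_ker.2 (by rw [map_sub, hca, sub_self]))
  obtain ⟨v, hv, hvb⟩ := hY (b + c) (Submodule.add_mem _ hb hcs.2)
    (LinearMap.mem_ker.2 (by rw [map_add, hca, add_comm, hc']))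
  refine ⟨u + v, Submodule.add_mem _ (Finsupp.supported_mono Set.subset_union_left hu)
    (Finsupp.supported_mono Set.subset_union_right hv), ?_⟩
  rw [map_add, hua, hvb]; abel

theorem Acyclic.of_union_of_inter {X Y : ∀ j, Set (Fin j → ι)} (hX : FaceClosed X)
    (hY : FaceClosed Y) {t : ℤ} (hu : Acyclic k (fun j => X j ∪ Y j) t)
    (hi : Acyclic k (fun j => X j ∩ Y j) t) : Acyclic k X t :=
  fun j hj => (hu j hj).of_union_of_inter hX hY (hi j hj)

theorem Acyclic.union {X Y : ∀ j, Set (Fin j → ι)} (hXc : FaceClosed X) (hYc : FaceClosed Y)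
    {t : ℤ} (hX : Acyclic k X t) (hY : Acyclic k Y t)
    (hi : Acyclic k (fun j => X j ∩ Y j) (t - 1)) : Acyclic k (fun j => X j ∪ Y j) t := by
  rintro (_ | j) hj
  · exact (hX 0 hj).union_zero (hY 0 hj)
  · exact (hX _ hj).union_succ hXc hYc (hY _ hj) (hi j (by push_cast at hj; linarith))

/-! ### Simplicial maps -/

/-- The chain map induced by a map of vertices. -/
noncomputable def mapVertices (k : Type*) [CommRing k] {ι κ : Type*} (φ : ι → κ) (j : ℕ) :
    ((Fin j → ι) →₀ k) →ₗ[k] ((Fin j → κ) →₀ k) :=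
  Finsupp.lmapDomain k k fun v i => φ (v i)

theorem mapVertices_single {κ : Type*} (φ : ι → κ) (j : ℕ) (v : Fin j → ι) (c : k) :
    mapVertices k φ j (Finsupp.single v c) = Finsupp.single (fun i => φ (v i)) c := by
  simp [mapVertices]

theorem bd_mapVertices {κ : Type*} (φ : ι → κ) (j : ℕ) (w : (Fin (j + 1) → ι) →₀ k) :
    bd k κ j (mapVertices k φ (j + 1) w) = mapVertices k φ j (bd k ι j w) := by
  induction w using Finsupp.induction_linear with
  | zero => simp
  | add f g hf hg => simp [hf, hg]
  | single v c => simp only [mapVertices_single, bd_single, map_sum, map_smul]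

theorem mapVertices_mem_cyc {κ : Type*} (φ : ι → κ) (j : ℕ) {w : (Fin j → ι) →₀ k}
    (hw : w ∈ cyc k ι j) : mapVertices k φ j w ∈ cyc k κ j := by
  cases j with
  | zero => exact Submodule.mem_top
  | succ j =>
    exact LinearMap.mem_ker.2 (by rw [bd_mapVertices, LinearMap.mem_ker.1 hw, map_zero])

theorem mapVertices_mem_supported {κ : Type*} {φ : ι → κ} {j : ℕ} {s : Set (Fin j → ι)}
    {s' : Set (Fin j → κ)} (h : ∀ v ∈ s, (fun i => φ (v i)) ∈ s') {z : (Fin j → ι) →₀ k}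
    (hz : z ∈ Finsupp.supported k k s) : mapVertices k φ j z ∈ Finsupp.supported k k s' := by
  refine map_mem_of_single _ _ (fun v hv => ?_) hz
  rw [mapVertices_single]
  exact Finsupp.single_mem_supported _ _ (h v hv)

/-- A retract of an acyclic family is acyclic. -/
theorem Acyclic.retract {κ : Type*} {X : ∀ j, Set (Fin j → ι)} {Y : ∀ j, Set (Fin j → κ)}
    (φ : ι → κ) (ψ : κ → ι) (h : ∀ x, ψ (φ x) = x)
    (hφ : ∀ j, ∀ v ∈ X j, (fun i => φ (v i)) ∈ Y j)
    (hψ : ∀ j, ∀ v ∈ Y j, (fun i => ψ (v i)) ∈ X j) {t : ℤ} (hY : Acyclic k Y t) :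
    Acyclic k X t := by
  intro j hj z hz hc
  obtain ⟨w, hw, hwz⟩ := hY j hj _ (mapVertices_mem_supported (hφ j) hz)
    (mapVertices_mem_cyc φ j hc)
  refine ⟨mapVertices k ψ (j + 1) w, mapVertices_mem_supported (hψ _) hw, ?_⟩
  rw [bd_mapVertices, hwz]
  change (mapVertices k ψ j ∘ₗ mapVertices k φ j) z = z
  rw [mapVertices, mapVertices, ← Finsupp.lmapDomain_comp]
  have : ((fun (v : Fin j → κ) i => ψ (v i)) ∘ fun (v : Fin j → ι) i => φ (v i)) = id := by
    funext v i; exact h _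
  rw [this, Finsupp.lmapDomain_id]; rfl

/-! ### Null homotopies -/

/-- The null homotopy of a chain map that vanishes on the empty tuple, obtained by coning off each
tuple `v` from a vertex `a v`. -/
noncomputable def nullHomotopy {κ : Type*} (a : ∀ j, (Fin (j + 1) → ι) → κ)
    (e : ∀ j, ((Fin j → ι) →₀ k) →ₗ[k] ((Fin j → κ) →₀ k)) :
    ∀ j, ((Fin j → ι) →₀ k) →ₗ[k] ((Fin (j + 1) → κ) →₀ k)
  | 0 => 0
  | j + 1 => Finsupp.linearCombination k fun v => cone k (a j v) (j + 1)
      (e (j + 1) (Finsupp.single v 1) - nullHomotopy a e j (bd k ι j (Finsupp.single v 1)))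

theorem nullHomotopy_succ_single {κ : Type*} (a : ∀ j, (Fin (j + 1) → ι) → κ)
    (e : ∀ j, ((Fin j → ι) →₀ k) →ₗ[k] ((Fin j → κ) →₀ k)) (j : ℕ) (v : Fin (j + 1) → ι) :
    nullHomotopy a e (j + 1) (Finsupp.single v 1) = cone k (a j v) (j + 1)
      (e (j + 1) (Finsupp.single v 1) - nullHomotopy a e j (bd k ι j (Finsupp.single v 1))) := by
  rw [nullHomotopy, Finsupp.linearCombination_single, one_smul]

/-- This is the acyclic carrier argument with carriers that are cones. The homotopy identity is
purely formal; the choice of apex `a j v` matters only for the support. -/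
theorem bd_nullHomotopy {κ : Type*} (a : ∀ j, (Fin (j + 1) → ι) → κ)
    (e : ∀ j, ((Fin j → ι) →₀ k) →ₗ[k] ((Fin j → κ) →₀ k))
    (he : ∀ j w, bd k κ j (e (j + 1) w) = e j (bd k ι j w)) (he0 : e 0 = 0)
    (j : ℕ) (z : (Fin j → ι) →₀ k) (hz : z ∈ cyc k ι j) :
    bd k κ j (nullHomotopy a e j z) = e j z := by
  -- The chain being coned off has zero boundary: by induction its boundary is `e` of the boundary
  -- minus the same term. So the boundary of the cone returns it unchanged.
  have key : ∀ j (z : (Fin (j + 1) → ι) →₀ k), bd k κ (j + 1) (nullHomotopy a e (j + 1) z) =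
      e (j + 1) z - nullHomotopy a e j (bd k ι j z) := by
    intro j
    induction j with
    | zero =>
      intro z
      induction z using Finsupp.induction_linear with
      | zero => simp
      | add f g hf hg => simp only [map_add, hf, hg]; abel
      | single v c =>
        rw [← mul_one c, ← smul_eq_mul, ← Finsupp.smul_single]
        simp only [map_smul]
        rw [← smul_sub]
        congr 1
        rw [nullHomotopy_succ_single, bd_cone_succ,
          map_sub, he, he0]
        simp [nullHomotopy]
    | succ j ih =>
      intro z
      induction z using Finsupp.induction_linear with
      | zero => simp
      | add f g hf hg => simp only [map_add, hf, hg]; abel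
      | single v c =>
        rw [← mul_one c, ← smul_eq_mul, ← Finsupp.smul_single]
        simp only [map_smul]
        rw [← smul_sub]
        congr 1
        rw [nullHomotopy_succ_single, bd_cone_succ,
          map_sub, he, ih, bd_bd]
        simp
  cases j with
  | zero => simp [nullHomotopy, he0]
  | succ j => rw [key, LinearMap.mem_ker.1 hz, map_zero, sub_zero]

/-- A null homotopy stays in a carrier: `Φ v` is the family carrying the tuple `v`. -/
theorem nullHomotopy_mem_supported {κ : Type*} (a : ∀ j, (Fin (j + 1) → ι) → κ)
    (e : ∀ j, ((Fin j → ι) →₀ k) →ₗ[k] ((Fin j → κ) →₀ k))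
    {X : ∀ j, Set (Fin j → ι)} (hX : FaceClosed X)
    (Φ : ∀ j, (Fin j → ι) → ∀ i, Set (Fin i → κ))
    (hΦ : ∀ j, ∀ v ∈ X (j + 1), ∀ i m, Φ j (fun l => v (Fin.succAbove i l)) m ⊆ Φ (j + 1) v m)
    (he : ∀ j, ∀ v ∈ X j, e j (Finsupp.single v 1) ∈ Finsupp.supported k k (Φ j v j))
    (ha : ∀ j, ∀ v ∈ X (j + 1), ∀ m, ∀ u ∈ Φ (j + 1) v m,
      (Fin.cons (a j v) u : Fin (m + 1) → κ) ∈ Φ (j + 1) v (m + 1))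
    (j : ℕ) (v : Fin j → ι) (hv : v ∈ X j) :
    nullHomotopy a e j (Finsupp.single v 1) ∈ Finsupp.supported k k (Φ j v (j + 1)) := by
  induction j with
  | zero => simp [nullHomotopy]
  | succ j ih =>
    rw [nullHomotopy_succ_single]
    refine cone_mem_supported (X := Φ (j + 1) v) (Y := Φ (j + 1) v) (ha j v hv _)
      (Submodule.sub_mem _ (he _ v hv) ?_)
    rw [bd_single, map_sum]
    refine Submodule.sum_mem _ fun i _ => ?_
    rw [map_smul]
    exact Submodule.smul_mem _ _
      (Finsupp.supported_mono (hΦ j v hv i _) (ih _ (hX j v hv i)))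

/-! ### Change of coefficients -/

/-- Boundary coefficients are signs, so additivity of `f` suffices. This matters because coordinate
maps from a field to `ℚ` are not ring homomorphisms. -/
theorem bd_mapRange {k' : Type*} [CommRing k'] (f : k →+ k') (j : ℕ)
    (w : (Fin (j + 1) → ι) →₀ k) :
    bd k' ι j (Finsupp.mapRange.addMonoidHom f w) =
      Finsupp.mapRange.addMonoidHom f (bd k ι j w) := by
  induction w using Finsupp.induction_linear with
  | zero => simp
  | add f g hf hg => simp only [map_add, hf, hg]
  | single v c =>
    have h1 : Finsupp.mapRange.addMonoidHom f (Finsupp.single v c) = Finsupp.single v (f c) := by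
      simp
    rw [h1, bd_single, bd_single, map_sum]
    refine Finset.sum_congr rfl fun i _ => ?_
    rw [Finsupp.smul_single, Finsupp.smul_single, Finsupp.mapRange.addMonoidHom_apply,
      Finsupp.mapRange_single]
    rcases neg_one_pow_eq_or ℤ (i : ℕ) with h | h
    · have h2 : (-1 : k) ^ (i : ℕ) = 1 := by exact_mod_cast congrArg (Int.cast : ℤ → k) h
      have h3 : (-1 : k') ^ (i : ℕ) = 1 := by exact_mod_cast congrArg (Int.cast : ℤ → k') h
      simp [h2, h3]
    · have h2 : (-1 : k) ^ (i : ℕ) = -1 := by exact_mod_cast congrArg (Int.cast : ℤ → k) h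
      have h3 : (-1 : k') ^ (i : ℕ) = -1 := by exact_mod_cast congrArg (Int.cast : ℤ → k') h
      simp [h2, h3]

theorem mapRange_mem_supported {α k' : Type*} [CommRing k'] (f : k →+ k') {s : Set α}
    {z : α →₀ k} (hz : z ∈ Finsupp.supported k k s) :
    Finsupp.mapRange.addMonoidHom f z ∈ Finsupp.supported k' k' s := by
  rw [Finsupp.mem_supported'] at hz ⊢
  intro x hx
  simp [hz x hx]

theorem mapRange_mem_cyc {k' : Type*} [CommRing k'] (f : k →+ k') {j : ℕ}
    {z : (Fin j → ι) →₀ k} (hz : z ∈ cyc k ι j) :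
    Finsupp.mapRange.addMonoidHom f z ∈ cyc k' ι j := by
  cases j with
  | zero => exact Submodule.mem_top
  | succ j =>
    exact LinearMap.mem_ker.2 (by rw [bd_mapRange, LinearMap.mem_ker.1 hz, map_zero])

/-- Exactness over `ℚ` implies exactness over every field of characteristic zero. -/
theorem ExactAt.of_rat {k : Type*} [Field k] [CharZero k] {X : ∀ j, Set (Fin j → ι)} {j : ℕ}
    (h : ExactAt ℚ X j) : ExactAt k X j := by
  intro z hz hc
  classical
  -- A chain over `k` is a finite sum of rational chains times elements of a `ℚ`-basis of `k`; each
  -- rational coordinate of a cycle is a cycle and can be filled separately.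
  let b := Module.Basis.ofVectorSpace ℚ k
  let p : Module.Basis.ofVectorSpaceIndex ℚ k → k →+ ℚ := fun i => (b.coord i).toAddMonoidHom
  let r : Module.Basis.ofVectorSpaceIndex ℚ k → ℚ →+ k := fun i =>
    (LinearMap.toSpanSingleton ℚ k (b i)).toAddMonoidHom
  choose w hw hwz using fun i => h _ (mapRange_mem_supported (p i) hz) (mapRange_mem_cyc (p i) hc)
  let S : Finset (Module.Basis.ofVectorSpaceIndex ℚ k) :=
    z.support.biUnion fun v => (b.repr (z v)).support
  refine ⟨∑ i ∈ S, Finsupp.mapRange.addMonoidHom (r i) (w i),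
    Submodule.sum_mem _ fun i _ => mapRange_mem_supported _ (hw i), ?_⟩
  rw [map_sum]
  simp only [bd_mapRange, hwz]
  ext v
  rw [Finsupp.finsetSum_apply]
  have hterm : ∀ i, (Finsupp.mapRange.addMonoidHom (r i) (Finsupp.mapRange.addMonoidHom (p i) z)) v
      = b.repr (z v) i • b i := fun i => by simp [p, r]
  simp only [hterm]
  conv_rhs => rw [← b.linearCombination_repr (z v), Finsupp.linearCombination_apply, Finsupp.sum]
  symm
  by_cases hv : v ∈ z.support
  · refine Finset.sum_subset (Finset.subset_biUnion_of_mem (fun v => (b.repr (z v)).support) hv) ?_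
    intro i _ hi
    rw [Finsupp.notMem_support_iff.1 hi, zero_smul]
  · rw [Finsupp.notMem_support_iff.1 hv]; simp

/-! ### Simplicial complexes -/

/-- The tuples whose entries lie in one simplex of `K`. -/
def tuples (K : PreAbstractSimplicialComplex ι) (j : ℕ) : Set (Fin j → ι) :=
  {v | ∃ σ, K.IsSimplex σ ∧ ∀ i, v i ∈ σ}

theorem faceClosed_tuples (K : PreAbstractSimplicialComplex ι) : FaceClosed (tuples K) :=
  fun _ _ ⟨σ, hσ, h⟩ _ => ⟨σ, hσ, fun _ => h _⟩

/-- Chains on the subtype of ordered simplices embed as the supported chains among those on all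
tuples, compatibly with boundaries. Working with supports makes unions, intersections and cones of
families easy to handle. -/
theorem subsingleton_reducedHomology {K : PreAbstractSimplicialComplex ι} {j : ℕ}
    (h : ExactAt k (tuples K) j) : Subsingleton (K.ReducedHomology k j) := by
  let inc : ∀ j, (K.OrderedSimplex j →₀ k) →ₗ[k] ((Fin j → ι) →₀ k) := fun j =>
    Finsupp.lmapDomain k k Subtype.val
  have hinj : ∀ j, Function.Injective (inc j) := fun j =>
    Finsupp.mapDomain_injective Subtype.val_injective
  have hbd : ∀ j w, bd k ι j (inc (j + 1) w) = inc j (K.boundary k j w) := by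
    intro j w
    induction w using Finsupp.induction_linear with
    | zero => simp
    | add f g hf hg => simp [hf, hg]
    | single v c =>
      simp only [inc, Finsupp.lmapDomain_apply, Finsupp.mapDomain_single, bd_single,
        PreAbstractSimplicialComplex.boundary, Finsupp.linearCombination_single]
      rw [← Finsupp.lmapDomain_apply k k, map_smul, map_sum, Finset.smul_sum]
      refine Finset.sum_congr rfl fun i _ => ?_
      rw [map_smul, Finsupp.lmapDomain_apply, Finsupp.mapDomain_single, smul_comm,
        Finsupp.smul_single_one]
      rfl
  have hsupp : ∀ j w, inc j w ∈ Finsupp.supported k k (tuples K j) := by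
    intro j w
    induction w using Finsupp.induction_linear with
    | zero => simp
    | add f g hf hg => rw [map_add]; exact Submodule.add_mem _ hf hg
    | single v c =>
      simp only [inc, Finsupp.lmapDomain_apply, Finsupp.mapDomain_single]
      exact Finsupp.single_mem_supported _ _ v.2
  have hsurj : ∀ j, ∀ w ∈ Finsupp.supported k k (tuples K j), ∃ u, inc j u = w := by
    intro j w hw
    rw [Finsupp.supported_eq_span_single] at hw
    refine (Submodule.span_le (p := LinearMap.range (inc j))).2 ?_ hw
    rintro _ ⟨v, hv, rfl⟩
    exact ⟨Finsupp.single ⟨v, hv⟩ 1, by simp [inc]⟩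
  refine Submodule.Quotient.subsingleton_iff.2 (eq_top_iff.2 ?_)
  rintro ⟨z, hz⟩ -
  have hzc : inc j z ∈ cyc k ι j := by
    cases j with
    | zero => exact Submodule.mem_top
    | succ j =>
      refine LinearMap.mem_ker.2 ?_
      rw [hbd, LinearMap.mem_ker.1 hz, map_zero]
  obtain ⟨w, hw, hwz⟩ := h _ (hsupp j z) hzc
  obtain ⟨u, rfl⟩ := hsurj _ w hw
  rw [hbd] at hwz
  exact ⟨u, hinj j hwz⟩

theorem isConnectedOver_of_acyclic {K : PreAbstractSimplicialComplex ι} {t : ℤ}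
    (h : Acyclic k (tuples K) t) : K.IsConnectedOver k t :=
  fun j hj => subsingleton_reducedHomology (h j hj)

end TupleChain

namespace TupleChain

variable {ι : Type*}

/-! ### Antisymmetrization -/

/-- The sign of a permutation as a rational number. -/
def ratSign {j : ℕ} (π : Equiv.Perm (Fin j)) : ℚ := ((Equiv.Perm.sign π : ℤ) : ℚ)

theorem ratSign_mul {j : ℕ} (π ρ : Equiv.Perm (Fin j)) :
    ratSign (π * ρ) = ratSign π * ratSign ρ := by
  simp [ratSign]

theorem ratSign_inv {j : ℕ} (π : Equiv.Perm (Fin j)) : ratSign π⁻¹ = ratSign π := by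
  simp [ratSign]

theorem ratSign_mul_self {j : ℕ} (π : Equiv.Perm (Fin j)) : ratSign π * ratSign π = 1 := by
  rw [ratSign]
  rcases Int.units_eq_one_or (Equiv.Perm.sign π) with h | h <;> simp [h]

theorem ratSign_cycleRange {j : ℕ} (i : Fin j) : ratSign i.cycleRange = (-1) ^ (i : ℕ) := by
  simp [ratSign]

/-- Antisymmetrization of chains. -/
noncomputable def alt (ι : Type*) (j : ℕ) : ((Fin j → ι) →₀ ℚ) →ₗ[ℚ] ((Fin j → ι) →₀ ℚ) :=
  (j.factorial : ℚ)⁻¹ • ∑ π : Equiv.Perm (Fin j),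
    ratSign π • Finsupp.lmapDomain ℚ ℚ fun v : Fin j → ι => v ∘ π

theorem alt_single (j : ℕ) (v : Fin j → ι) (c : ℚ) :
    alt ι j (Finsupp.single v c) = (j.factorial : ℚ)⁻¹ • ∑ π : Equiv.Perm (Fin j),
      ratSign π • Finsupp.single (v ∘ π) c := by
  simp [alt]

/-- A permutation is determined by the image `l` of `0` and a permutation of the remaining
positions; `l.cycleRange⁻¹` is the order-preserving way of sending `0` to `l`, and its sign is the
sign in the boundary. -/
theorem sum_perm_succ {M : Type*} [AddCommMonoid M] {j : ℕ}
    (f : Equiv.Perm (Fin (j + 1)) → M) :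
    ∑ π, f π = ∑ l : Fin (j + 1), ∑ ρ : Equiv.Perm (Fin j),
      f (l.cycleRange⁻¹ * Equiv.Perm.decomposeFin.symm (0, ρ)) := by
  rw [← Fintype.sum_prod_type']
  symm
  refine Function.Bijective.sum_comp (e := fun x : Fin (j + 1) × Equiv.Perm (Fin j) =>
    x.1.cycleRange⁻¹ * Equiv.Perm.decomposeFin.symm (0, x.2)) ?_ f
  rw [Fintype.bijective_iff_injective_and_card]
  constructor
  · rintro ⟨l, ρ⟩ ⟨l', ρ'⟩ h
    have h0 := congrArg (fun π : Equiv.Perm (Fin (j + 1)) => π 0) h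
    simp only [Equiv.Perm.mul_apply, Equiv.Perm.decomposeFin_symm_apply_zero] at h0
    have hl : l = l' := by
      simpa [Equiv.Perm.inv_def] using h0
    subst hl
    have := Equiv.Perm.decomposeFin.symm.injective (mul_left_cancel h)
    simpa using this
  · rw [Fintype.card_prod, Fintype.card_perm, Fintype.card_perm, Fintype.card_fin,
      Fintype.card_fin, Nat.factorial_succ]

/-- After antisymmetrization all `j + 1` faces contribute equally: precomposing with `i.cycleRange`
turns the `i`-th face into the one omitting position `0` and absorbs its sign. The factor `j + 1`
adjusts the factorial. -/
theorem bd_alt (j : ℕ) (w : (Fin (j + 1) → ι) →₀ ℚ) :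
    bd ℚ ι j (alt ι (j + 1) w) = alt ι j (bd ℚ ι j w) := by
  induction w using Finsupp.induction_linear with
  | zero => simp
  | add f g hf hg => simp [hf, hg]
  | single v c =>
    have hL : bd ℚ ι j (∑ π : Equiv.Perm (Fin (j + 1)), ratSign π • Finsupp.single (v ∘ π) c) =
        ((j : ℚ) + 1) • ∑ π : Equiv.Perm (Fin (j + 1)), ratSign π •
          Finsupp.single (fun l : Fin j => v (π l.succ)) c := by
      simp only [map_sum, map_smul, bd_single, Finset.smul_sum]
      rw [Finset.sum_comm]
      have : ∀ i : Fin (j + 1), ∑ π : Equiv.Perm (Fin (j + 1)), ratSign π • (-1 : ℚ) ^ (i : ℕ) •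
          Finsupp.single (fun l => (v ∘ π) (i.succAbove l)) c =
          ∑ π : Equiv.Perm (Fin (j + 1)), ratSign π •
          Finsupp.single (fun l : Fin j => v (π l.succ)) c := by
        intro i
        rw [← Equiv.sum_comp (Equiv.mulRight i.cycleRange)]
        refine Finset.sum_congr rfl fun π _ => ?_
        rw [Equiv.coe_mulRight, ratSign_mul, smul_smul, mul_assoc, ← ratSign_cycleRange,
          ratSign_mul_self, mul_one]
        simp
      simp only [this]
      rw [← Finset.smul_sum, Finset.sum_const, Finset.card_univ, Fintype.card_fin,
        ← Nat.cast_smul_eq_nsmul ℚ]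
      push_cast
      rfl
    have hR : alt ι j (∑ i : Fin (j + 1), (-1 : ℚ) ^ (i : ℕ) •
        Finsupp.single (fun l => v (i.succAbove l)) c) =
        (j.factorial : ℚ)⁻¹ • ∑ π : Equiv.Perm (Fin (j + 1)), ratSign π •
          Finsupp.single (fun l : Fin j => v (π l.succ)) c := by
      rw [sum_perm_succ, map_sum, Finset.smul_sum]
      refine Finset.sum_congr rfl fun i _ => ?_
      rw [map_smul, alt_single, smul_comm]
      congr 1
      rw [Finset.smul_sum]
      refine Finset.sum_congr rfl fun ρ _ => ?_
      rw [smul_smul, ratSign_mul, ratSign_inv, ratSign_cycleRange]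
      congr 2
      · simp [ratSign]
      · funext l
        simp [Equiv.Perm.inv_def]
    rw [alt_single, map_smul, hL, bd_single, hR, smul_smul, Nat.factorial_succ]
    congr 1
    push_cast
    have : ((j : ℚ) + 1) ≠ 0 := by positivity
    field_simp

/-- A chain is antisymmetric. -/
def Antisymm {j : ℕ} (f : (Fin j → ι) →₀ ℚ) : Prop :=
  ∀ (π : Equiv.Perm (Fin j)) (v : Fin j → ι), f (v ∘ π) = ratSign π * f v

theorem alt_apply (j : ℕ) (f : (Fin j → ι) →₀ ℚ) (v : Fin j → ι) :
    alt ι j f v = (j.factorial : ℚ)⁻¹ * ∑ π : Equiv.Perm (Fin j), ratSign π * f (v ∘ π) := by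
  rw [alt, ← Equiv.sum_comp (Equiv.inv (Equiv.Perm (Fin j)))]
  simp only [Equiv.inv_apply, LinearMap.smul_apply, LinearMap.sum_apply, Finsupp.smul_apply,
    Finsupp.finsetSum_apply, Finsupp.lmapDomain_apply, smul_eq_mul, ratSign_inv]
  congr 1
  refine Finset.sum_congr rfl fun π _ => ?_
  congr 1
  have : v = (v ∘ π) ∘ (π⁻¹ : Equiv.Perm (Fin j)) := by
    funext i; simp
  conv_lhs => rw [this]
  exact Finsupp.mapDomain_apply (f := fun v : Fin j → ι => v ∘ (π⁻¹ : Equiv.Perm (Fin j)))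
    (fun a b h => (π⁻¹ : Equiv.Perm (Fin j)).surjective.injective_comp_right h) f (v ∘ π)

theorem antisymm_alt (j : ℕ) (f : (Fin j → ι) →₀ ℚ) : Antisymm (alt ι j f) := by
  intro π v
  rw [alt_apply, alt_apply, mul_left_comm]
  congr 1
  rw [Finset.mul_sum, ← Equiv.sum_comp (Equiv.mulLeft π⁻¹)]
  refine Finset.sum_congr rfl fun ρ _ => ?_
  rw [Equiv.coe_mulLeft, ratSign_mul, ratSign_inv, mul_assoc]
  congr 3
  funext i
  simp

theorem Antisymm.alt_eq {j : ℕ} {f : (Fin j → ι) →₀ ℚ} (hf : Antisymm f) : alt ι j f = f := by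
  ext v
  rw [alt_apply]
  simp only [hf _ v, ← mul_assoc, ratSign_mul_self, one_mul]
  simp [Fintype.card_perm, Nat.factorial_ne_zero]

/-- Swapping two equal entries fixes the tuple but changes the sign. Thus antisymmetric chains see
only honest simplices, for which the number of entries is the number of vertices. -/
theorem Antisymm.injective_of_ne_zero {j : ℕ} {f : (Fin j → ι) →₀ ℚ} (hf : Antisymm f)
    {v : Fin j → ι} (hv : f v ≠ 0) : Function.Injective v := by
  intro a b hab
  by_contra hne
  have h := hf (Equiv.swap a b) v
  have h2 : v ∘ Equiv.swap a b = v := by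
    funext i
    rw [Function.comp_apply, Equiv.swap_apply_def]
    split_ifs <;> simp_all
  rw [h2, ratSign, Equiv.Perm.sign_swap hne] at h
  apply hv
  push_cast at h
  linarith

theorem Antisymm.cons_removeNth {j : ℕ} {f : (Fin (j + 1) → ι) →₀ ℚ} (hf : Antisymm f)
    (v : Fin (j + 1) → ι) (i : Fin (j + 1)) :
    f (Fin.cons (v i) (i.removeNth v)) = (-1) ^ (i : ℕ) * f v := by
  rw [Fin.cons_removeNth_eq_comp_cycleRange_symm]
  have := hf i.cycleRange⁻¹ v
  rw [ratSign_inv, ratSign_cycleRange] at this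
  exact this

/-- On a family of tuples closed under selection of entries, every cycle is homologous to an
antisymmetric one. -/
theorem exists_bd_eq_alt_sub {X : ∀ j, Set (Fin j → ι)}
    (hX : ∀ j m (v : Fin j → ι) (u : Fin m → ι), v ∈ X j → Set.range u ⊆ Set.range v → u ∈ X m)
    {j : ℕ} {z : (Fin j → ι) →₀ ℚ} (hz : z ∈ Finsupp.supported ℚ ℚ (X j)) (hc : z ∈ cyc ℚ ι j) :
    ∃ w ∈ Finsupp.supported ℚ ℚ (X (j + 1)), bd ℚ ι j w = alt ι j z - z := by
  -- The carrier of `v` is the family of all tuples with entries among those of `v`, a cone from any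
  -- entry; `alt - id` is carried by it and vanishes on the empty tuple.
  let e : ∀ j, ((Fin j → ι) →₀ ℚ) →ₗ[ℚ] ((Fin j → ι) →₀ ℚ) := fun j => alt ι j - LinearMap.id
  have he : ∀ j w, bd ℚ ι j (e (j + 1) w) = e j (bd ℚ ι j w) := fun j w => by
    simp [e, bd_alt]
  have he0 : e 0 = 0 := by
    refine LinearMap.ext fun f => ?_
    have : Antisymm f := fun π v => by
      rw [Subsingleton.elim π 1]; simp [ratSign]
    simp [e, this.alt_eq]
  have hXc : FaceClosed X := fun j v hv i => hX _ _ v _ hv (by rintro _ ⟨l, rfl⟩; exact ⟨_, rfl⟩)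
  refine ⟨nullHomotopy (fun j v => v 0) e j z, ?_, bd_nullHomotopy _ e he he0 j z hc⟩
  refine map_mem_of_single _ _ (fun v hv => ?_) hz
  refine Finsupp.supported_mono ?_ (nullHomotopy_mem_supported _ e hXc
    (fun j v m => {u | Set.range u ⊆ Set.range v}) ?_ ?_ ?_ j v hv)
  · exact fun u hu => hX _ _ v u hv hu
  · intro j v _ i m u hu
    refine Set.Subset.trans hu ?_
    rintro _ ⟨l, rfl⟩
    exact ⟨_, rfl⟩
  · intro j v _
    simp only [e, LinearMap.sub_apply, LinearMap.id_apply, alt_single]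
    refine Submodule.sub_mem _ (Submodule.smul_mem _ _ (Submodule.sum_mem _ fun π _ =>
      Submodule.smul_mem _ _ (Finsupp.single_mem_supported _ _ ?_)))
      (Finsupp.single_mem_supported _ _ (Set.Subset.refl _))
    exact Set.range_comp_subset_range _ _
  · intro j v _ m u hu
    rintro _ ⟨l, rfl⟩
    refine Fin.cases ?_ (fun l => ?_) l
    · exact ⟨0, by simp⟩
    · simpa using hu ⟨l, rfl⟩

/-! ### Garland's method -/

theorem bd_apply [Fintype ι] (j : ℕ) (f : (Fin (j + 1) → ι) →₀ ℚ) (τ : Fin j → ι) :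
    bd ℚ ι j f τ = ∑ i : Fin (j + 1), ∑ x, (-1) ^ (i : ℕ) * f (i.insertNth x τ) := by
  classical
  induction f using Finsupp.induction_linear with
  | zero => simp
  | add f g hf hg => simp [hf, hg, mul_add, Finset.sum_add_distrib]
  | single v c =>
    rw [bd_single, Finsupp.finsetSum_apply]
    refine Finset.sum_congr rfl fun i _ => ?_
    rw [Finsupp.smul_apply, smul_eq_mul, ← Finset.mul_sum]
    congr 1
    rw [Finset.sum_eq_single (v i)]
    · by_cases h : (fun l => v (i.succAbove l)) = τ
      · subst h
        have : i.insertNth (v i) (fun l => v (i.succAbove l)) = v := Fin.insertNth_self_removeNth i v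
        rw [this]; simp
      · rw [Finsupp.single_eq_of_ne (Ne.symm h), Finsupp.single_eq_of_ne]
        intro h'
        refine h (funext fun l => ?_)
        rw [← h']
        simp
    · intro x _ hx
      rw [Finsupp.single_eq_of_ne]
      rintro rfl
      simp at hx
    · simp

/-- By antisymmetry, inserting a vertex at any position contributes the same to the boundary. So
being a cycle says that each local function `x ↦ f (x, τ)` is orthogonal to the constants, which is
what a spectral gap needs. -/
theorem Antisymm.sum_cons_eq_zero [Fintype ι] {j : ℕ} {f : (Fin (j + 1) → ι) →₀ ℚ}
    (hf : Antisymm f) (hc : bd ℚ ι j f = 0) (τ : Fin j → ι) :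
    ∑ x, f (Fin.cons x τ : Fin (j + 1) → ι) = 0 := by
  have h := bd_apply j f τ
  have h2 : ∀ (i : Fin (j + 1)) (x : ι), (-1) ^ (i : ℕ) * f (i.insertNth x τ) =
      f (Fin.cons x τ : Fin (j + 1) → ι) := by
    intro i x
    rw [← hf.cons_removeNth]
    simp
  simp only [h2, hc, Finsupp.coe_zero, Pi.zero_apply, Finset.sum_const, Finset.card_univ,
    Fintype.card_fin, nsmul_eq_mul] at h
  have : ((j + 1 : ℕ) : ℚ) ≠ 0 := by positivity
  exact (mul_eq_zero.1 h.symm).resolve_left this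

open Classical in
/-- The vertices of the link of `σ` in `K`. -/
noncomputable def linkVertices [Fintype ι] [DecidableEq ι]
    (K : PreAbstractSimplicialComplex ι) (σ : Finset ι) : Finset ι :=
  Finset.univ.filter fun y => y ∉ σ ∧ insert y σ ∈ K

theorem mem_linkVertices [Fintype ι] [DecidableEq ι] {K : PreAbstractSimplicialComplex ι}
    {σ : Finset ι} {y : ι} : y ∈ linkVertices K σ ↔ y ∉ σ ∧ insert y σ ∈ K := by
  simp [linkVertices]

theorem mem_of_subset {K : PreAbstractSimplicialComplex ι} {σ τ : Finset ι} (hσ : K.IsSimplex σ)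
    (h : τ ⊆ σ) (hne : τ.Nonempty) : τ ∈ K := by
  rcases hσ with rfl | hσ
  · exact absurd (Finset.subset_empty.1 h) hne.ne_empty
  · exact (K.isRelLowerSet_faces hσ).2 h hne

theorem isSimplex_of_subset {K : PreAbstractSimplicialComplex ι} {σ τ : Finset ι}
    (hσ : K.IsSimplex σ) (h : τ ⊆ σ) : K.IsSimplex τ :=
  τ.eq_empty_or_nonempty.imp id (mem_of_subset hσ h)

variable [Fintype ι] [DecidableEq ι]

/-- Send a tuple `v` to the sum of the cones over it from the vertices of its link. -/
noncomputable def linkCone (K : PreAbstractSimplicialComplex ι) (j : ℕ) :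
    ((Fin j → ι) →₀ ℚ) →ₗ[ℚ] ((Fin (j + 1) → ι) →₀ ℚ) :=
  Finsupp.linearCombination ℚ fun v =>
    ∑ y ∈ linkVertices K (Finset.univ.image v), cone ℚ y j (Finsupp.single v 1)

/-- Send a tuple `v` to the sum of the cones over its boundary from the vertices of its link. -/
noncomputable def linkConeBd (K : PreAbstractSimplicialComplex ι) (j : ℕ) :
    ((Fin (j + 1) → ι) →₀ ℚ) →ₗ[ℚ] ((Fin (j + 1) → ι) →₀ ℚ) :=
  Finsupp.linearCombination ℚ fun v =>
    ∑ y ∈ linkVertices K (Finset.univ.image v), cone ℚ y j (bd ℚ ι j (Finsupp.single v 1))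

theorem linkCone_mem {K : PreAbstractSimplicialComplex ι} {j : ℕ} (z : (Fin j → ι) →₀ ℚ) :
    linkCone K j z ∈ Finsupp.supported ℚ ℚ (tuples K (j + 1)) := by
  refine map_mem_of_single (s := Set.univ) _ _ (fun v _ => ?_) (by simp)
  rw [linkCone, Finsupp.linearCombination_single, one_smul]
  refine Submodule.sum_mem _ fun y hy => ?_
  rw [cone_single]
  refine Finsupp.single_mem_supported _ _ ⟨_, Or.inr (mem_linkVertices.1 hy).2, fun i => ?_⟩
  refine Fin.cases ?_ (fun l => ?_) i <;> simp

theorem linkConeBd_mem {K : PreAbstractSimplicialComplex ι} {j : ℕ} (z : (Fin (j + 1) → ι) →₀ ℚ) :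
    linkConeBd K j z ∈ Finsupp.supported ℚ ℚ (tuples K (j + 1)) := by
  refine map_mem_of_single (s := Set.univ) _ _ (fun v _ => ?_) (by simp)
  rw [linkConeBd, Finsupp.linearCombination_single, one_smul]
  refine Submodule.sum_mem _ fun y hy => ?_
  rw [bd_single, map_sum]
  refine Submodule.sum_mem _ fun i _ => ?_
  rw [map_smul, cone_single]
  refine Submodule.smul_mem _ _
    (Finsupp.single_mem_supported _ _ ⟨_, Or.inr (mem_linkVertices.1 hy).2, fun l => ?_⟩)
  refine Fin.cases ?_ (fun l => ?_) l <;> simp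

/-- Each of the `D` cones over `v` has boundary `v` minus the cone over the boundary of `v`.
Antisymmetry guarantees that the tuples involved have `j + 1` distinct vertices, so that `hD`
applies. -/
theorem bd_linkCone {K : PreAbstractSimplicialComplex ι} {j D : ℕ}
    (hD : ∀ σ, K.IsSimplex σ → σ.card = j + 1 → (linkVertices K σ).card = D)
    {f : (Fin (j + 1) → ι) →₀ ℚ} (hf : Antisymm f)
    (hK : f ∈ Finsupp.supported ℚ ℚ (tuples K (j + 1))) :
    bd ℚ ι (j + 1) (linkCone K (j + 1) f) = (D : ℚ) • f - linkConeBd K j f := by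
  have hs : f ∈ Finsupp.supported ℚ ℚ {v | v ∈ tuples K (j + 1) ∧ Function.Injective v} := by
    rw [Finsupp.mem_supported]
    intro v hv
    exact ⟨hK hv, hf.injective_of_ne_zero (Finsupp.mem_support_iff.1 hv)⟩
  have := map_mem_of_single (bd ℚ ι (j + 1) ∘ₗ linkCone K (j + 1) -
    ((D : ℚ) • LinearMap.id - linkConeBd K j)) ⊥ ?_ hs
  · exact sub_eq_zero.1 ((Submodule.mem_bot ℚ).1 this)
  · rintro v ⟨⟨σ, hσ, hv⟩, hinj⟩
    rw [Submodule.mem_bot]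
    simp only [LinearMap.sub_apply, LinearMap.comp_apply, linkCone, linkConeBd,
      Finsupp.linearCombination_single, one_smul, LinearMap.smul_apply, LinearMap.id_apply,
      map_sum, bd_cone_succ, Finset.sum_sub_distrib]
    have hcard := hD (Finset.univ.image v)
      (isSimplex_of_subset hσ (by simpa [Finset.image_subset_iff] using hv))
      (by rw [Finset.card_image_of_injective _ hinj]; simp)
    rw [Finset.sum_const, hcard, ← Nat.cast_smul_eq_nsmul ℚ, sub_self]

/-- The pairing of `linkConeBd f` with `f` is a sum of local terms. -/
theorem sum_linkConeBd_mul (K : PreAbstractSimplicialComplex ι) {j : ℕ}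
    {f : (Fin (j + 1) → ι) →₀ ℚ} (hf : Antisymm f) :
    ∑ u, linkConeBd K j f u * f u = (j + 1) * ∑ τ : Fin j → ι, ∑ x,
      ∑ y ∈ linkVertices K (insert x (Finset.univ.image τ)),
        f (Fin.cons x τ : Fin (j + 1) → ι) * f (Fin.cons y τ : Fin (j + 1) → ι) := by
  have h1 : ∀ g : (Fin (j + 1) → ι) →₀ ℚ, ∑ u, g u * f u =
      Finsupp.linearCombination ℚ (fun u => f u) g := by
    intro g
    rw [Finsupp.linearCombination_apply, Finsupp.sum_fintype _ _ (by simp)]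
    rfl
  rw [h1, linkConeBd, Finsupp.linearCombination_apply (R := ℚ) (l := f),
    Finsupp.sum_fintype _ _ (by simp), map_sum]
  have h2 : ∀ v : Fin (j + 1) → ι, Finsupp.linearCombination ℚ (fun u => f u)
      (f v • ∑ y ∈ linkVertices K (Finset.univ.image v),
        cone ℚ y j (bd ℚ ι j (Finsupp.single v 1))) =
      ∑ i : Fin (j + 1), ∑ y ∈ linkVertices K (Finset.univ.image v),
        f (Fin.cons (v i) (i.removeNth v)) * f (Fin.cons y (i.removeNth v)) := by
    intro v
    rw [map_smul, map_sum, Finset.smul_sum, Finset.sum_comm]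
    refine Finset.sum_congr rfl fun y _ => ?_
    rw [bd_single, map_sum, map_sum, Finset.smul_sum]
    refine Finset.sum_congr rfl fun i _ => ?_
    rw [map_smul, cone_single, map_smul, Finsupp.linearCombination_single, hf.cons_removeNth]
    simp only [smul_eq_mul, one_mul]
    rw [mul_left_comm, mul_assoc]
    rfl
  simp only [h2]
  rw [Finset.sum_comm]
  -- Splitting `v` into its `i`-th entry and the rest gives the same sum for every `i`, whence the
  -- factor `j + 1`.
  have h3 : ∀ i : Fin (j + 1), ∑ v : Fin (j + 1) → ι, ∑ y ∈ linkVertices K (Finset.univ.image v),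
      f (Fin.cons (v i) (i.removeNth v)) * f (Fin.cons y (i.removeNth v)) =
      ∑ τ : Fin j → ι, ∑ x, ∑ y ∈ linkVertices K (insert x (Finset.univ.image τ)),
        f (Fin.cons x τ : Fin (j + 1) → ι) * f (Fin.cons y τ : Fin (j + 1) → ι) := by
    intro i
    rw [← Equiv.sum_comp (Fin.insertNthEquiv (fun _ => ι) i), Fintype.sum_prod_type_right]
    refine Finset.sum_congr rfl fun τ _ => Finset.sum_congr rfl fun x _ => ?_
    have him : Finset.univ.image (i.insertNth x τ : Fin (j + 1) → ι) =
        insert x (Finset.univ.image τ) := by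
      ext y
      simp only [Finset.mem_image, Finset.mem_univ, true_and, Finset.mem_insert,
        Fin.exists_iff_succAbove i]
      simp [eq_comm]
    have he : Fin.insertNthEquiv (fun _ => ι) i (x, τ) = i.insertNth x τ := rfl
    rw [he, him]
    simp only [Fin.insertNth_apply_same, Fin.removeNth_insertNth]
  simp only [h3]
  simp

/-- Garland's method: the homology of `K` in degree `m` vanishes if the spectral gaps of the links
of the simplices with `m` vertices are large. -/
theorem exactAt_of_link_gap (K : PreAbstractSimplicialComplex ι) (m D : ℕ) (T : ℚ)
    (hD : ∀ σ, K.IsSimplex σ → σ.card = m + 1 → (linkVertices K σ).card = D)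
    (hT : ∀ τ, K.IsSimplex τ → τ.card = m → ∀ g : ι → ℚ, (∀ x ∉ linkVertices K τ, g x = 0) →
      ∑ x, g x = 0 →
      ∑ x, ∑ y ∈ linkVertices K (insert x τ), g x * g y ≤ T * ∑ x, g x ^ 2)
    (h : (m + 1) * T < D) : ExactAt ℚ (tuples K) (m + 1) := by
  intro z hz hc
  have htup : ∀ j m (v : Fin j → ι) (u : Fin m → ι), v ∈ tuples K j →
      Set.range u ⊆ Set.range v → u ∈ tuples K m := by
    rintro j m v u ⟨σ, hσ, hv⟩ hu
    refine ⟨σ, hσ, fun i => ?_⟩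
    obtain ⟨l, hl⟩ := hu ⟨i, rfl⟩
    exact hl ▸ hv l
  have halt : ∀ j, ∀ f ∈ Finsupp.supported ℚ ℚ (tuples K j),
      alt ι j f ∈ Finsupp.supported ℚ ℚ (tuples K j) := by
    intro j f hf
    refine map_mem_of_single _ _ (fun v hv => ?_) hf
    rw [alt_single]
    exact Submodule.smul_mem _ _ (Submodule.sum_mem _ fun π _ => Submodule.smul_mem _ _
      (Finsupp.single_mem_supported _ _ (htup _ _ v _ hv (Set.range_comp_subset_range _ _))))
  let Z : Submodule ℚ ((Fin (m + 1) → ι) →₀ ℚ) :=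
    LinearMap.ker (alt ι (m + 1) - LinearMap.id) ⊓
      (Finsupp.supported ℚ ℚ (tuples K (m + 1)) ⊓ LinearMap.ker (bd ℚ ι m))
  have hZ : ∀ f, f ∈ Z ↔ Antisymm f ∧ f ∈ Finsupp.supported ℚ ℚ (tuples K (m + 1)) ∧
      bd ℚ ι m f = 0 := by
    intro f
    have : f ∈ LinearMap.ker (alt ι (m + 1) - LinearMap.id) ↔ Antisymm f := by
      rw [LinearMap.mem_ker, LinearMap.sub_apply, LinearMap.id_apply, sub_eq_zero]
      exact ⟨fun h => h ▸ antisymm_alt _ _, fun h => h.alt_eq⟩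
    rw [← this]
    rfl
  -- On the space `Z` of antisymmetric cycles, `L` takes values in boundaries. It remains to show
  -- that it is injective on `Z`, since `Z` is finite-dimensional.
  let L : ((Fin (m + 1) → ι) →₀ ℚ) →ₗ[ℚ] ((Fin (m + 1) → ι) →₀ ℚ) :=
    (D : ℚ) • LinearMap.id - alt ι (m + 1) ∘ₗ linkConeBd K m
  have hLbd : ∀ f ∈ Z, L f = bd ℚ ι (m + 1) (alt ι (m + 2) (linkCone K (m + 1) f)) := by
    intro f hf
    obtain ⟨ha, hs, hb⟩ := (hZ f).1 hf
    rw [bd_alt, bd_linkCone hD ha hs, map_sub, map_smul, ha.alt_eq]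
    rfl
  have hLZ : ∀ f ∈ Z, L f ∈ Z := by
    intro f hf
    obtain ⟨ha, hs, hb⟩ := (hZ f).1 hf
    refine (hZ _).2 ⟨?_, ?_, by rw [hLbd f hf, bd_bd]⟩
    · have : L f = alt ι (m + 1) ((D : ℚ) • f - linkConeBd K m f) := by
        rw [map_sub, map_smul, ha.alt_eq]; rfl
      rw [this]
      exact antisymm_alt _ _
    · exact Submodule.sub_mem _ (Submodule.smul_mem _ _ hs) (halt _ _ (linkConeBd_mem f))
  have hinj : ∀ f ∈ Z, L f = 0 → f = 0 := by
    intro f hf hL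
    obtain ⟨ha, hs, hb⟩ := (hZ f).1 hf
    have hsa : ∀ g : (Fin (m + 1) → ι) →₀ ℚ, ∑ u, alt ι (m + 1) g u * f u = ∑ u, g u * f u := by
      intro g
      simp only [alt_apply, mul_assoc, Finset.sum_mul]
      rw [← Finset.mul_sum, Finset.sum_comm]
      have : ∀ π : Equiv.Perm (Fin (m + 1)), ∑ u : Fin (m + 1) → ι, ratSign π *
          (g (u ∘ π) * f u) = ∑ u, g u * f u := by
        intro π
        rw [← Equiv.sum_comp (Equiv.arrowCongr π (Equiv.refl ι))]
        refine Finset.sum_congr rfl fun u _ => ?_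
        have h1 : (Equiv.arrowCongr π (Equiv.refl ι)) u = u ∘ (π⁻¹ : Equiv.Perm _) := rfl
        have h2 : (u ∘ (π⁻¹ : Equiv.Perm _)) ∘ π = u := by funext i; simp
        rw [h1, h2, ha, ratSign_inv, mul_left_comm, ← mul_assoc (ratSign π), ratSign_mul_self,
          one_mul]
      simp only [this]
      simp [Fintype.card_perm, Nat.factorial_ne_zero]
    -- The antisymmetrization is self-adjoint and fixes `f`, so it disappears from the pairing with
    -- `f`.
    have h0 : (D : ℚ) * ∑ u, f u ^ 2 = ∑ u, linkConeBd K m f u * f u := by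
      rw [← hsa]
      have h1 : alt ι (m + 1) (linkConeBd K m f) = (D : ℚ) • f := (sub_eq_zero.1 hL).symm
      rw [h1, Finset.mul_sum]
      refine Finset.sum_congr rfl fun u _ => ?_
      rw [Finsupp.smul_apply, smul_eq_mul]; ring
    have hle : ∑ τ : Fin m → ι, ∑ x, ∑ y ∈ linkVertices K (insert x (Finset.univ.image τ)),
        f (Fin.cons x τ : Fin (m + 1) → ι) * f (Fin.cons y τ : Fin (m + 1) → ι) ≤
        T * ∑ u, f u ^ 2 := by
      have hsq : ∑ u, f u ^ 2 = ∑ τ : Fin m → ι, ∑ x, f (Fin.cons x τ : Fin (m + 1) → ι) ^ 2 := by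
        rw [← Equiv.sum_comp (Fin.consEquiv (fun _ => ι)), Fintype.sum_prod_type_right]
        rfl
      rw [hsq, Finset.mul_sum]
      refine Finset.sum_le_sum fun τ _ => ?_
      -- Only tuples `τ` extended by the support of `f` matter; for these `τ` has distinct entries
      -- spanning a simplex, and the local function is supported on its link.
      by_cases hz : ∀ x, f (Fin.cons x τ : Fin (m + 1) → ι) = 0
      · simp [hz]
      · push Not at hz
        obtain ⟨x₀, hx₀⟩ := hz
        have hsimp : ∀ x, f (Fin.cons x τ : Fin (m + 1) → ι) ≠ 0 →
            K.IsSimplex (insert x (Finset.univ.image τ)) ∧ x ∉ Finset.univ.image τ ∧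
              Function.Injective τ := by
          intro x hx
          obtain ⟨σ, hσ, hv⟩ := hs (Finsupp.mem_support_iff.2 hx)
          have hi := Fin.cons_injective_iff.1 (ha.injective_of_ne_zero hx)
          refine ⟨isSimplex_of_subset hσ ?_, ?_, hi.2⟩
          · intro y hy
            rcases Finset.mem_insert.1 hy with rfl | hy
            · simpa using hv 0
            · obtain ⟨l, -, rfl⟩ := Finset.mem_image.1 hy
              simpa using hv l.succ
          · simpa using hi.1
        obtain ⟨h1, h2, h3⟩ := hsimp x₀ hx₀
        refine hT (Finset.univ.image τ) (isSimplex_of_subset h1 (Finset.subset_insert _ _))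
          (by rw [Finset.card_image_of_injective _ h3]; simp)
          (fun x => f (Fin.cons x τ : Fin (m + 1) → ι)) ?_ (ha.sum_cons_eq_zero hb τ)
        intro x hx
        by_contra hne
        obtain ⟨h1, h2, -⟩ := hsimp x hne
        exact hx (mem_linkVertices.2 ⟨h2, mem_of_subset h1 subset_rfl (Finset.insert_nonempty _ _)⟩)
    rw [sum_linkConeBd_mul K ha] at h0
    have hnn : 0 ≤ ∑ u, f u ^ 2 := Finset.sum_nonneg fun u _ => sq_nonneg _
    have hm : (0 : ℚ) < (m : ℚ) + 1 := by positivity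
    have hzero : ∑ u, f u ^ 2 = 0 := by
      by_contra hne
      have hpos : 0 < ∑ u, f u ^ 2 := lt_of_le_of_ne hnn (Ne.symm hne)
      have h4 := mul_le_mul_of_nonneg_left hle hm.le
      have h5 := mul_lt_mul_of_pos_right h hpos
      linarith
    ext u
    have := (Finset.sum_eq_zero_iff_of_nonneg fun u _ => sq_nonneg (f u)).1 hzero u
      (Finset.mem_univ u)
    simpa using this
  have hsurj : Function.Surjective (L.restrict hLZ) := by
    rw [← LinearMap.injective_iff_surjective, ← LinearMap.ker_eq_bot, LinearMap.ker_eq_bot']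
    rintro ⟨f, hf⟩ h0
    exact Subtype.ext (hinj f hf (congrArg Subtype.val h0))
  obtain ⟨w, hw, hwz⟩ := exists_bd_eq_alt_sub htup hz hc
  have hzZ : alt ι (m + 1) z ∈ Z :=
    (hZ _).2 ⟨antisymm_alt _ _, halt _ _ hz, by rw [bd_alt, LinearMap.mem_ker.1 hc, map_zero]⟩
  obtain ⟨⟨f, hf⟩, hfz⟩ := hsurj ⟨_, hzZ⟩
  have hfz' : L f = alt ι (m + 1) z := congrArg Subtype.val hfz
  refine ⟨alt ι (m + 2) (linkCone K (m + 1) f) - w,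
    Submodule.sub_mem _ (halt _ _ (linkCone_mem f)) hw, ?_⟩
  rw [map_sub, ← hLbd f hf, hfz', hwz, sub_sub_cancel]

end TupleChain

namespace TupleChain

variable {k : Type*} [CommRing k]

/-! ### Order complexes of subsets of a poset -/

section Poset

variable {P : Type*} [PartialOrder P]

/-- The tuples of pairwise comparable elements of `S`. -/
def chainTuples (S : Set P) (j : ℕ) : Set (Fin j → P) :=
  {v | (∀ i, v i ∈ S) ∧ ∀ i l, v i ≤ v l ∨ v l ≤ v i}

theorem faceClosed_chainTuples (S : Set P) : FaceClosed (chainTuples S) :=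
  fun _ _ hv _ => ⟨fun _ => hv.1 _, fun _ _ => hv.2 _ _⟩

theorem chainTuples_mono {S T : Set P} (h : S ⊆ T) (j : ℕ) : chainTuples S j ⊆ chainTuples T j :=
  fun _ hv => ⟨fun i => h (hv.1 i), hv.2⟩

theorem cons_mem_chainTuples {S : Set P} {a : P} (ha : a ∈ S) {j : ℕ} {v : Fin j → P}
    (hv : v ∈ chainTuples S j) (h : ∀ i, v i ≤ a ∨ a ≤ v i) :
    (Fin.cons a v : Fin (j + 1) → P) ∈ chainTuples S (j + 1) := by
  constructor
  · intro i
    refine Fin.cases ?_ (fun i => ?_) i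
    · simpa using ha
    · simpa using hv.1 i
  · intro i l
    refine Fin.cases ?_ (fun i => ?_) i <;> refine Fin.cases ?_ (fun l => ?_) l
    · simp
    · simpa using (h l).symm
    · simpa using h i
    · simpa using hv.2 i l

theorem acyclic_of_comparable {S : Set P} {a : P} (ha : a ∈ S) (h : ∀ y ∈ S, y ≤ a ∨ a ≤ y)
    (t : ℤ) : Acyclic k (chainTuples S) t :=
  acyclic_of_apex a (fun _ _ hv => cons_mem_chainTuples ha hv fun i => h _ (hv.1 i)) t

theorem chainTuples_union {S : Set P} {x : P} (hx : x ∈ S) (j : ℕ) :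
    chainTuples (S \ {x}) j ∪ chainTuples {y ∈ S | y ≤ x ∨ x ≤ y} j = chainTuples S j := by
  ext v
  constructor
  · rintro (h | h)
    · exact chainTuples_mono Set.sdiff_subset j h
    · exact chainTuples_mono (Set.sep_subset _ _) j h
  · intro h
    by_cases hv : ∃ i, v i = x
    · obtain ⟨i, rfl⟩ := hv
      exact Or.inr ⟨fun l => ⟨h.1 l, h.2 l i⟩, h.2⟩
    · push Not at hv
      exact Or.inl ⟨fun l => ⟨h.1 l, hv l⟩, h.2⟩

theorem chainTuples_inter (S : Set P) (x : P) (j : ℕ) :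
    chainTuples (S \ {x}) j ∩ chainTuples {y ∈ S | y ≤ x ∨ x ≤ y} j =
      chainTuples {y ∈ S | y < x ∨ x < y} j := by
  ext v
  constructor
  · rintro ⟨h1, h2⟩
    refine ⟨fun i => ⟨(h1.1 i).1, (h2.1 i).2.imp (fun h => lt_of_le_of_ne h (h1.1 i).2)
      fun h => lt_of_le_of_ne h (Ne.symm (h1.1 i).2)⟩, h1.2⟩
  · intro h
    exact ⟨⟨fun i => ⟨(h.1 i).1, (h.1 i).2.elim (fun h => h.ne) fun h => h.ne'⟩, h.2⟩,
      ⟨fun i => ⟨(h.1 i).1, (h.1 i).2.imp le_of_lt le_of_lt⟩, h.2⟩⟩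

/-- Adding an element `x` to a poset: the link of `x` may be one degree less connected. -/
theorem acyclic_of_diff_singleton {S : Set P} {x : P} (hx : x ∈ S) {t : ℤ}
    (h : Acyclic k (chainTuples (S \ {x})) t)
    (hl : Acyclic k (chainTuples {y ∈ S | y < x ∨ x < y}) (t - 1)) :
    Acyclic k (chainTuples S) t := by
  have := Acyclic.union (Y := chainTuples {y ∈ S | y ≤ x ∨ x ≤ y}) (faceClosed_chainTuples (S \ {x}))
    (faceClosed_chainTuples _) h
    (acyclic_of_comparable (a := x) (by exact ⟨hx, Or.inl le_rfl⟩) (fun y hy => hy.2) t)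
    (by simpa only [chainTuples_inter] using hl)
  simpa only [chainTuples_union hx] using this

/-- Removing an element `x` from a poset. -/
theorem acyclic_diff_singleton {S : Set P} {x : P} (hx : x ∈ S) {t : ℤ}
    (h : Acyclic k (chainTuples S) t)
    (hl : Acyclic k (chainTuples {y ∈ S | y < x ∨ x < y}) t) :
    Acyclic k (chainTuples (S \ {x})) t :=
  Acyclic.of_union_of_inter (Y := chainTuples {y ∈ S | y ≤ x ∨ x ≤ y})
    (faceClosed_chainTuples (S \ {x})) (faceClosed_chainTuples _)
    (by simpa only [chainTuples_union hx] using h) (by simpa only [chainTuples_inter] using hl)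

/-- Elements `y` that have a least element `r y` of `S` above them can be added to `S`. -/
theorem acyclic_union_of_least_above [DecidableEq P] {S : Set P} {t : ℤ}
    (h : Acyclic k (chainTuples S) t) (r : P → P)
    (B : Finset P) (hB : ∀ y ∈ B, y ∉ S ∧ r y ∈ S ∧ y < r y ∧ ∀ z ∈ S, y < z → r y ≤ z) :
    Acyclic k (chainTuples (S ∪ B)) t := by
  induction hn : B.card generalizing B with
  | zero => simpa [Finset.card_eq_zero.1 hn] using h
  | succ n ih =>
    -- Since `y` is maximal in `B`, everything above it lies in `S`, hence above `r y`; everything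
    -- below `y` is below `r y`. So the link of `y` is a cone with apex `r y`.
    obtain ⟨y, hy⟩ := B.exists_maximal (Finset.card_pos.1 (by omega))
    obtain ⟨hyS, hr, hlt, hleast⟩ := hB y hy.1
    refine acyclic_of_diff_singleton (x := y) (Or.inr hy.1) ?_ ?_
    · have : (S ∪ B) \ {y} = S ∪ (B.erase y : Finset P) := by
        ext z
        simp only [Set.mem_sdiff, Set.mem_union, SetLike.mem_coe, Set.mem_singleton_iff,
          Finset.mem_erase]
        constructor
        · rintro ⟨h | h, hz⟩
          · exact Or.inl h
          · exact Or.inr ⟨hz, h⟩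
        · rintro (h | h)
          · exact ⟨Or.inl h, fun hz => hyS (hz ▸ h)⟩
          · exact ⟨Or.inr h.2, h.1⟩
      rw [this]
      exact ih _ (fun z hz => hB z (Finset.mem_of_mem_erase hz))
        (by rw [Finset.card_erase_of_mem hy.1, hn]; rfl)
    · refine acyclic_of_comparable (a := r y) (by exact ⟨Or.inl hr, Or.inr hlt⟩) ?_ _
      rintro z ⟨hz, hzy | hzy⟩
      · exact Or.inl (hzy.trans hlt).le
      · rcases hz with hz | hz
        · exact Or.inr (hleast z hz hzy)
        · exact absurd hzy (hy.not_gt hz)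

/-- Removing an antichain. -/
theorem acyclic_diff_antichain [DecidableEq P] {S : Set P} {t : ℤ}
    (h : Acyclic k (chainTuples S) t)
    (B : Finset P) (hBS : ∀ x ∈ B, x ∈ S) (hanti : ∀ x ∈ B, ∀ y ∈ B, ¬ x < y)
    (hB : ∀ x ∈ B, Acyclic k (chainTuples {y ∈ S | y < x ∨ x < y}) t) :
    Acyclic k (chainTuples (S \ B)) t := by
  induction B using Finset.induction_on with
  | empty => simpa using h
  | insert x B hx ih =>
    have h1 := ih (fun y hy => hBS y (Finset.mem_insert_of_mem hy))
      (fun y hy z hz => hanti y (Finset.mem_insert_of_mem hy) z (Finset.mem_insert_of_mem hz))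
      (fun y hy => hB y (Finset.mem_insert_of_mem hy))
    have h2 : S \ (insert x B : Finset P) = (S \ B) \ {x} := by
      ext z; simp only [Finset.coe_insert, Set.mem_sdiff, Set.mem_insert_iff,
        Set.mem_singleton_iff]; tauto
    rw [h2]
    refine acyclic_diff_singleton
      (by exact ⟨hBS x (Finset.mem_insert_self _ _), by simpa using hx⟩) h1 ?_
    have h3 : {y ∈ S \ (B : Set P) | y < x ∨ x < y} = {y ∈ S | y < x ∨ x < y} := by
      ext y
      constructor
      · exact fun h => ⟨h.1.1, h.2⟩
      · intro h
        refine ⟨⟨h.1, fun hy => ?_⟩, h.2⟩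
        rcases h.2 with h' | h'
        · exact hanti y (Finset.mem_insert_of_mem hy) x (Finset.mem_insert_self _ _) h'
        · exact hanti x (Finset.mem_insert_self _ _) y (Finset.mem_insert_of_mem hy) h'
    rw [h3]
    exact hB x (Finset.mem_insert_self _ _)

theorem exists_top_of_mem_chainTuples {S : Set P} {j : ℕ} {v : Fin (j + 1) → P}
    (hv : v ∈ chainTuples S (j + 1)) : ∃ i, ∀ l, v l ≤ v i := by
  obtain ⟨x, hx⟩ := (Set.finite_range v).exists_maximal (Set.range_nonempty v)
  obtain ⟨i, rfl⟩ := hx.1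
  refine ⟨i, fun l => (hv.2 l i).elim id fun h => hx.2 ⟨l, rfl⟩ h⟩

end Poset

/-! ### Barycentric subdivision -/

variable {ι : Type*}

theorem nonempty_of_mem {K : PreAbstractSimplicialComplex ι} {s : Finset ι} (h : s ∈ K) :
    s.Nonempty := (K.isRelLowerSet_faces h).1

theorem card_injOn_of_isChain {c : Finset (Finset ι)} (hc : IsChain (· ≤ ·) (c : Set (Finset ι))) :
    Set.InjOn Finset.card (c : Set (Finset ι)) := by
  intro a ha b hb hab
  rcases hc.total ha hb with h | h
  · exact Finset.eq_of_subset_of_card_le h hab.ge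
  · exact (Finset.eq_of_subset_of_card_le h hab.le).symm

theorem card_le_card_of_isChain {K : PreAbstractSimplicialComplex ι} {c : Finset (Finset ι)}
    {s : Finset ι} (hcK : ∀ y ∈ c, y ∈ K ∧ y ⊆ s)
    (hc : IsChain (· ≤ ·) (c : Set (Finset ι))) : c.card ≤ s.card := by
  have h1 : s.card = (Finset.Icc 1 s.card).card := by simp
  rw [← Finset.card_image_of_injOn (card_injOn_of_isChain hc), h1]
  refine Finset.card_le_card fun m hm => ?_
  obtain ⟨y, hy, rfl⟩ := Finset.mem_image.1 hm
  exact Finset.mem_Icc.2 ⟨(nonempty_of_mem (hcK y hy).1).card_pos, Finset.card_le_card (hcK y hy).2⟩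

variable [DecidableEq ι]

theorem mem_link {K : PreAbstractSimplicialComplex ι} {s τ : Finset ι} :
    τ ∈ K.link s ↔ τ.Nonempty ∧ Disjoint s τ ∧ s ∪ τ ∈ K := by
  change τ.Nonempty ∧ Disjoint s τ ∧ _ ↔ _
  convert Iff.rfl

theorem isSimplex_link {K : PreAbstractSimplicialComplex ι} {s τ : Finset ι}
    (hs : K.IsSimplex s) :
    (K.link s).IsSimplex τ ↔ Disjoint s τ ∧ K.IsSimplex (s ∪ τ) := by
  constructor
  · rintro (rfl | h)
    · exact ⟨Finset.disjoint_empty_right s, by simpa using hs⟩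
    · exact ⟨(mem_link.1 h).2.1, Or.inr (mem_link.1 h).2.2⟩
  · rintro ⟨h1, h2⟩
    rcases τ.eq_empty_or_nonempty with rfl | hne
    · exact Or.inl rfl
    · refine Or.inr (mem_link.2 ⟨hne, h1, mem_of_subset h2 subset_rfl ?_⟩)
      exact hne.mono Finset.subset_union_right

theorem linkVertices_link [Fintype ι] {K : PreAbstractSimplicialComplex ι} {s τ : Finset ι}
    (h : Disjoint s τ) : linkVertices (K.link s) τ = linkVertices K (s ∪ τ) := by
  ext y
  rw [mem_linkVertices, mem_linkVertices, mem_link, Finset.disjoint_insert_right,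
    Finset.union_insert, Finset.mem_union]
  have := Finset.insert_nonempty y τ
  tauto

theorem tuples_link_empty (K : PreAbstractSimplicialComplex ι) : tuples (K.link ∅) = tuples K := by
  funext j
  have : ∀ σ, (K.link ∅).IsSimplex σ ↔ K.IsSimplex σ := fun σ => by
    rw [isSimplex_link (Or.inl rfl)]; simp
  simp only [tuples, this]

/-- The subdivision chain map: a tuple `v` goes to the cone from `s ∪ v` over the subdivision of its
boundary. -/
noncomputable def subdivide (k : Type*) [CommRing k] (s : Finset ι) :
    ∀ j, ((Fin j → ι) →₀ k) →ₗ[k] ((Fin j → Finset ι) →₀ k)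
  | 0 => mapVertices k (fun _ => ∅) 0
  | j + 1 => Finsupp.linearCombination k fun v =>
      cone k (s ∪ Finset.univ.image v) j (subdivide k s j (bd k ι j (Finsupp.single v 1)))

theorem subdivide_single (s : Finset ι) (j : ℕ) (v : Fin (j + 1) → ι) :
    subdivide k s (j + 1) (Finsupp.single v 1) = cone k (s ∪ Finset.univ.image v) j
      (subdivide k s j (bd k ι j (Finsupp.single v 1))) := by
  rw [subdivide, Finsupp.linearCombination_single, one_smul]

theorem bd_subdivide (s : Finset ι) (j : ℕ) (w : (Fin (j + 1) → ι) →₀ k) :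
    bd k (Finset ι) j (subdivide k s (j + 1) w) = subdivide k s j (bd k ι j w) := by
  induction j with
  | zero =>
    induction w using Finsupp.induction_linear with
    | zero => simp
    | add f g hf hg => simp only [map_add, hf, hg]
    | single v c =>
      rw [← mul_one c, ← smul_eq_mul, ← Finsupp.smul_single]
      simp only [map_smul]
      rw [subdivide_single, bd_cone_zero]
  | succ j ih =>
    induction w using Finsupp.induction_linear with
    | zero => simp
    | add f g hf hg => simp only [map_add, hf, hg]
    | single v c =>
      rw [← mul_one c, ← smul_eq_mul, ← Finsupp.smul_single]
      simp only [map_smul]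
      rw [subdivide_single, bd_cone_succ, ih, bd_bd]
      simp

/-- The bound by `s ∪ v` is needed both for the induction, where the new apex must lie above all
previous members, and for the carrier argument below. -/
theorem subdivide_mem_supported (K : PreAbstractSimplicialComplex ι) (s : Finset ι) (j : ℕ)
    (v : Fin j → ι) (hv : v ∈ tuples (K.link s) j) :
    subdivide k s j (Finsupp.single v 1) ∈ Finsupp.supported k k
      (chainTuples {y | y ∈ K ∧ s ⊂ y ∧ y ⊆ s ∪ Finset.univ.image v} j) := by
  induction j with
  | zero =>
    rw [subdivide, mapVertices_single]
    exact Finsupp.single_mem_supported _ _ ⟨fun i => i.elim0, fun i => i.elim0⟩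
  | succ j ih =>
    rw [subdivide_single]
    obtain ⟨σ, hσ, hvσ⟩ := hv
    have him : Finset.univ.image v ∈ K.link s := mem_of_subset hσ
      (by simpa [Finset.image_subset_iff] using hvσ) (Finset.univ_nonempty.image v)
    obtain ⟨hne, hdis, hK⟩ := mem_link.1 him
    have hss : s ⊂ s ∪ Finset.univ.image v := by
      refine Finset.ssubset_iff_subset_ne.2 ⟨Finset.subset_union_left, fun h => ?_⟩
      obtain ⟨x, hx⟩ := hne
      exact Finset.disjoint_left.1 hdis (h ▸ Finset.mem_union_right _ hx) hx
    refine cone_mem_supported (X := chainTuples _) (Y := chainTuples _) (fun u hu =>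
      cons_mem_chainTuples (by exact ⟨hK, hss, subset_rfl⟩) hu fun i => Or.inl (hu.1 i).2.2) ?_
    · rw [bd_single, map_sum]
      refine Submodule.sum_mem _ fun i _ => ?_
      rw [map_smul]
      refine Submodule.smul_mem _ _ (Finsupp.supported_mono (chainTuples_mono ?_ _)
        (ih _ (faceClosed_tuples _ _ v ⟨σ, hσ, hvσ⟩ i)))
      rintro y ⟨h1, h2, h3⟩
      refine ⟨h1, h2, h3.trans (Finset.union_subset_union_right ?_)⟩
      intro x hx
      obtain ⟨l, -, rfl⟩ := Finset.mem_image.1 hx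
      exact Finset.mem_image_of_mem _ (Finset.mem_univ _)

/-- The poset of simplices of `K` strictly above `s` is as connected as the link of `s`. -/
theorem acyclic_above [Nonempty ι] (K : PreAbstractSimplicialComplex ι) (s : Finset ι) {t : ℤ}
    (h : Acyclic k (tuples (K.link s)) t) : Acyclic k (chainTuples {y | y ∈ K ∧ s ⊂ y}) t := by
  intro j hj z hz hc
  -- `φ` picks a vertex of `y` outside `s`. On a chain all picked vertices lie in its top member, so
  -- `φ` is simplicial into the link; the arbitrary value elsewhere is never seen.
  have hφ : ∀ y : Finset ι, ∃ x, s ⊂ y → x ∈ y \ s := by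
    intro y
    by_cases hy : s ⊂ y
    · obtain ⟨x, hx, hxs⟩ := Finset.exists_of_ssubset hy
      exact ⟨x, fun _ => Finset.mem_sdiff.2 ⟨hx, hxs⟩⟩
    · exact ⟨Classical.arbitrary ι, fun h => absurd h hy⟩
  choose φ hφ using hφ
  set X := chainTuples {y : Finset ι | y ∈ K ∧ s ⊂ y} with hX
  have hsup : ∀ j, ∀ v ∈ X (j + 1), Finset.univ.sup v ∈ K ∧ s ⊂ Finset.univ.sup v := by
    intro j v hv
    obtain ⟨i, hi⟩ := exists_top_of_mem_chainTuples hv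
    have : Finset.univ.sup v = v i :=
      le_antisymm (Finset.sup_le fun l _ => hi l) (Finset.le_sup (Finset.mem_univ i))
    rw [this]
    exact hv.1 i
  have hle : ∀ j (v : Fin j → Finset ι) i, v i ⊆ Finset.univ.sup v :=
    fun j v i => Finset.le_sup (f := v) (Finset.mem_univ i)
  have hφX : ∀ j, ∀ v ∈ X j, (fun i => φ (v i)) ∈ tuples (K.link s) j := by
    rintro (_ | j) v hv
    · exact ⟨∅, Or.inl rfl, fun i => i.elim0⟩
    · obtain ⟨h1, h2⟩ := hsup j v hv
      refine ⟨Finset.univ.sup v \ s, Or.inr (mem_link.2 ⟨?_, Finset.disjoint_sdiff, ?_⟩), ?_⟩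
      · exact Finset.sdiff_nonempty.2 h2.2
      · rwa [Finset.union_sdiff_of_subset h2.1]
      · intro i
        have := Finset.mem_sdiff.1 (hφ _ (hv.1 i).2)
        exact Finset.mem_sdiff.2 ⟨hle _ v i this.1, this.2⟩
  -- Subdividing after `φ` is homotopic to the identity: both are carried by the simplices above `s`
  -- and below the top of the chain, a cone with that top as apex.
  let e : ∀ j, ((Fin j → Finset ι) →₀ k) →ₗ[k] ((Fin j → Finset ι) →₀ k) := fun j =>
    subdivide k s j ∘ₗ mapVertices k φ j - LinearMap.id
  have he : ∀ j w, bd k (Finset ι) j (e (j + 1) w) = e j (bd k (Finset ι) j w) := fun j w => by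
    simp [e, bd_subdivide, bd_mapVertices]
  have he0 : e 0 = 0 := by
    refine Finsupp.lhom_ext fun v c => ?_
    simp only [e, LinearMap.sub_apply, LinearMap.comp_apply, mapVertices_single, subdivide,
      LinearMap.id_apply, LinearMap.zero_apply]
    rw [Subsingleton.elim (fun i : Fin 0 => (∅ : Finset ι)) v, sub_self]
  obtain ⟨w, hw, hwz⟩ := h j hj _ (mapVertices_mem_supported (hφX j) hz)
    (mapVertices_mem_cyc φ j hc)
  have hnull := bd_nullHomotopy (fun j v => Finset.univ.sup v) e he he0 j z hc
  refine ⟨subdivide k s (j + 1) w - nullHomotopy (fun j v => Finset.univ.sup v) e j z,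
    Submodule.sub_mem _ ?_ ?_, ?_⟩
  · refine map_mem_of_single _ _ (fun v hv => ?_) hw
    exact Finsupp.supported_mono (chainTuples_mono (fun y hy => by exact ⟨hy.1, hy.2.1⟩) _)
      (subdivide_mem_supported K s _ v hv)
  · refine map_mem_of_single _ _ (fun v hv => ?_) hz
    refine Finsupp.supported_mono (chainTuples_mono (fun y hy => by exact ⟨hy.1, hy.2.1⟩) _)
      (nullHomotopy_mem_supported _ e (faceClosed_chainTuples _)
      (fun j v m => chainTuples {y | y ∈ K ∧ s ⊂ y ∧ y ⊆ Finset.univ.sup v} m) ?_ ?_ ?_ j v hv)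
    · intro j v _ i m
      exact chainTuples_mono (fun y hy => by
        exact ⟨hy.1, hy.2.1, hy.2.2.trans (Finset.sup_le fun l _ => hle _ v _)⟩) m
    · intro j v hv
      refine Submodule.sub_mem _ ?_ (Finsupp.single_mem_supported _ _
        ⟨fun i => ⟨(hv.1 i).1, (hv.1 i).2, hle _ v i⟩, hv.2⟩)
      rw [LinearMap.comp_apply, mapVertices_single]
      refine Finsupp.supported_mono (chainTuples_mono ?_ _)
        (subdivide_mem_supported K s j _ (hφX j v hv))
      rintro y ⟨h1, h2, h3⟩
      refine ⟨h1, h2, h3.trans ?_⟩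
      cases j with
      | zero =>
        exfalso
        refine h2.2 (h3.trans ?_)
        simp
      | succ j =>
        refine Finset.union_subset (hsup j v hv).2.1 ?_
        intro x hx
        obtain ⟨l, -, rfl⟩ := Finset.mem_image.1 hx
        exact hle _ v l (Finset.mem_sdiff.1 (hφ _ (hv.1 l).2)).1
    · intro j v hv m u hu
      exact cons_mem_chainTuples (by exact ⟨(hsup j v hv).1, (hsup j v hv).2, subset_rfl⟩) hu
        fun i => Or.inl (hu.1 i).2.2
  · rw [map_sub, hnull, bd_subdivide, hwz]
    simp [e]

/-! ### Links of chains of simplices -/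

/-- The simplices of `K` that are strictly comparable to all members of `c`. -/
def chainLink (K : PreAbstractSimplicialComplex ι) (c : Finset (Finset ι)) : Set (Finset ι) :=
  {y | y ∈ K ∧ ∀ s ∈ c, y < s ∨ s < y}

theorem sep_chainLink (K : PreAbstractSimplicialComplex ι) (c : Finset (Finset ι)) (x : Finset ι) :
    {y ∈ chainLink K c | y < x ∨ x < y} = chainLink K (insert x c) := by
  ext y
  simp only [chainLink, Set.mem_ofPred_eq, Finset.mem_insert, forall_eq_or_imp]
  tauto

/-- Joining the proper part of a Boolean lattice raises connectivity: one missing size. -/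
theorem acyclic_chainLink_of_gap {K : PreAbstractSimplicialComplex ι} {c : Finset (Finset ι)}
    (hcK : ∀ y ∈ c, y ∈ K) (hc : IsChain (· ≤ ·) (c : Set (Finset ι)))
    {s : Finset ι} (hs : s ∈ c) (hs2 : 2 ≤ s.card) (hgap : ∀ y ∈ c, y.card + 1 ≠ s.card) :
    ∃ x ∈ chainLink K c, x < s ∧ ∀ t : ℤ, Acyclic k (chainTuples (chainLink K c \ {x})) t := by
  classical
  -- `u` is the member of `c` just below `s`, or `∅` if there is none. The open interval from `u` to
  -- `s` is the proper part of a Boolean lattice and is a join factor of `chainLink K c`.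
  set u : Finset ι := (c.filter (· < s)).sup id with hu
  have hu' : u = ∅ ∨ u ∈ c ∧ u < s := by
    rcases (c.filter (· < s)).eq_empty_or_nonempty with h | h
    · left; rw [hu, h]; simp
    · right
      obtain ⟨m, hm⟩ := (c.filter (· < s)).exists_maximal h
      have : u = m := by
        refine le_antisymm (Finset.sup_le fun y hy => ?_) (Finset.le_sup (f := id) hm.1)
        rcases hc.total (Finset.mem_filter.1 hy).1 (Finset.mem_filter.1 hm.1).1 with h' | h'
        · exact h'
        · exact hm.2 hy h'
      rw [this]
      exact Finset.mem_filter.1 hm.1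
  have hucard : u.card + 2 ≤ s.card := by
    rcases hu' with h | ⟨h1, h2⟩
    · rw [h]; simpa using hs2
    · have := Finset.card_lt_card h2
      have := hgap u h1
      omega
  have hus : u < s := by
    rcases hu' with h | h
    · rw [h]; exact Finset.empty_ssubset.2 (nonempty_of_mem (hcK s hs))
    · exact h.2
  have hbelow : ∀ y ∈ c, y < s → y ≤ u := fun y hy hys =>
    Finset.le_sup (f := id) (Finset.mem_filter.2 ⟨hy, hys⟩)
  obtain ⟨v, hvs, hvu⟩ := Finset.exists_of_ssubset hus
  have hKs : ∀ y ⊆ s, y.Nonempty → y ∈ K := fun y hy hne =>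
    mem_of_subset (Or.inr (hcK s hs)) hy hne
  -- a set strictly between `u` and `s` lies in the link of the chain
  have hbetween : ∀ y, u < y → y < s → y ∈ chainLink K c := by
    intro y h1 h2
    refine ⟨hKs y h2.1 ((Finset.nonempty_of_ne_empty fun h => ?_)), fun w hw => ?_⟩
    · rw [h] at h1; exact Finset.not_ssubset_empty _ h1
    · by_cases hws : w < s
      · exact Or.inr (lt_of_le_of_lt (hbelow w hw hws) h1)
      · refine Or.inl (lt_of_lt_of_le h2 ?_)
        rcases hc.total hs hw with h | h
        · exact h
        · exact (eq_or_lt_of_le h).elim (fun h => h ▸ le_rfl) fun h => absurd h hws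
  have hxs : s.erase v < s := Finset.erase_ssubset hvs
  have hux : u < s.erase v := by
    refine Finset.ssubset_iff_subset_ne.2 ⟨fun a ha => Finset.mem_erase.2
      ⟨fun h => hvu (h ▸ ha), hus.1 ha⟩, fun h => ?_⟩
    have := Finset.card_erase_of_mem hvs
    rw [← h] at this
    omega
  have hyu : ∀ y ∈ chainLink K c, y < u ∨ u < y := by
    intro y hy
    rcases hu' with h | h
    · rw [h]; exact Or.inr (Finset.empty_ssubset.2 (nonempty_of_mem hy.1))
    · exact hy.2 u h.1
  have hz1 : u < insert v u := Finset.ssubset_insert hvu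
  have hz2 : insert v u < s := by
    refine Finset.ssubset_iff_subset_ne.2 ⟨Finset.insert_subset hvs hus.1, fun h => ?_⟩
    have := Finset.card_insert_of_notMem hvu
    rw [h] at this
    omega
  refine ⟨s.erase v, hbetween _ hux hxs, hxs, fun t => ?_⟩
  -- Without the coatom `s.erase v` the interval contracts by `y ↦ insert v y` onto a cone with apex
  -- `insert v u`. The sets in `B` are those moved by this map; `s.erase v` is the only one whose
  -- image would be `s` itself.
  let B : Finset (Finset ι) := s.powerset.filter fun y => u < y ∧ v ∉ y ∧ y ≠ s.erase v
  have hBmem : ∀ y, y ∈ B ↔ y ⊆ s ∧ u < y ∧ v ∉ y ∧ y ≠ s.erase v := by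
    intro y; simp [B]
  have hBs : ∀ y ∈ B, y < s := fun y hy => Finset.ssubset_iff_subset_ne.2
    ⟨((hBmem y).1 hy).1, fun h => ((hBmem y).1 hy).2.2.1 (h ▸ hvs)⟩
  let S : Set (Finset ι) := (chainLink K c \ {s.erase v}) \ B
  have hS : chainLink K c \ {s.erase v} = S ∪ B := by
    ext y
    constructor
    · intro h
      by_cases hy : y ∈ B
      · exact Or.inr hy
      · exact Or.inl ⟨h, hy⟩
    · rintro (h | h)
      · exact h.1
      · exact ⟨hbetween y ((hBmem y).1 h).2.1 (hBs y h), ((hBmem y).1 h).2.2.2⟩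
  have hins : ∀ y, y ∈ S → u < y → v ∈ y := by
    intro y hy huy
    by_contra hv
    have hys : y ⊆ s := by
      rcases hy.1.1.2 s hs with h | h
      · exact h.1
      · exact absurd (h.1 hvs) hv
    exact hy.2 ((hBmem y).2 ⟨hys, huy, hv, hy.1.2⟩)
  rw [hS]
  refine acyclic_union_of_least_above (r := insert v) ?_ B fun y hy => ?_
  · have hzS : insert v u ∈ S := by
      refine ⟨⟨hbetween _ hz1 hz2, fun h => ?_⟩,
        fun h => ((hBmem _).1 h).2.2.1 (Finset.mem_insert_self v u)⟩
      have := Finset.mem_insert_self v u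
      rw [Set.mem_singleton_iff.1 h] at this
      simp at this
    · refine acyclic_of_comparable hzS ?_ t
      intro y hy
      rcases hyu y hy.1.1 with h | h
      · exact Or.inl (h.trans hz1).le
      · exact Or.inr (Finset.insert_subset (hins y hy h) h.1)
  · obtain ⟨h1, h2, h3, h4⟩ := (hBmem y).1 hy
    have hlt : y < insert v y := Finset.ssubset_insert h3
    refine ⟨fun h => h.2 hy, ⟨⟨hbetween _ (h2.trans hlt) ?_, ?_⟩, ?_⟩, hlt, fun z hz hyz => ?_⟩
    · refine Finset.ssubset_iff_subset_ne.2 ⟨Finset.insert_subset hvs h1, fun h => h4 ?_⟩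
      rw [← h, Finset.erase_insert h3]
    · intro h
      have := Finset.mem_insert_self v y
      rw [Set.mem_singleton_iff.1 h] at this
      simp at this
    · exact fun h => ((hBmem _).1 h).2.2.1 (Finset.mem_insert_self v y)
    · exact Finset.insert_subset (hins z hz (h2.trans hyz)) hyz.1

/-- The link of a chain with top `s` is the join of spheres with the poset above `s`. -/
theorem acyclic_chainLink [Nonempty ι] {K : PreAbstractSimplicialComplex ι} {s : Finset ι} {t : ℤ}
    (h : Acyclic k (tuples (K.link s)) t) (c : Finset (Finset ι))
    (hcK : ∀ y ∈ c, y ∈ K ∧ y ⊆ s) (hc : IsChain (· ≤ ·) (c : Set (Finset ι)))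
    (hs : s ∈ c ∨ s = ∅ ∧ c = ∅) :
    Acyclic k (chainTuples (chainLink K c)) (t + s.card - c.card) := by
  induction hn : s.card - c.card generalizing c with
  | zero =>
    -- The chain is saturated up to `s`, so every simplex comparable with all its members lies
    -- strictly above `s`.
    have hcard : c.card = s.card := le_antisymm (card_le_card_of_isChain hcK hc) (by omega)
    have himg : c.image Finset.card = Finset.Icc 1 s.card := by
      refine Finset.eq_of_subset_of_card_le (fun m hm => ?_) ?_
      · obtain ⟨y, hy, rfl⟩ := Finset.mem_image.1 hm
        exact Finset.mem_Icc.2 ⟨(nonempty_of_mem (hcK y hy).1).card_pos,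
          Finset.card_le_card (hcK y hy).2⟩
      · rw [Finset.card_image_of_injOn (card_injOn_of_isChain hc), Nat.card_Icc]
        omega
    have : chainLink K c = {y | y ∈ K ∧ s ⊂ y} := by
      ext y
      constructor
      · rintro ⟨h1, h2⟩
        refine ⟨h1, ?_⟩
        rcases hs with hs | ⟨rfl, rfl⟩
        · rcases h2 s hs with h3 | h3
          · have : y.card ∈ c.image Finset.card := by
              rw [himg, Finset.mem_Icc]
              exact ⟨(nonempty_of_mem h1).card_pos, (Finset.card_lt_card h3).le⟩
            obtain ⟨w, hw, hwy⟩ := Finset.mem_image.1 this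
            rcases h2 w hw with h4 | h4
            · exact absurd hwy (Finset.card_lt_card h4).ne'
            · exact absurd hwy (Finset.card_lt_card h4).ne
          · exact h3
        · exact Finset.empty_ssubset.2 (nonempty_of_mem h1)
      · rintro ⟨h1, h2⟩
        exact ⟨h1, fun w hw => Or.inr (lt_of_le_of_lt (hcK w hw).2 h2)⟩
    rw [this, hcard, add_sub_cancel_right]
    exact acyclic_above K s h
  | succ n ih =>
    have hsc : s ∈ c := by
      rcases hs with hs | ⟨rfl, rfl⟩
      · exact hs
      · simp at hn
    -- If every member of size at least 2 had a member of one size less, descending from `s` would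
    -- realize all sizes and leave nothing missing.
    obtain ⟨s', hs', hs2, hgap⟩ : ∃ s' ∈ c, 2 ≤ s'.card ∧ ∀ y ∈ c, y.card + 1 ≠ s'.card := by
      by_contra! hno
      have hall : ∀ m, m < s.card → ∃ y ∈ c, y.card = s.card - m := by
        intro m
        induction m with
        | zero => exact fun _ => ⟨s, hsc, by simp⟩
        | succ m ihm =>
          intro hm
          obtain ⟨y, hy, hyc⟩ := ihm (by omega)
          obtain ⟨w, hw, hwy⟩ := hno y hy (by omega)
          exact ⟨w, hw, by omega⟩
      have : Finset.Icc 1 s.card ⊆ c.image Finset.card := by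
        intro m hm
        rw [Finset.mem_Icc] at hm
        obtain ⟨y, hy, hyc⟩ := hall (s.card - m) (by omega)
        exact Finset.mem_image.2 ⟨y, hy, by omega⟩
      have := (Finset.card_le_card this).trans Finset.card_image_le
      rw [Nat.card_Icc] at this
      omega
    obtain ⟨x, hx, hxs, hac⟩ := acyclic_chainLink_of_gap (k := k) (fun y hy => (hcK y hy).1) hc
      hs' hs2 hgap
    have hxc : x ∉ c := fun h => (hx.2 x h).elim (lt_irrefl x) (lt_irrefl x)
    -- Without `x` the poset is acyclic in all degrees, so only the link of `x` matters. That link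
    -- belongs to the longer chain `insert x c`, and adding `x` back gains one degree.
    refine acyclic_of_diff_singleton hx (hac _) ?_
    rw [sep_chainLink]
    have := ih (insert x c) ?_ ?_ (Or.inl (Finset.mem_insert_of_mem hsc)) ?_
    · rw [Finset.card_insert_of_notMem hxc] at this
      refine this.mono ?_
      push_cast; linarith
    · intro y hy
      rcases Finset.mem_insert.1 hy with rfl | hy
      · exact ⟨hx.1, hxs.1.trans (hcK s' hs').2⟩
      · exact hcK y hy
    · rw [Finset.coe_insert]
      refine hc.insert fun y hy _ => (hx.2 y hy).imp le_of_lt le_of_lt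
    · rw [Finset.card_insert_of_notMem hxc]; omega

end TupleChain

namespace Symplectic

open LinearMap (BilinForm)

/-! ### Counting vectors and non-degenerate planes -/

section Counting

variable {F V : Type*} [Field F] [AddCommGroup V] [Module F V]

open Classical in
/-- The indicator function of a subspace. -/
noncomputable def ind (U : Submodule F V) (x : V) : ℚ := if x ∈ U then 1 else 0

open Classical in
/-- The indicator of the relation `U ≤ W` between subspaces. -/
noncomputable def indLE (U W : Submodule F V) : ℚ := if U ≤ W then 1 else 0

theorem ind_of_mem {U : Submodule F V} {x : V} (h : x ∈ U) : ind U x = 1 := if_pos h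

theorem ind_of_notMem {U : Submodule F V} {x : V} (h : x ∉ U) : ind U x = 0 := if_neg h

theorem indLE_of_le {U W : Submodule F V} (h : U ≤ W) : indLE U W = 1 := if_pos h

theorem indLE_of_not_le {U W : Submodule F V} (h : ¬ U ≤ W) : indLE U W = 0 := if_neg h

theorem ind_congr {U W : Submodule F V} {x y : V} (h : x ∈ U ↔ y ∈ W) : ind U x = ind W y := by
  by_cases hx : x ∈ U
  · rw [ind_of_mem hx, ind_of_mem (h.1 hx)]
  · rw [ind_of_notMem hx, ind_of_notMem fun hy => hx (h.2 hy)]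

theorem ind_mul_ind (U W : Submodule F V) (x : V) : ind U x * ind W x = ind (U ⊓ W) x := by
  by_cases hU : x ∈ U <;> by_cases hW : x ∈ W <;> simp [ind, hU, hW]

theorem indLE_mul_indLE (S U W : Submodule F V) : indLE S U * indLE S W = indLE S (U ⊓ W) := by
  by_cases hU : S ≤ U <;> by_cases hW : S ≤ W <;> simp [indLE, hU, hW]

theorem ind_add_mem {U : Submodule F V} {x u : V} (hu : u ∈ U) : ind U (x + u) = ind U x :=
  ind_congr (Submodule.add_mem_iff_left U hu)

theorem ind_zero (U : Submodule F V) : ind U 0 = 1 := ind_of_mem U.zero_mem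

theorem sum_ind [Fintype V] (U : Submodule F V) : ∑ x, ind U x = Nat.card U := by
  classical
  simp only [ind, Finset.sum_boole, Nat.card_eq_fintype_card, Fintype.card_subtype]

variable (Ψ : BilinForm F V)

theorem ind_ker_comm {Ψ : BilinForm F V} (hΨ : Ψ.IsAlt) (x y : V) :
    ind (LinearMap.ker (Ψ x)) y = ind (LinearMap.ker (Ψ y)) x :=
  ind_congr (by simpa using hΨ.isRefl.eq_iff)

theorem mem_orthogonal_iff_le_ker {Ψ : BilinForm F V} (hΨ : Ψ.IsAlt) {U : Submodule F V} {x : V} :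
    x ∈ Ψ.orthogonal U ↔ U ≤ LinearMap.ker (Ψ x) := by
  rw [LinearMap.BilinForm.mem_orthogonal_iff]
  exact ⟨fun h y hy => hΨ.isRefl.eq_iff.1 (h y hy), fun h y hy => hΨ.isRefl.eq_iff.1 (h hy)⟩

theorem orthogonal_sup (U W : Submodule F V) :
    Ψ.orthogonal (U ⊔ W) = Ψ.orthogonal U ⊓ Ψ.orthogonal W := by
  refine le_antisymm (le_inf (LinearMap.BilinForm.orthogonal_le le_sup_left)
    (LinearMap.BilinForm.orthogonal_le le_sup_right)) ?_
  rintro x ⟨h1, h2⟩ y hy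
  obtain ⟨u, hu, w, hw, rfl⟩ := Submodule.mem_sup.1 hy
  have h1' : Ψ u x = 0 := h1 u hu
  have h2' : Ψ w x = 0 := h2 w hw
  change Ψ (u + w) x = 0
  simp [h1', h2']

theorem nondegenerate_restrict_iff [FiniteDimensional F V] {Ψ : BilinForm F V} (hΨ : Ψ.IsAlt)
    (U : Submodule F V) : (Ψ.restrict U).Nondegenerate ↔ Disjoint U (Ψ.orthogonal U) := by
  rw [LinearMap.BilinForm.restrict_nondegenerate_iff_isCompl_orthogonal hΨ.isRefl,
    LinearMap.BilinForm.isCompl_orthogonal_iff_disjoint hΨ.isRefl]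

theorem one_lt_card {F : Type*} [Field F] [Finite F] : (1 : ℚ) < Nat.card F := by
  exact_mod_cast Finite.one_lt_card

/-- If some `u` in `U` is not orthogonal to `x`, translations by multiples of `u` permute the level
sets of `Ψ x` on `U`, so all `q` of them have the same size. -/
theorem sum_ind_mul_ind_ker [Fintype V] [Finite F] {Ψ : BilinForm F V} (hΨ : Ψ.IsAlt)
    (U : Submodule F V) (x : V) :
    ∑ y, ind U y * ind (LinearMap.ker (Ψ x)) y =
      (Nat.card U : ℚ) / Nat.card F +
        ind (Ψ.orthogonal U) x * ((Nat.card U : ℚ) - (Nat.card U : ℚ) / Nat.card F) := by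
  classical
  have hq : (Nat.card F : ℚ) ≠ 0 := (zero_lt_one.trans one_lt_card).ne'
  by_cases hx : x ∈ Ψ.orthogonal U
  · rw [ind_of_mem hx, one_mul, add_sub_cancel, ← sum_ind]
    refine Finset.sum_congr rfl fun y _ => ?_
    rw [ind_mul_ind, inf_eq_left.2 ((mem_orthogonal_iff_le_ker hΨ).1 hx)]
  · rw [ind_of_notMem hx, zero_mul, add_zero, eq_div_iff hq]
    rw [mem_orthogonal_iff_le_ker hΨ, SetLike.not_le_iff_exists] at hx
    obtain ⟨u, hu, hxu⟩ := hx
    have hxu' : Ψ x u ≠ 0 := hxu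
    have := Fintype.ofFinite F
    rw [← sum_ind]
    have h1 : ∀ y, ind U y = ∑ c : F, if Ψ x y = c then ind U y else 0 := fun y => by simp
    have h2 : ∀ c : F, (∑ y, if Ψ x y = c then ind U y else 0) =
        ∑ y, ind U y * ind (LinearMap.ker (Ψ x)) y := by
      intro c
      rw [← Equiv.sum_comp (Equiv.addRight ((c * (Ψ x u)⁻¹) • u))]
      refine Finset.sum_congr rfl fun y _ => ?_
      rw [Equiv.coe_addRight, ind_add_mem (U.smul_mem _ hu)]
      have : Ψ x (y + (c * (Ψ x u)⁻¹) • u) = Ψ x y + c := by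
        rw [map_add, map_smul, smul_eq_mul, mul_assoc, inv_mul_cancel₀ hxu', mul_one]
      rw [this]
      by_cases h : Ψ x y = 0
      · rw [ind_of_mem (U := LinearMap.ker (Ψ x)) (LinearMap.mem_ker.2 h)]; simp [h]
      · rw [ind_of_notMem (U := LinearMap.ker (Ψ x)) fun h' => h (LinearMap.mem_ker.1 h')]; simp [h]
    rw [Finset.sum_congr rfl fun y _ => h1 y, Finset.sum_comm, Finset.sum_congr rfl fun c _ => h2 c]
    simp [mul_comm, Nat.card_eq_fintype_card]

variable [FiniteDimensional F V]

theorem card_submodule (U : Submodule F V) :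
    (Nat.card U : ℚ) = (Nat.card F : ℚ) ^ Module.finrank F U := by
  rw [Module.natCard_eq_pow_finrank (K := F)]
  push_cast
  rfl

theorem card_orthogonal_mul {Ψ : BilinForm F V} (hnd : Ψ.Nondegenerate) (U : Submodule F V) :
    (Nat.card (Ψ.orthogonal U) : ℚ) * Nat.card U = Nat.card V := by
  rw [card_submodule, card_submodule, Module.natCard_eq_pow_finrank (K := F) (V := V), ← pow_add,
    LinearMap.BilinForm.finrank_orthogonal hnd, Nat.sub_add_cancel U.finrank_le]
  push_cast
  rfl

theorem card_sup_mul_card_inf (U W : Submodule F V) :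
    (Nat.card (U ⊔ W : Submodule F V) : ℚ) * Nat.card (U ⊓ W : Submodule F V) =
      Nat.card U * Nat.card W := by
  simp only [card_submodule, ← pow_add, Submodule.finrank_sup_add_finrank_inf_eq]

theorem card_plane {Ψ : BilinForm F V} (P : NondegeneratePlane Ψ) :
    (Nat.card P.1 : ℚ) = (Nat.card F : ℚ) ^ 2 := by
  rw [card_submodule, P.2.1]

/-- The non-degenerate plane spanned by two non-orthogonal vectors. -/
noncomputable def spanPlane {Ψ : BilinForm F V} (hΨ : Ψ.IsAlt) {x y : V} (h : Ψ x y ≠ 0) :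
    NondegeneratePlane Ψ :=
  ⟨Submodule.span F {x, y}, by
    have hli : LinearIndependent F ![x, y] := by
      rw [LinearIndependent.pair_iff]
      intro s t hst
      have h1 := congrArg (Ψ x) hst
      have h2 := congrArg (fun z => Ψ z y) hst
      simp only [map_add, map_smul, hΨ.self_eq_zero, smul_eq_mul, mul_zero, zero_add, map_zero,
        mul_eq_zero, h, or_false, LinearMap.add_apply, LinearMap.smul_apply, add_zero,
        LinearMap.zero_apply] at h1 h2
      exact ⟨h2, h1⟩
    constructor
    · have := finrank_span_eq_card hli
      rwa [Matrix.range_cons_cons_empty, Fintype.card_fin] at this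
    · rw [nondegenerate_restrict_iff hΨ, Submodule.disjoint_def]
      intro z hz hz'
      obtain ⟨s, t, rfl⟩ := Submodule.mem_span_pair.1 hz
      have h1 := hz' x (Submodule.subset_span (by simp))
      have h2 := hz' y (Submodule.subset_span (by simp))
      have h3 : Ψ y x ≠ 0 := fun h3 => h (hΨ.isRefl.eq_iff.1 h3)
      change Ψ x (s • x + t • y) = 0 at h1
      change Ψ y (s • x + t • y) = 0 at h2
      simp only [map_add, map_smul, hΨ.self_eq_zero, smul_eq_mul, mul_zero, zero_add,
        mul_eq_zero, h, h3, or_false, add_zero] at h1 h2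
      simp [h1, h2]⟩

theorem eq_spanPlane {Ψ : BilinForm F V} (hΨ : Ψ.IsAlt) {x y : V} (h : Ψ x y ≠ 0)
    {P : NondegeneratePlane Ψ} (hx : x ∈ P.1) (hy : y ∈ P.1) : P = spanPlane hΨ h := by
  refine Subtype.ext (Submodule.eq_of_le_of_finrank_eq ?_ ?_).symm
  · rw [spanPlane, Submodule.span_le]
    rintro z (rfl | rfl)
    · exact hx
    · exact hy
  · rw [P.2.1, (spanPlane hΨ h).2.1]

theorem spanPlane_le {Ψ : BilinForm F V} (hΨ : Ψ.IsAlt) {x y : V} (h : Ψ x y ≠ 0)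
    {U : Submodule F V} (hx : x ∈ U) (hy : y ∈ U) : (spanPlane hΨ h).1 ≤ U := by
  rw [spanPlane, Submodule.span_le]
  rintro z (rfl | rfl)
  · exact hx
  · exact hy

theorem left_mem_spanPlane {Ψ : BilinForm F V} (hΨ : Ψ.IsAlt) {x y : V} (h : Ψ x y ≠ 0) :
    x ∈ (spanPlane hΨ h).1 := Submodule.subset_span (by simp)

theorem right_mem_spanPlane {Ψ : BilinForm F V} (hΨ : Ψ.IsAlt) {x y : V} (h : Ψ x y ≠ 0) :
    y ∈ (spanPlane hΨ h).1 := Submodule.subset_span (by simp)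

/-- In a non-degenerate plane, orthogonal vectors are proportional. -/
theorem mem_span_of_mem_plane {Ψ : BilinForm F V} (hΨ : Ψ.IsAlt) {P : NondegeneratePlane Ψ}
    {x y : V} (hx : x ∈ P.1) (hy : y ∈ P.1) (hx0 : x ≠ 0) (h : Ψ x y = 0) :
    y ∈ Submodule.span F {x} := by
  have hxP : x ∉ Ψ.orthogonal P.1 := fun h' => hx0
    (Submodule.disjoint_def.1 ((nondegenerate_restrict_iff hΨ _).1 P.2.2) x hx h')
  rw [mem_orthogonal_iff_le_ker hΨ, SetLike.not_le_iff_exists] at hxP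
  obtain ⟨u, hu, hxu⟩ := hxP
  have hxu' : Ψ x u ≠ 0 := hxu
  rw [eq_spanPlane hΨ hxu' hx hu] at hy
  obtain ⟨s, t, rfl⟩ := Submodule.mem_span_pair.1 hy
  simp only [map_add, map_smul, hΨ.self_eq_zero, smul_eq_mul, mul_zero, zero_add, mul_eq_zero,
    hxu', or_false] at h
  rw [h, zero_smul, add_zero]
  exact Submodule.smul_mem _ _ (Submodule.mem_span_singleton_self x)

variable {Ψ : BilinForm F V}

theorem indLE_spanPlane (hΨ : Ψ.IsAlt) {x y : V} (h : Ψ x y ≠ 0) (U : Submodule F V) :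
    indLE (spanPlane hΨ h).1 U = ind U x * ind U y := by
  by_cases hx : x ∈ U
  · by_cases hy : y ∈ U
    · rw [indLE_of_le (spanPlane_le hΨ h hx hy), ind_of_mem hx, ind_of_mem hy, one_mul]
    · rw [indLE_of_not_le fun hle => hy (hle (right_mem_spanPlane hΨ h)), ind_of_notMem hy,
        mul_zero]
  · rw [indLE_of_not_le fun hle => hx (hle (left_mem_spanPlane hΨ h)), ind_of_notMem hx, zero_mul]

theorem ind_orthogonal_plane (hΨ : Ψ.IsAlt) (P : NondegeneratePlane Ψ) {x : V} (hx : x ∈ P.1) (hx0 : x ≠ 0) :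
    ind (Ψ.orthogonal P.1) x = 0 :=
  ind_of_notMem fun h' => hx0
    (Submodule.disjoint_def.1 ((nondegenerate_restrict_iff hΨ _).1 P.2.2) x hx h')

/-- A non-orthogonal pair lies in exactly one non-degenerate plane. All plane counts below reduce to
counting such pairs. -/
theorem sum_planes_of_ne [Fintype (NondegeneratePlane Ψ)] (hΨ : Ψ.IsAlt) {x y : V} (h : Ψ x y ≠ 0) (φ : NondegeneratePlane Ψ → ℚ) :
    ∑ P, φ P * (ind P.1 x * ind P.1 y) = φ (spanPlane hΨ h) := by
  rw [Finset.sum_eq_single (spanPlane hΨ h)]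
  · rw [ind_of_mem (left_mem_spanPlane hΨ h), ind_of_mem (right_mem_spanPlane hΨ h)]; ring
  · intro P _ hP
    by_cases hx : x ∈ P.1
    · by_cases hy : y ∈ P.1
      · exact absurd (eq_spanPlane hΨ h hx hy) hP
      · rw [ind_of_notMem hy]; ring
    · rw [ind_of_notMem hx]; ring
  · exact fun h => absurd (Finset.mem_univ _) h

variable [Fintype V] [Finite F]

/-- A nonzero vector of a plane is orthogonal to `q` vectors of the plane. -/
theorem sum_ind_mul_one_sub (hΨ : Ψ.IsAlt) (P : NondegeneratePlane Ψ) {x : V} (hx0 : x ≠ 0) (hx : x ∈ P.1) :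
    ∑ y, ind P.1 y * (1 - ind (LinearMap.ker (Ψ x)) y) =
      (Nat.card F : ℚ) ^ 2 - Nat.card F := by
  have hq : (Nat.card F : ℚ) ≠ 0 := (zero_lt_one.trans one_lt_card).ne'
  simp only [mul_sub, mul_one, Finset.sum_sub_distrib]
  rw [sum_ind, sum_ind_mul_ind_ker hΨ, card_plane, ind_orthogonal_plane hΨ P hx hx0]
  field_simp
  ring

variable [Fintype (NondegeneratePlane Ψ)]

/-- The number of non-degenerate planes of `U` that contain a given vector. -/
theorem sum_planes_ind (hΨ : Ψ.IsAlt) (U : Submodule F V) {x : V} (hx0 : x ≠ 0) :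
    ∑ P : NondegeneratePlane Ψ, indLE P.1 U * ind P.1 x =
      ind U x * (1 - ind (Ψ.orthogonal U) x) * (Nat.card U / (Nat.card F : ℚ) ^ 2) := by
  have hq1 : (1 : ℚ) < Nat.card F := one_lt_card
  have hq : (Nat.card F : ℚ) ≠ 0 := (zero_lt_one.trans hq1).ne'
  have hne : (Nat.card F : ℚ) - 1 ≠ 0 := (sub_pos.2 hq1).ne'
  -- Double count pairs of a plane `P` through `x` and a vector `y` of `P` not orthogonal to `x`:
  -- each plane has `q ^ 2 - q` such vectors, and each `y` determines `P`.
  have h1 : ∑ P : NondegeneratePlane Ψ, ∑ y, indLE P.1 U * (ind P.1 x * ind P.1 y) *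
      (1 - ind (LinearMap.ker (Ψ x)) y) =
      ((Nat.card F : ℚ) ^ 2 - Nat.card F) *
        ∑ P : NondegeneratePlane Ψ, indLE P.1 U * ind P.1 x := by
    rw [Finset.mul_sum]
    refine Finset.sum_congr rfl fun P _ => ?_
    by_cases hx : x ∈ P.1
    · rw [← sum_ind_mul_one_sub hΨ P hx0 hx, Finset.sum_mul]
      refine Finset.sum_congr rfl fun y _ => ?_
      rw [ind_of_mem hx]; ring
    · simp [ind_of_notMem hx]
  have h2 : ∀ y, ∑ P : NondegeneratePlane Ψ, indLE P.1 U * (ind P.1 x * ind P.1 y) *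
      (1 - ind (LinearMap.ker (Ψ x)) y) =
      ind U x * (ind U y - ind U y * ind (LinearMap.ker (Ψ x)) y) := by
    intro y
    rw [← Finset.sum_mul]
    by_cases h : Ψ x y = 0
    · rw [ind_of_mem (U := LinearMap.ker (Ψ x)) (LinearMap.mem_ker.2 h)]; ring
    · rw [sum_planes_of_ne hΨ h (fun P => indLE P.1 U), indLE_spanPlane hΨ h]; ring
  rw [Finset.sum_comm, Finset.sum_congr rfl fun y _ => h2 y, ← Finset.mul_sum,
    Finset.sum_sub_distrib, sum_ind, sum_ind_mul_ind_ker hΨ] at h1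
  have h3 : (Nat.card F : ℚ) ^ 2 - Nat.card F ≠ 0 := by
    have : (Nat.card F : ℚ) ^ 2 - Nat.card F = Nat.card F * (Nat.card F - 1) := by ring
    rw [this]
    exact mul_ne_zero hq hne
  refine mul_left_cancel₀ h3 (h1.symm.trans ?_)
  field_simp
  ring

/-- The number of non-degenerate planes of a subspace `U`. -/
theorem sum_planes_indLE (hΨ : Ψ.IsAlt) (U : Submodule F V) :
    (Nat.card F : ℚ) ^ 2 * ((Nat.card F : ℚ) ^ 2 - 1) *
      ∑ P : NondegeneratePlane Ψ, indLE P.1 U =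
      Nat.card U * (Nat.card U - Nat.card (U ⊓ Ψ.orthogonal U : Submodule F V)) := by
  classical
  have hq1 : (1 : ℚ) < Nat.card F := one_lt_card
  have hq : (Nat.card F : ℚ) ≠ 0 := (zero_lt_one.trans hq1).ne'
  -- Double count pairs of a plane of `U` and a nonzero vector of it; vectors in the radical of `U`
  -- lie in no such plane.
  have h1 : ∑ P : NondegeneratePlane Ψ, ∑ x, indLE P.1 U * ind P.1 x * (if x = 0 then 0 else 1) =
      ((Nat.card F : ℚ) ^ 2 - 1) * ∑ P : NondegeneratePlane Ψ, indLE P.1 U := by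
    rw [Finset.mul_sum]
    refine Finset.sum_congr rfl fun P _ => ?_
    have : ∀ x, indLE P.1 U * ind P.1 x * (if x = 0 then 0 else 1) =
        indLE P.1 U * (ind P.1 x - if x = 0 then 1 else 0) := by
      intro x
      split_ifs with h
      · rw [h, ind_zero]; ring
      · ring
    rw [Finset.sum_congr rfl fun x _ => this x, ← Finset.mul_sum, Finset.sum_sub_distrib, sum_ind,
      card_plane]
    simp [mul_comm]
  have h2 : ∀ x, ∑ P : NondegeneratePlane Ψ, indLE P.1 U * ind P.1 x * (if x = 0 then 0 else 1) =
      (ind U x - ind (U ⊓ Ψ.orthogonal U) x) * (Nat.card U / (Nat.card F : ℚ) ^ 2) := by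
    intro x
    rw [← Finset.sum_mul]
    split_ifs with h
    · rw [h, ind_zero, ind_zero]; ring
    · rw [sum_planes_ind hΨ U h, ← ind_mul_ind]; ring
  rw [Finset.sum_comm, Finset.sum_congr rfl fun x _ => h2 x, ← Finset.sum_mul,
    Finset.sum_sub_distrib, sum_ind, sum_ind] at h1
  rw [mul_assoc, ← h1]
  field_simp

end Counting

end Symplectic

namespace Symplectic

open LinearMap (BilinForm)

/-! ### The spectral gap of the orthogonality graph -/

section Spectral

variable {F V : Type*} [Field F] [AddCommGroup V] [Module F V]

/-- Sum a function on planes over the planes that contain a vector. -/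
noncomputable def vecSum {Ψ : BilinForm F V} [Fintype (NondegeneratePlane Ψ)]
    (f : NondegeneratePlane Ψ → ℚ) (x : V) : ℚ := ∑ P, f P * ind P.1 x

/-- Sum a function on vectors over the vectors of a plane. -/
noncomputable def planeSum [Fintype V] {Ψ : BilinForm F V} (g : V → ℚ) (P : NondegeneratePlane Ψ) : ℚ :=
  ∑ x, ind P.1 x * g x

/-- Sum a function on vectors over the vectors orthogonal to a given one. -/
noncomputable def orthSum [Fintype V] (Ψ : BilinForm F V) (g : V → ℚ) (x : V) : ℚ :=
  ∑ y, ind (LinearMap.ker (Ψ x)) y * g y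

/-- Sum a function on planes over the planes orthogonal to a given one. -/
noncomputable def adjSum {Ψ : BilinForm F V} [Fintype (NondegeneratePlane Ψ)]
    (f : NondegeneratePlane Ψ → ℚ) (P : NondegeneratePlane Ψ) : ℚ :=
  ∑ Q, indLE Q.1 (Ψ.orthogonal P.1) * f Q

/-- Functions on vectors that come from functions with sum zero on the points of the projective
space. -/
structure IsProjective (F : Type*) {V : Type*} [Field F] [AddCommGroup V] [Module F V] [Fintype V]
    (g : V → ℚ) : Prop where
  zero : g 0 = 0
  sum : ∑ x, g x = 0
  smul : ∀ (c : F) (x : V), c ≠ 0 → g (c • x) = g x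

theorem IsProjective.linearComb [Fintype V] {g h : V → ℚ} (hg : IsProjective F g) (hh : IsProjective F h)
    (a b : ℚ) : IsProjective F fun x => a * g x + b * h x where
  zero := by simp [hg.zero, hh.zero]
  sum := by simp [Finset.sum_add_distrib, ← Finset.mul_sum, hg.sum, hh.sum]
  smul c x hc := by simp [hg.smul c x hc, hh.smul c x hc]

theorem IsProjective.sum_span [Fintype V] [Finite F] {g : V → ℚ} (hg : IsProjective F g) {x : V} (hx : x ≠ 0) :
    ∑ y, ind (Submodule.span F {x}) y * g y = ((Nat.card F : ℚ) - 1) * g x := by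
  classical
  have := Fintype.ofFinite F
  rw [← Fintype.sum_of_injective (fun c : F => c • x) (smul_left_injective F hx)
    (fun c => if c = 0 then 0 else g x)]
  · have : ∀ c : F, (if c = 0 then (0 : ℚ) else g x) = g x - if c = 0 then g x else 0 := by
      intro c; split_ifs <;> simp
    simp only [this, Finset.sum_sub_distrib]
    simp [Nat.card_eq_fintype_card, sub_mul]
  · intro y hy
    rw [ind_of_notMem, zero_mul]
    intro h
    obtain ⟨c, rfl⟩ := Submodule.mem_span_singleton.1 h
    exact hy ⟨c, rfl⟩
  · intro c
    rw [ind_of_mem (Submodule.mem_span_singleton.2 ⟨c, rfl⟩), one_mul]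
    split_ifs with h
    · rw [h, zero_smul, hg.zero]
    · rw [hg.smul c x h]

variable {Ψ : BilinForm F V}

theorem orthogonal_ker [FiniteDimensional F V] (hΨ : Ψ.IsAlt) (hnd : Ψ.Nondegenerate) (x : V) :
    Ψ.orthogonal (LinearMap.ker (Ψ x)) = Submodule.span F {x} := by
  have h : Ψ.orthogonal (Submodule.span F {x}) = LinearMap.ker (Ψ x) :=
    LinearMap.BilinForm.orthogonal_span_singleton_eq_toLin_ker x
  rw [← h, LinearMap.BilinForm.orthogonal_orthogonal hnd hΨ.isRefl]

theorem card_orthogonal_plane [FiniteDimensional F V] [Finite F] (hnd : Ψ.Nondegenerate) (P : NondegeneratePlane Ψ) :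
    (Nat.card (Ψ.orthogonal P.1) : ℚ) = Nat.card V / (Nat.card F : ℚ) ^ 2 := by
  have hq : (Nat.card F : ℚ) ≠ 0 := (zero_lt_one.trans one_lt_card).ne'
  rw [eq_div_iff (pow_ne_zero 2 hq), ← card_plane P, card_orthogonal_mul hnd]

variable [Fintype V]

theorem sum_orthSum_mul (hΨ : Ψ.IsAlt) (g h : V → ℚ) :
    ∑ x, orthSum Ψ g x * h x = ∑ x, g x * orthSum Ψ h x := by
  simp only [orthSum, Finset.sum_mul, Finset.mul_sum]
  rw [Finset.sum_comm]
  refine Finset.sum_congr rfl fun y _ => Finset.sum_congr rfl fun x _ => ?_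
  rw [ind_ker_comm hΨ]; ring

theorem sum_planeSum_mul [Fintype (NondegeneratePlane Ψ)] (g : V → ℚ)
    (f : NondegeneratePlane Ψ → ℚ) : ∑ P, planeSum g P * f P = ∑ x, g x * vecSum f x := by
  simp only [planeSum, vecSum, Finset.sum_mul, Finset.mul_sum]
  rw [Finset.sum_comm]
  refine Finset.sum_congr rfl fun x _ => Finset.sum_congr rfl fun P _ => ?_
  ring

theorem isProjective_vecSum [FiniteDimensional F V] [Fintype (NondegeneratePlane Ψ)]
    {f : NondegeneratePlane Ψ → ℚ} (hf : ∑ P, f P = 0) :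
    IsProjective F (vecSum f) where
  zero := by simpa [vecSum, ind_zero] using hf
  sum := by
    simp only [vecSum]
    rw [Finset.sum_comm]
    simp only [← Finset.mul_sum, sum_ind, card_plane, ← Finset.sum_mul, hf, zero_mul]
  smul c x hc := by
    refine Finset.sum_congr rfl fun P _ => ?_
    congr 1
    exact ind_congr (Submodule.smul_mem_iff _ hc)

variable [Finite F]

theorem card_ker (hΨ : Ψ.IsAlt) (hnd : Ψ.Nondegenerate) {x : V} (hx : x ≠ 0) :
    (Nat.card (LinearMap.ker (Ψ x)) : ℚ) = Nat.card V / Nat.card F := by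
  have h1 := sum_ind_mul_ind_ker hΨ ⊤ x
  have h2 : ind (Ψ.orthogonal ⊤) x = 0 := by
    rw [LinearMap.BilinForm.orthogonal_top_eq_bot hnd]
    exact ind_of_notMem (by simpa using hx)
  rw [h2] at h1
  simp only [ind_mul_ind, top_inf_eq, sum_ind, zero_mul, add_zero] at h1
  rw [h1]
  congr 2
  exact Nat.card_congr (Equiv.Set.univ V)

theorem sum_ind_ker (hΨ : Ψ.IsAlt) (hnd : Ψ.Nondegenerate) {x : V} (hx : x ≠ 0) :
    ∑ y, ind (LinearMap.ker (Ψ x)) y = (Nat.card V : ℚ) / Nat.card F := by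
  rw [sum_ind, card_ker hΨ hnd hx]

theorem IsProjective.orthSum (hΨ : Ψ.IsAlt) (hnd : Ψ.Nondegenerate) {g : V → ℚ}
    (hg : IsProjective F g) : IsProjective F (orthSum Ψ g) where
  zero := by
    rw [← hg.sum]
    refine Finset.sum_congr rfl fun y _ => ?_
    rw [ind_of_mem (by simp), one_mul]
  sum := by
    simp only [Symplectic.orthSum]
    rw [Finset.sum_comm]
    have : ∀ y, ∑ x, ind (LinearMap.ker (Ψ x)) y * g y =
        (Nat.card V : ℚ) / Nat.card F * g y := by
      intro y
      by_cases hy : y = 0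
      · simp [hy, hg.zero]
      · rw [← sum_ind_ker hΨ hnd hy, Finset.sum_mul]
        exact Finset.sum_congr rfl fun x _ => by rw [ind_ker_comm hΨ]
    simp only [this, ← Finset.mul_sum, hg.sum, mul_zero]
  smul c x hc := by
    refine Finset.sum_congr rfl fun y _ => ?_
    congr 1
    refine ind_congr ?_
    simp [hc]

variable [FiniteDimensional F V]

/-- For nonzero `x`, the number of vectors orthogonal to both `x` and `z` depends only on whether
`z` lies on the line of `x`. The constant part is killed by the zero sum, leaving a scalar. -/
theorem IsProjective.orthSum_orthSum (hΨ : Ψ.IsAlt) (hnd : Ψ.Nondegenerate) {g : V → ℚ}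
    (hg : IsProjective F g) (x : V) :
    Symplectic.orthSum Ψ (Symplectic.orthSum Ψ g) x =
      Nat.card V / (Nat.card F : ℚ) ^ 2 * ((Nat.card F : ℚ) - 1) ^ 2 * g x := by
  have hq : (Nat.card F : ℚ) ≠ 0 := (zero_lt_one.trans one_lt_card).ne'
  by_cases hx : x = 0
  · rw [hx, ((hg.orthSum hΨ hnd).orthSum hΨ hnd).zero, hg.zero, mul_zero]
  · simp only [Symplectic.orthSum, Finset.mul_sum]
    rw [Finset.sum_comm]
    have : ∀ z, ∑ y, ind (LinearMap.ker (Ψ x)) y * (ind (LinearMap.ker (Ψ y)) z * g z) =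
        (Nat.card V / (Nat.card F : ℚ) ^ 2) * g z +
        (Nat.card V / (Nat.card F : ℚ) - Nat.card V / (Nat.card F : ℚ) ^ 2) *
          (ind (Submodule.span F {x}) z * g z) := by
      intro z
      have h1 := sum_ind_mul_ind_ker hΨ (LinearMap.ker (Ψ x)) z
      rw [orthogonal_ker hΨ hnd, card_ker hΨ hnd hx] at h1
      simp only [ind_ker_comm hΨ _ z, ← mul_assoc, ← Finset.sum_mul]
      rw [h1]
      field_simp
    simp only [this, Finset.sum_add_distrib, ← Finset.mul_sum, hg.sum, hg.sum_span hx]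
    field_simp
    ring

variable [Fintype (NondegeneratePlane Ψ)]

/-- The number of non-degenerate planes through a vector. -/
theorem sum_planes_ind_top (hΨ : Ψ.IsAlt) (hnd : Ψ.Nondegenerate) {x : V} (hx : x ≠ 0) :
    ∑ P : NondegeneratePlane Ψ, ind P.1 x = Nat.card V / (Nat.card F : ℚ) ^ 2 := by
  have h := sum_planes_ind hΨ ⊤ hx
  have h2 : ind (Ψ.orthogonal ⊤) x = 0 := by
    rw [LinearMap.BilinForm.orthogonal_top_eq_bot hnd]
    exact ind_of_notMem (by simpa using hx)
  have h3 : Nat.card (⊤ : Submodule F V) = Nat.card V := Nat.card_congr (Equiv.Set.univ V)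
  simp only [indLE_of_le le_top, one_mul, h2, sub_zero, mul_one, ind_of_mem (Submodule.mem_top),
    h3] at h
  exact h

/-- Three cases: a non-orthogonal pair spans a unique plane, orthogonal independent vectors share
none, and a multiple of `x` lies in every plane through `x`. -/
theorem sum_planes_ind_mul_ind (hΨ : Ψ.IsAlt) (hnd : Ψ.Nondegenerate) {x : V} (hx : x ≠ 0)
    (y : V) : ∑ P : NondegeneratePlane Ψ, ind P.1 x * ind P.1 y =
      1 - ind (LinearMap.ker (Ψ x)) y +
        Nat.card V / (Nat.card F : ℚ) ^ 2 * ind (Submodule.span F {x}) y := by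
  by_cases hxy : Ψ x y = 0
  · rw [ind_of_mem (U := LinearMap.ker (Ψ x)) (LinearMap.mem_ker.2 hxy), sub_self, zero_add]
    by_cases hy : y ∈ Submodule.span F {x}
    · rw [ind_of_mem hy, mul_one, ← sum_planes_ind_top hΨ hnd hx]
      refine Finset.sum_congr rfl fun P _ => ?_
      by_cases hP : x ∈ P.1
      · rw [ind_of_mem (U := P.1) (x := y), mul_one]
        exact (Submodule.span_singleton_le_iff_mem x P.1).2 hP hy
      · rw [ind_of_notMem hP, zero_mul]
    · rw [ind_of_notMem hy, mul_zero]
      refine Finset.sum_eq_zero fun P _ => ?_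
      by_cases hP : x ∈ P.1
      · by_cases hP' : y ∈ P.1
        · exact absurd (mem_span_of_mem_plane hΨ hP hP' hx hxy) hy
        · rw [ind_of_notMem hP', mul_zero]
      · rw [ind_of_notMem hP, zero_mul]
  · have h := sum_planes_of_ne hΨ hxy fun _ => 1
    simp only [one_mul] at h
    rw [h, ind_of_notMem (U := LinearMap.ker (Ψ x)) (fun h => hxy (LinearMap.mem_ker.1 h)),
      ind_of_notMem (U := Submodule.span F {x})]
    · ring
    · intro h
      obtain ⟨c, rfl⟩ := Submodule.mem_span_singleton.1 h
      exact hxy (by simp [hΨ.self_eq_zero])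

/-- `vecSum` and `planeSum` are adjoint, so this is the Gram operator of the vector–plane incidence.
It is a polynomial in `orthSum`, and so it commutes with `orthSum` and can be inverted. -/
theorem vecSum_planeSum (hΨ : Ψ.IsAlt) (hnd : Ψ.Nondegenerate) {g : V → ℚ}
    (hg : IsProjective F g) (x : V) :
    vecSum (planeSum (Ψ := Ψ) g) x =
      Nat.card V / (Nat.card F : ℚ) ^ 2 * ((Nat.card F : ℚ) - 1) * g x - orthSum Ψ g x := by
  have h0 : vecSum (planeSum (Ψ := Ψ) g) x =
      ∑ y, (∑ P : NondegeneratePlane Ψ, ind P.1 x * ind P.1 y) * g y := by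
    simp only [vecSum, planeSum, Finset.sum_mul]
    rw [Finset.sum_comm]
    refine Finset.sum_congr rfl fun y _ => Finset.sum_congr rfl fun P _ => ?_
    ring
  rw [h0]
  by_cases hx : x = 0
  · rw [hx, (hg.orthSum hΨ hnd).zero, hg.zero, mul_zero, sub_zero]
    have : ∀ y, (∑ P : NondegeneratePlane Ψ, ind P.1 0 * ind P.1 y) * g y =
        Nat.card V / (Nat.card F : ℚ) ^ 2 * g y := by
      intro y
      by_cases hy : y = 0
      · simp [hy, hg.zero]
      · simp only [ind_zero, one_mul, sum_planes_ind_top hΨ hnd hy]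
    simp only [this, ← Finset.mul_sum, hg.sum, mul_zero]
  · simp only [sum_planes_ind_mul_ind hΨ hnd hx, add_mul, sub_mul, one_mul,
      Finset.sum_add_distrib, Finset.sum_sub_distrib, hg.sum, mul_assoc, ← Finset.mul_sum,
      hg.sum_span hx]
    rw [orthSum]
    ring

/-- Both sides are multiples of the sum of `g` over the orthogonal complement of `P`. Hence
adjacency of planes preserves the functions induced from vectors and acts there through
orthogonality of vectors. -/
theorem adjSum_planeSum (hΨ : Ψ.IsAlt) (hnd : Ψ.Nondegenerate) {g : V → ℚ}
    (hg : IsProjective F g) (P : NondegeneratePlane Ψ) :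
    (((Nat.card F : ℚ)) ^ 2 - Nat.card F) * adjSum (planeSum g) P =
      Nat.card V / (Nat.card F : ℚ) ^ 4 * planeSum (orthSum Ψ g) P := by
  have hq : (Nat.card F : ℚ) ≠ 0 := (zero_lt_one.trans one_lt_card).ne'
  have h1 : adjSum (planeSum g) P =
      Nat.card V / (Nat.card F : ℚ) ^ 4 * ∑ y, ind (Ψ.orthogonal P.1) y * g y := by
    simp only [adjSum, planeSum, Finset.mul_sum]
    rw [Finset.sum_comm]
    refine Finset.sum_congr rfl fun y _ => ?_
    by_cases hy : y = 0
    · simp [hy, hg.zero]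
    · simp only [← mul_assoc, ← Finset.sum_mul]
      rw [sum_planes_ind hΨ _ hy, card_orthogonal_plane hnd,
        LinearMap.BilinForm.orthogonal_orthogonal hnd hΨ.isRefl]
      by_cases hyP : y ∈ P.1
      · rw [ind_orthogonal_plane hΨ P hyP hy]; ring
      · rw [ind_of_notMem hyP]; field_simp; ring
  have h2 : planeSum (orthSum Ψ g) P =
      ((Nat.card F : ℚ) ^ 2 - Nat.card F) * ∑ y, ind (Ψ.orthogonal P.1) y * g y := by
    simp only [planeSum, orthSum, Finset.mul_sum]
    rw [Finset.sum_comm]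
    have : ∀ y, ∑ x, ind P.1 x * (ind (LinearMap.ker (Ψ x)) y * g y) = Nat.card F * g y +
        ((Nat.card F : ℚ) ^ 2 - Nat.card F) * (ind (Ψ.orthogonal P.1) y * g y) := by
      intro y
      have h1 := sum_ind_mul_ind_ker hΨ P.1 y
      rw [card_plane] at h1
      simp only [ind_ker_comm hΨ _ y, ← mul_assoc, ← Finset.sum_mul]
      rw [h1]
      field_simp
    simp only [this, Finset.sum_add_distrib, ← Finset.mul_sum, hg.sum, mul_zero, zero_add]
  rw [h1, h2]; ring

/-- A function on planes with sum zero is the sum of a function that comes from vectors and a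
function whose sums over planes through a vector vanish. -/
theorem exists_planeSum_add (hΨ : Ψ.IsAlt) (hnd : Ψ.Nondegenerate)
    (hV : (Nat.card F : ℚ) ^ 2 < Nat.card V)
    {f : NondegeneratePlane Ψ → ℚ} (hf : ∑ P, f P = 0) :
    ∃ g : V → ℚ, IsProjective F g ∧ ∀ x, vecSum (fun P => f P - planeSum g P) x = 0 := by
  have hq1 : (1 : ℚ) < Nat.card F := one_lt_card
  have hh := isProjective_vecSum hf
  set a : ℚ := Nat.card V / (Nat.card F : ℚ) ^ 2 * ((Nat.card F : ℚ) - 1) with ha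
  set b : ℚ := Nat.card V / (Nat.card F : ℚ) ^ 2 * ((Nat.card F : ℚ) - 1) ^ 2 with hb
  have he : a ^ 2 - b ≠ 0 := by
    have h1 : 1 < Nat.card V / (Nat.card F : ℚ) ^ 2 := by
      rw [one_lt_div (by positivity)]; exact hV
    have : a ^ 2 - b = Nat.card V / (Nat.card F : ℚ) ^ 2 * ((Nat.card F : ℚ) - 1) ^ 2 *
        (Nat.card V / (Nat.card F : ℚ) ^ 2 - 1) := by rw [ha, hb]; ring
    rw [this]
    have h2 : (Nat.card F : ℚ) - 1 ≠ 0 := (sub_pos.2 hq1).ne'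
    have h3 : Nat.card V / (Nat.card F : ℚ) ^ 2 - 1 ≠ 0 := (sub_pos.2 h1).ne'
    have h4 : Nat.card V / (Nat.card F : ℚ) ^ 2 ≠ 0 := (zero_lt_one.trans h1).ne'
    exact mul_ne_zero (mul_ne_zero h4 (pow_ne_zero 2 h2)) h3
  -- The Gram operator is `a - D` with `D` the operator `orthSum` and `D ^ 2 = b`, so its inverse is
  -- `(a + D) / (a ^ 2 - b)`; apply it to `vecSum f`.
  have hg := hh.linearComb (hh.orthSum hΨ hnd) (a / (a ^ 2 - b)) (1 / (a ^ 2 - b))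
  refine ⟨_, hg, fun x => ?_⟩
  have h1 : ∀ g : V → ℚ, vecSum (fun P => f P - planeSum g P) x =
      vecSum f x - vecSum (planeSum (Ψ := Ψ) g) x := fun g => by
    simp only [vecSum, sub_mul, Finset.sum_sub_distrib]
  rw [h1, vecSum_planeSum hΨ hnd hg]
  have h2 : orthSum Ψ (fun x => a / (a ^ 2 - b) * vecSum f x +
      1 / (a ^ 2 - b) * orthSum Ψ (vecSum f) x) x =
      a / (a ^ 2 - b) * orthSum Ψ (vecSum f) x + 1 / (a ^ 2 - b) * (b * vecSum f x) := by
    rw [← hh.orthSum_orthSum hΨ hnd]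
    simp only [orthSum, Finset.mul_sum, ← Finset.sum_add_distrib]
    refine Finset.sum_congr rfl fun y _ => ?_
    rw [mul_add, Finset.mul_sum]
    congr 1
    · ring
    · exact Finset.sum_congr rfl fun z _ => by ring
  rw [h2, ← ha]
  field_simp
  ring

/-- Up to a constant, adjacency replaces `g` by `orthSum Ψ g`. The latter operator is self-adjoint,
squares to a scalar and commutes with the Gram operator, so it scales the norm of `planeSum g`. -/
theorem adjSum_sq_planeSum (hΨ : Ψ.IsAlt) (hnd : Ψ.Nondegenerate) {g : V → ℚ}
    (hg : IsProjective F g) :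
    ∑ P : NondegeneratePlane Ψ, adjSum (planeSum g) P ^ 2 =
      (Nat.card V : ℚ) ^ 3 / (Nat.card F : ℚ) ^ 12 * ∑ P : NondegeneratePlane Ψ, planeSum g P ^ 2 := by
  have hq1 : (1 : ℚ) < Nat.card F := one_lt_card
  have hq : (Nat.card F : ℚ) ≠ 0 := (zero_lt_one.trans hq1).ne'
  have hq2 : (Nat.card F : ℚ) - 1 ≠ 0 := (sub_pos.2 hq1).ne'
  have hD := hg.orthSum hΨ hnd
  have h1 : ∀ g : V → ℚ, IsProjective F g → ∑ P : NondegeneratePlane Ψ, planeSum g P ^ 2 =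
      Nat.card V / (Nat.card F : ℚ) ^ 2 * ((Nat.card F : ℚ) - 1) * ∑ x, g x * g x -
        ∑ x, g x * orthSum Ψ g x := by
    intro g hg
    simp only [pow_two, sum_planeSum_mul, vecSum_planeSum hΨ hnd hg, mul_sub, Finset.mul_sum,
      Finset.sum_sub_distrib]
    congr 1
    exact Finset.sum_congr rfl fun x _ => by ring
  have h2 : ∑ P : NondegeneratePlane Ψ, planeSum (orthSum Ψ g) P ^ 2 =
      Nat.card V / (Nat.card F : ℚ) ^ 2 * ((Nat.card F : ℚ) - 1) ^ 2 *
        ∑ P : NondegeneratePlane Ψ, planeSum g P ^ 2 := by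
    rw [h1 _ hD, h1 _ hg, sum_orthSum_mul hΨ, sum_orthSum_mul hΨ g (orthSum Ψ (orthSum Ψ g))]
    simp only [hg.orthSum_orthSum hΨ hnd]
    have h3 : orthSum Ψ (fun x => Nat.card V / (Nat.card F : ℚ) ^ 2 *
        ((Nat.card F : ℚ) - 1) ^ 2 * g x) = fun x => Nat.card V / (Nat.card F : ℚ) ^ 2 *
        ((Nat.card F : ℚ) - 1) ^ 2 * orthSum Ψ g x := by
      funext x
      simp only [orthSum, Finset.mul_sum]
      exact Finset.sum_congr rfl fun y _ => by ring
    have h4 : orthSum Ψ (orthSum Ψ (orthSum Ψ g)) = fun x => Nat.card V / (Nat.card F : ℚ) ^ 2 *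
        ((Nat.card F : ℚ) - 1) ^ 2 * orthSum Ψ g x := funext fun x => hD.orthSum_orthSum hΨ hnd x
    rw [h4]
    simp only [mul_sub, Finset.mul_sum]
    congr 1
    · exact Finset.sum_congr rfl fun x _ => by ring
    · exact Finset.sum_congr rfl fun x _ => by ring
  have h5 : ∀ P : NondegeneratePlane Ψ, adjSum (planeSum g) P =
      Nat.card V / (Nat.card F : ℚ) ^ 4 / ((Nat.card F : ℚ) ^ 2 - Nat.card F) *
        planeSum (orthSum Ψ g) P := by
    intro P
    have hne : (Nat.card F : ℚ) ^ 2 - Nat.card F ≠ 0 := by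
      have : (Nat.card F : ℚ) ^ 2 - Nat.card F = Nat.card F * (Nat.card F - 1) := by ring
      rw [this]
      exact mul_ne_zero hq hq2
    rw [div_mul_eq_mul_div, eq_div_iff hne, mul_comm, adjSum_planeSum hΨ hnd hg]
  simp only [h5, mul_pow, ← Finset.mul_sum, h2]
  have h6 : (Nat.card F : ℚ) ^ 2 - Nat.card F = Nat.card F * (Nat.card F - 1) := by ring
  rw [h6]
  field_simp

end Spectral

end Symplectic

namespace Symplectic

open LinearMap (BilinForm)

/-! ### The adjacency operator on functions with vanishing vector sums, and the combined bound -/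

section SpectralBound

variable {F V : Type*} [Field F] [AddCommGroup V] [Module F V]

theorem sum_comm_pairs {α β : Type*} [Fintype α] [Fintype β] (φ : α → α → β → β → ℚ) :
    ∑ a, ∑ a', ∑ b, ∑ b', φ a a' b b' = ∑ b, ∑ b', ∑ a, ∑ a', φ a a' b b' := by
  calc _ = ∑ a, ∑ b, ∑ a', ∑ b', φ a a' b b' := Finset.sum_congr rfl fun _ _ => Finset.sum_comm
    _ = ∑ b, ∑ a, ∑ a', ∑ b', φ a a' b b' := Finset.sum_comm
    _ = ∑ b, ∑ a, ∑ b', ∑ a', φ a a' b b' := Finset.sum_congr rfl fun _ _ =>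
        Finset.sum_congr rfl fun _ _ => Finset.sum_comm
    _ = _ := Finset.sum_congr rfl fun _ _ => Finset.sum_comm

theorem indLE_orthogonal_comm {Ψ : BilinForm F V} (hΨ : Ψ.IsAlt) (U W : Submodule F V) :
    indLE U (Ψ.orthogonal W) = indLE W (Ψ.orthogonal U) := by
  have hiff : U ≤ Ψ.orthogonal W ↔ W ≤ Ψ.orthogonal U :=
    ⟨fun h x hx y hy => hΨ.isRefl _ _ (h hy x hx), fun h x hx y hy => hΨ.isRefl _ _ (h hy x hx)⟩
  by_cases h : U ≤ Ψ.orthogonal W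
  · rw [indLE_of_le h, indLE_of_le (hiff.1 h)]
  · rw [indLE_of_not_le h, indLE_of_not_le fun h' => h (hiff.2 h')]

theorem card_orthogonal_sup [FiniteDimensional F V] [Finite F] {Ψ : BilinForm F V}
    (hnd : Ψ.Nondegenerate) (P Q : NondegeneratePlane Ψ) :
    (Nat.card (Ψ.orthogonal (P.1 ⊔ Q.1)) : ℚ) = Nat.card V / (Nat.card F : ℚ) ^ 4 *
      Nat.card (P.1 ⊓ Q.1 : Submodule F V) := by
  have hq : (Nat.card F : ℚ) ≠ 0 := (zero_lt_one.trans one_lt_card).ne'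
  have h1 := card_orthogonal_mul hnd (P.1 ⊔ Q.1)
  have h2 := card_sup_mul_card_inf P.1 Q.1
  rw [card_plane, card_plane, ← pow_add] at h2
  have h3 : (Nat.card (P.1 ⊔ Q.1 : Submodule F V) : ℚ) ≠ 0 := by
    intro h
    rw [h, zero_mul] at h2
    exact pow_ne_zero 4 hq h2.symm
  refine mul_right_cancel₀ h3 ?_
  rw [h1, mul_assoc, mul_comm (Nat.card (P.1 ⊓ Q.1 : Submodule F V) : ℚ), h2]
  field_simp

/-- Orthogonal vectors in a common non-degenerate plane are proportional, so the sum is either empty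
or a vector sum of `f`. -/
theorem sum_mul_ind_mul_ind_of_vecSum_eq_zero [FiniteDimensional F V]
    {Ψ : BilinForm F V} [Fintype (NondegeneratePlane Ψ)] (hΨ : Ψ.IsAlt) {f : NondegeneratePlane Ψ → ℚ}
    (hf : ∀ x, vecSum f x = 0) {x y : V} (hxy : Ψ x y = 0) :
    ∑ P, f P * (ind P.1 x * ind P.1 y) = 0 := by
  by_cases hx : x = 0
  · rw [← hf y]
    exact Finset.sum_congr rfl fun P _ => by rw [hx, ind_zero, one_mul]
  · by_cases hy : y ∈ Submodule.span F {x}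
    · rw [← hf x]
      refine Finset.sum_congr rfl fun P _ => ?_
      by_cases hP : x ∈ P.1
      · rw [ind_of_mem (U := P.1) (x := y), mul_one]
        exact (Submodule.span_singleton_le_iff_mem x P.1).2 hP hy
      · rw [ind_of_notMem hP, zero_mul]
    · refine Finset.sum_eq_zero fun P _ => ?_
      by_cases hP : x ∈ P.1
      · by_cases hP' : y ∈ P.1
        · exact absurd (mem_span_of_mem_plane hΨ hP hP' hx hxy) hy
        · rw [ind_of_notMem hP', mul_zero, mul_zero]
      · rw [ind_of_notMem hP, zero_mul, mul_zero]

variable [Fintype V]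

/-- Each `r` in `R` is a difference of an element of `W` and one of `U` in `|U ⊓ W|` ways. -/
theorem sum_ind_sub_eq (U W R : Submodule F V) (hR : R ≤ U ⊔ W) :
    ∑ x, ∑ y, ind U x * ind W y * ind R (y - x) =
      (Nat.card (U ⊓ W : Submodule F V) : ℚ) * Nat.card R := by
  have h1 : ∀ x, ∑ y, ind U x * ind W y * ind R (y - x) =
      ∑ r, ind R r * (ind U x * ind W (r + x)) := by
    intro x
    rw [← Equiv.sum_comp (Equiv.addRight x)]
    refine Finset.sum_congr rfl fun r _ => ?_
    rw [Equiv.coe_addRight, add_sub_cancel_right]; ring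
  rw [Finset.sum_congr rfl fun x _ => h1 x, Finset.sum_comm, ← sum_ind R, Finset.mul_sum]
  refine Finset.sum_congr rfl fun r _ => ?_
  by_cases hr : r ∈ R
  · obtain ⟨u, hu, w, hw, rfl⟩ := Submodule.mem_sup.1 (hR hr)
    rw [ind_of_mem hr, mul_one, ← sum_ind, ← Equiv.sum_comp (Equiv.subRight u)]
    refine Finset.sum_congr rfl fun x _ => ?_
    rw [Equiv.subRight_apply, one_mul, ← ind_mul_ind]
    congr 1
    · exact ind_congr (Submodule.sub_mem_iff_left U hu)
    · refine ind_congr ?_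
      rw [show u + w + (x - u) = x + w by abel, Submodule.add_mem_iff_left W hw]
  · rw [ind_of_notMem hr]; simp

variable {Ψ : BilinForm F V} [FiniteDimensional F V] [Finite F] [Fintype (NondegeneratePlane Ψ)]

/-- The sum over pairs of planes of the squared cardinality of the intersection. -/
theorem sum_sum_card_inf_sq (hΨ : Ψ.IsAlt) {f : NondegeneratePlane Ψ → ℚ}
    (hf : ∀ x, vecSum f x = 0) :
    ∑ P, ∑ Q, f P * f Q * (Nat.card (P.1 ⊓ Q.1 : Submodule F V) : ℚ) ^ 2 =
      ((Nat.card F : ℚ) ^ 2 - 1) * ((Nat.card F : ℚ) ^ 2 - Nat.card F) * ∑ P, f P ^ 2 := by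
  have h1 : ∑ P, ∑ Q, f P * f Q * (Nat.card (P.1 ⊓ Q.1 : Submodule F V) : ℚ) ^ 2 =
      ∑ x, ∑ y, (∑ P, f P * (ind P.1 x * ind P.1 y)) ^ 2 := by
    have : ∀ P Q : NondegeneratePlane Ψ,
        f P * f Q * (Nat.card (P.1 ⊓ Q.1 : Submodule F V) : ℚ) ^ 2 =
        ∑ x, ∑ y, (f P * (ind P.1 x * ind P.1 y)) * (f Q * (ind Q.1 x * ind Q.1 y)) := by
      intro P Q
      rw [← sum_ind, pow_two, Finset.sum_mul_sum, Finset.mul_sum]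
      refine Finset.sum_congr rfl fun x _ => ?_
      rw [Finset.mul_sum]
      refine Finset.sum_congr rfl fun y _ => ?_
      rw [← ind_mul_ind, ← ind_mul_ind]; ring
    rw [Finset.sum_congr rfl fun P _ => Finset.sum_congr rfl fun Q _ => this P Q, sum_comm_pairs]
    simp only [pow_two, Finset.sum_mul_sum]
  -- The squared intersection size counts pairs of vectors. Orthogonal pairs contribute nothing, and
  -- for the others only one plane occurs, so the square has no cross terms.
  have h2 : ∀ x y, (∑ P, f P * (ind P.1 x * ind P.1 y)) ^ 2 =
      ∑ P, f P ^ 2 * (ind P.1 x * ind P.1 y) * (1 - ind (LinearMap.ker (Ψ x)) y) := by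
    intro x y
    rw [← Finset.sum_mul]
    by_cases h : Ψ x y = 0
    · rw [sum_mul_ind_mul_ind_of_vecSum_eq_zero hΨ hf h,
        ind_of_mem (U := LinearMap.ker (Ψ x)) (LinearMap.mem_ker.2 h)]
      ring
    · rw [sum_planes_of_ne hΨ h, sum_planes_of_ne hΨ h (fun P => f P ^ 2),
        ind_of_notMem (U := LinearMap.ker (Ψ x)) (fun h' => h (LinearMap.mem_ker.1 h'))]
      ring
  rw [h1, Finset.sum_congr rfl fun x _ => Finset.sum_congr rfl fun y _ => h2 x y]
  rw [Finset.sum_congr rfl fun x _ => Finset.sum_comm, Finset.sum_comm, Finset.mul_sum]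
  refine Finset.sum_congr rfl fun P _ => ?_
  classical
  have h3 : ∀ x, ∑ y, f P ^ 2 * (ind P.1 x * ind P.1 y) * (1 - ind (LinearMap.ker (Ψ x)) y) =
      f P ^ 2 * ((Nat.card F : ℚ) ^ 2 - Nat.card F) * (ind P.1 x - if x = 0 then 1 else 0) := by
    intro x
    by_cases hx0 : x = 0
    · rw [if_pos hx0, hx0, ind_zero, sub_self, mul_zero]
      refine Finset.sum_eq_zero fun y _ => ?_
      rw [ind_of_mem (U := LinearMap.ker (Ψ 0)) (by simp), sub_self, mul_zero]
    · rw [if_neg hx0, sub_zero]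
      by_cases hx : x ∈ P.1
      · rw [← sum_ind_mul_one_sub hΨ P hx0 hx, ind_of_mem hx, mul_one, Finset.mul_sum]
        exact Finset.sum_congr rfl fun y _ => by ring
      · simp [ind_of_notMem hx]
  rw [Finset.sum_congr rfl fun x _ => h3 x, ← Finset.mul_sum, Finset.sum_sub_distrib, sum_ind,
    card_plane]
  simp
  ring

/-- The number of common neighbours of two planes. -/
theorem sum_indLE_mul_indLE (hΨ : Ψ.IsAlt) (hnd : Ψ.Nondegenerate) (P Q : NondegeneratePlane Ψ) :
    (Nat.card F : ℚ) ^ 2 * ((Nat.card F : ℚ) ^ 2 - 1) * ∑ S : NondegeneratePlane Ψ,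
      indLE S.1 (Ψ.orthogonal P.1) * indLE S.1 (Ψ.orthogonal Q.1) =
      (Nat.card V / (Nat.card F : ℚ) ^ 4) ^ 2 *
        (Nat.card (P.1 ⊓ Q.1 : Submodule F V) : ℚ) ^ 2 -
      Nat.card V / (Nat.card F : ℚ) ^ 4 * ∑ x, ∑ y, (ind P.1 x * ind (Ψ.orthogonal P.1) (y - x)) *
        (ind Q.1 y * ind (Ψ.orthogonal Q.1) (x - y)) := by
  -- The product of the sizes of `P ⊓ Q` and of the radical of `P ⊔ Q` is rewritten as a count of
  -- pairs `x ∈ P`, `y ∈ Q` that are each other's orthogonal projections. In this form it separates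
  -- into a factor for `P` and one for `Q`.
  have hR : ∑ x, ∑ y, (ind P.1 x * ind (Ψ.orthogonal P.1) (y - x)) *
        (ind Q.1 y * ind (Ψ.orthogonal Q.1) (x - y)) =
      (Nat.card (P.1 ⊓ Q.1 : Submodule F V) : ℚ) *
        Nat.card (Ψ.orthogonal (P.1 ⊔ Q.1) ⊓ (P.1 ⊔ Q.1) : Submodule F V) := by
    rw [← sum_ind_sub_eq P.1 Q.1 _ inf_le_right]
    refine Finset.sum_congr rfl fun x _ => Finset.sum_congr rfl fun y _ => ?_
    have hsub : ind (Ψ.orthogonal Q.1) (x - y) = ind (Ψ.orthogonal Q.1) (y - x) :=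
      ind_congr (sub_mem_comm_iff)
    rw [hsub]
    by_cases hx : x ∈ P.1
    · by_cases hy : y ∈ Q.1
      · have hm : y - x ∈ P.1 ⊔ Q.1 := Submodule.sub_mem _ (Submodule.mem_sup_right hy)
          (Submodule.mem_sup_left hx)
        rw [← ind_mul_ind (Ψ.orthogonal (P.1 ⊔ Q.1)), ind_of_mem hm, orthogonal_sup,
          ← ind_mul_ind (Ψ.orthogonal P.1)]
        ring
      · rw [ind_of_notMem hy]; ring
    · rw [ind_of_notMem hx]; ring
  have h := sum_planes_indLE hΨ (Ψ.orthogonal (P.1 ⊔ Q.1))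
  rw [LinearMap.BilinForm.orthogonal_orthogonal hnd hΨ.isRefl] at h
  simp only [indLE_mul_indLE, ← orthogonal_sup]
  rw [h, hR, card_orthogonal_sup hnd]
  ring

/-- Expanding the square counts common neighbours of pairs of planes. The main term involves squared
intersection sizes and is a multiple of the squared norm of `f`; the radical term has no definite
sign but is at most as large. -/
theorem adjSum_sq_le (hΨ : Ψ.IsAlt) (hnd : Ψ.Nondegenerate) {f : NondegeneratePlane Ψ → ℚ}
    (hf : ∀ x, vecSum f x = 0) :
    (Nat.card F : ℚ) ^ 9 * ∑ P, adjSum f P ^ 2 ≤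
      2 * (Nat.card V : ℚ) ^ 2 * (Nat.card F - 1) * ∑ P, f P ^ 2 := by
  have hq1 : (1 : ℚ) < Nat.card F := one_lt_card
  have hq : (Nat.card F : ℚ) ≠ 0 := (zero_lt_one.trans hq1).ne'
  set q : ℚ := ((Nat.card F : ℕ) : ℚ) with hqdef
  set N : ℚ := ((Nat.card V : ℕ) : ℚ) with hNdef
  set Z := ∑ P, ∑ Q, f P * f Q * (Nat.card (P.1 ⊓ Q.1 : Submodule F V) : ℚ) ^ 2 with hZ
  -- `G x y` sums `f` over the planes onto which `y` projects orthogonally to `x`. The radical term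
  -- is the pairing of `G` with its transpose, bounded by the squared norm of `G`, which is again a
  -- multiple of `Z`.
  let G : V → V → ℚ := fun x y => ∑ P, f P * (ind P.1 x * ind (Ψ.orthogonal P.1) (y - x))
  have hA : q ^ 2 * (q ^ 2 - 1) * ∑ P, adjSum f P ^ 2 =
      (N / q ^ 4) ^ 2 * Z - N / q ^ 4 * ∑ x, ∑ y, G x y * G y x := by
    have h1 : ∑ S, adjSum f S ^ 2 = ∑ P, ∑ Q, f P * f Q * ∑ S : NondegeneratePlane Ψ,
        indLE S.1 (Ψ.orthogonal P.1) * indLE S.1 (Ψ.orthogonal Q.1) := by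
      simp only [adjSum, pow_two, Finset.sum_mul_sum]
      simp only [Finset.mul_sum]
      rw [Finset.sum_comm]
      refine Finset.sum_congr rfl fun P _ => ?_
      rw [Finset.sum_comm]
      refine Finset.sum_congr rfl fun Q _ => Finset.sum_congr rfl fun S _ => ?_
      rw [indLE_orthogonal_comm hΨ P.1, indLE_orthogonal_comm hΨ Q.1]; ring
    have h2 : ∑ x, ∑ y, G x y * G y x = ∑ P, ∑ Q, f P * f Q * ∑ x, ∑ y,
        (ind P.1 x * ind (Ψ.orthogonal P.1) (y - x)) *
        (ind Q.1 y * ind (Ψ.orthogonal Q.1) (x - y)) := by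
      simp only [G, Finset.sum_mul_sum]
      simp only [Finset.mul_sum]
      rw [sum_comm_pairs]
      refine Finset.sum_congr rfl fun P _ => Finset.sum_congr rfl fun Q _ =>
        Finset.sum_congr rfl fun x _ => Finset.sum_congr rfl fun y _ => ?_
      ring
    rw [h1, h2, hZ, Finset.mul_sum, Finset.mul_sum, Finset.mul_sum, ← Finset.sum_sub_distrib]
    refine Finset.sum_congr rfl fun P _ => ?_
    rw [Finset.mul_sum, Finset.mul_sum, Finset.mul_sum, ← Finset.sum_sub_distrib]
    refine Finset.sum_congr rfl fun Q _ => ?_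
    have := sum_indLE_mul_indLE hΨ hnd P Q
    rw [← hqdef, ← hNdef] at this
    rw [mul_left_comm, this]
    ring
  have hG : ∑ x, ∑ y, G x y ^ 2 = N / q ^ 4 * Z := by
    have h1 : ∑ x, ∑ y, G x y ^ 2 = ∑ P, ∑ Q, f P * f Q * ∑ x, ∑ y,
        (ind P.1 x * ind (Ψ.orthogonal P.1) (y - x)) *
        (ind Q.1 x * ind (Ψ.orthogonal Q.1) (y - x)) := by
      simp only [G, pow_two, Finset.sum_mul_sum]
      simp only [Finset.mul_sum]
      rw [sum_comm_pairs]
      refine Finset.sum_congr rfl fun P _ => Finset.sum_congr rfl fun Q _ =>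
        Finset.sum_congr rfl fun x _ => Finset.sum_congr rfl fun y _ => ?_
      ring
    rw [h1, hZ, Finset.mul_sum]
    refine Finset.sum_congr rfl fun P _ => ?_
    rw [Finset.mul_sum]
    refine Finset.sum_congr rfl fun Q _ => ?_
    have h2 : ∑ x, ∑ y, (ind P.1 x * ind (Ψ.orthogonal P.1) (y - x)) *
        (ind Q.1 x * ind (Ψ.orthogonal Q.1) (y - x)) =
        Nat.card (P.1 ⊓ Q.1 : Submodule F V) * (Nat.card (Ψ.orthogonal (P.1 ⊔ Q.1)) : ℚ) := by
      rw [← sum_ind, ← sum_ind, Finset.sum_mul]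
      refine Finset.sum_congr rfl fun x _ => ?_
      rw [Finset.mul_sum, ← Equiv.sum_comp (Equiv.addRight x)]
      refine Finset.sum_congr rfl fun y _ => ?_
      rw [Equiv.coe_addRight, add_sub_cancel_right, orthogonal_sup, ← ind_mul_ind, ← ind_mul_ind]
      ring
    rw [h2, card_orthogonal_sup hnd]; ring
  have hle : -(∑ x, ∑ y, G x y * G y x) ≤ ∑ x, ∑ y, G x y ^ 2 := by
    have hswap : ∑ x, ∑ y, G y x ^ 2 = ∑ x, ∑ y, G x y ^ 2 := Finset.sum_comm
    have h0 : 0 ≤ ∑ x, ∑ y, (G x y + G y x) ^ 2 :=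
      Finset.sum_nonneg fun x _ => Finset.sum_nonneg fun y _ => sq_nonneg _
    have h1 : ∑ x, ∑ y, (G x y + G y x) ^ 2 = ∑ x, ∑ y, G x y ^ 2 + ∑ x, ∑ y, G y x ^ 2 +
        2 * ∑ x, ∑ y, G x y * G y x := by
      simp only [Finset.mul_sum, ← Finset.sum_add_distrib]
      refine Finset.sum_congr rfl fun x _ => Finset.sum_congr rfl fun y _ => ?_
      ring
    rw [h1, hswap] at h0
    linarith
  have hNq : 0 ≤ N / q ^ 4 := by positivity
  have hfin : q ^ 2 * (q ^ 2 - 1) * ∑ P, adjSum f P ^ 2 ≤ 2 * (N / q ^ 4) ^ 2 * Z := by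
    rw [hA]
    have := mul_le_mul_of_nonneg_left hle hNq
    rw [hG] at this
    linarith
  rw [hZ, sum_sum_card_inf_sq hΨ hf, ← hqdef] at hfin
  have hpos : 0 < q ^ 2 - 1 := by nlinarith
  have e1 : q ^ 2 * (q ^ 2 - 1) * ∑ P, adjSum f P ^ 2 =
      ((q ^ 2 - 1) / q ^ 7) * (q ^ 9 * ∑ P, adjSum f P ^ 2) := by field_simp
  have e2 : 2 * (N / q ^ 4) ^ 2 * ((q ^ 2 - 1) * (q ^ 2 - q) * ∑ P, f P ^ 2) =
      ((q ^ 2 - 1) / q ^ 7) * (2 * N ^ 2 * (q - 1) * ∑ P, f P ^ 2) := by field_simp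
  rw [e1, e2] at hfin
  exact le_of_mul_le_mul_left hfin (by positivity)

/-- The spectral gap of the orthogonality graph of a symplectic space of dimension `2 * m`. -/
theorem sum_adjSum_mul_le (hΨ : Ψ.IsAlt) (hnd : Ψ.Nondegenerate) {m : ℕ} (hm : 3 ≤ m)
    (hV : Module.finrank F V = 2 * m) {f : NondegeneratePlane Ψ → ℚ} (hf : ∑ P, f P = 0) :
    ∑ P, adjSum f P * f P ≤ (Nat.card F : ℚ) ^ (3 * m - 6) * ∑ P, f P ^ 2 := by
  have hq1 : (1 : ℚ) < Nat.card F := one_lt_card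
  have hq2 : (2 : ℚ) ≤ Nat.card F := by
    have : 1 < Nat.card F := Finite.one_lt_card
    exact_mod_cast this
  set q : ℚ := ((Nat.card F : ℕ) : ℚ) with hqdef
  have hq0 : 0 < q := by linarith
  have hN : (Nat.card V : ℚ) = q ^ (2 * m) := by
    rw [Module.natCard_eq_pow_finrank (K := F), hV]; push_cast; rfl
  set t : ℚ := q ^ (3 * m - 6) with ht
  have ht0 : 0 < t := by positivity
  have ht2 : q ^ 12 * t ^ 2 = (q ^ (2 * m)) ^ 3 := by
    rw [ht, ← pow_mul, ← pow_mul, ← pow_add]; congr 1; omega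
  obtain ⟨g, hg, hz⟩ := exists_planeSum_add hΨ hnd (by
    rw [hN]; exact pow_lt_pow_right₀ hq1 (by omega)) hf
  set f₁ : NondegeneratePlane Ψ → ℚ := planeSum g with hf₁
  set f₂ : NondegeneratePlane Ψ → ℚ := fun P => f P - f₁ P with hf₂
  have hsplit : ∀ P, adjSum f P = adjSum f₁ P + adjSum f₂ P := by
    intro P
    simp only [adjSum, ← Finset.sum_add_distrib, hf₂]
    exact Finset.sum_congr rfl fun Q _ => by ring
  have hort : ∀ g' : V → ℚ, ∑ P, planeSum g' P * f₂ P = 0 := by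
    intro g'
    rw [sum_planeSum_mul]
    exact Finset.sum_eq_zero fun x _ => by rw [hz x, mul_zero]
  have hne : q ^ 2 - q ≠ 0 := by nlinarith
  -- The two parts are orthogonal and adjacency preserves the first, so there are no cross terms.
  have h12 : ∑ P, adjSum f₁ P * f₂ P = 0 := by
    refine (mul_eq_zero.1 (?_ : (q ^ 2 - q) * _ = 0)).resolve_left hne
    rw [Finset.mul_sum]
    simp only [← mul_assoc, hf₁]
    rw [Finset.sum_congr rfl fun P _ => by rw [adjSum_planeSum hΨ hnd hg P]]
    simp only [mul_assoc, ← Finset.mul_sum, hort, mul_zero]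
  have hadj : ∀ a b : NondegeneratePlane Ψ → ℚ, ∑ P, adjSum a P * b P = ∑ P, a P * adjSum b P := by
    intro a b
    simp only [adjSum, Finset.sum_mul, Finset.mul_sum]
    rw [Finset.sum_comm]
    refine Finset.sum_congr rfl fun P _ => Finset.sum_congr rfl fun Q _ => ?_
    rw [indLE_orthogonal_comm hΨ P.1]; ring
  have h21 : ∑ P, adjSum f₂ P * f₁ P = 0 := by
    rw [hadj, ← h12]
    exact Finset.sum_congr rfl fun P _ => mul_comm _ _
  have hbound : ∀ a : NondegeneratePlane Ψ → ℚ, ∑ P, adjSum a P ^ 2 ≤ t ^ 2 * ∑ P, a P ^ 2 →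
      ∑ P, adjSum a P * a P ≤ t * ∑ P, a P ^ 2 := by
    intro a ha
    have h0 : 0 ≤ ∑ P, (adjSum a P - t * a P) ^ 2 := Finset.sum_nonneg fun P _ => sq_nonneg _
    have h1 : ∑ P, (adjSum a P - t * a P) ^ 2 = ∑ P, adjSum a P ^ 2 + t ^ 2 * ∑ P, a P ^ 2 -
        2 * t * ∑ P, adjSum a P * a P := by
      simp only [Finset.mul_sum, ← Finset.sum_add_distrib, ← Finset.sum_sub_distrib]
      exact Finset.sum_congr rfl fun P _ => by ring
    rw [h1] at h0
    refine le_of_mul_le_mul_left ?_ ht0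
    nlinarith
  have hb1 : ∑ P, adjSum f₁ P * f₁ P ≤ t * ∑ P, f₁ P ^ 2 := by
    refine hbound f₁ (le_of_eq ?_)
    rw [hf₁, adjSum_sq_planeSum hΨ hnd hg, ← hqdef, hN, ← ht2]
    field_simp
  have hb2 : ∑ P, adjSum f₂ P * f₂ P ≤ t * ∑ P, f₂ P ^ 2 := by
    refine hbound f₂ ?_
    have h := adjSum_sq_le hΨ hnd hz
    rw [← hqdef, hN] at h
    have hS : 0 ≤ ∑ P, f₂ P ^ 2 := Finset.sum_nonneg fun P _ => sq_nonneg _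
    have hq6 : q ^ 6 ≤ q ^ (2 * m) := pow_le_pow_right₀ hq1.le (by omega)
    -- This is where `3 ≤ m` enters the comparison: it puts the bound on the second part below `t ^
    -- 2`, the exact value on the first.
    have hk : 2 * (q - 1) * q ^ 3 ≤ q ^ (2 * m) := by
      refine le_trans ?_ hq6
      have h1 : 2 * (q - 1) ≤ q ^ 3 := by nlinarith [sq_nonneg (q - 1)]
      have h2 := mul_le_mul_of_nonneg_right h1 (pow_pos hq0 3).le
      linarith [h2, show q ^ 3 * q ^ 3 = q ^ 6 by ring]
    have h3 : q ^ 12 * ∑ P, adjSum f₂ P ^ 2 ≤ q ^ 12 * (t ^ 2 * ∑ P, f₂ P ^ 2) := by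
      rw [← mul_assoc, ht2]
      have h4 := mul_le_mul_of_nonneg_left h (pow_pos hq0 3).le
      have h5 := mul_le_mul_of_nonneg_left hk
        (mul_nonneg (pow_nonneg (pow_pos hq0 (2 * m)).le 2) hS)
      calc q ^ 12 * ∑ P, adjSum f₂ P ^ 2 = q ^ 3 * (q ^ 9 * ∑ P, adjSum f₂ P ^ 2) := by ring
        _ ≤ _ := h4
        _ = ((q ^ (2 * m)) ^ 2 * ∑ P, f₂ P ^ 2) * (2 * (q - 1) * q ^ 3) := by ring
        _ ≤ _ := h5
        _ = _ := by ring
    exact le_of_mul_le_mul_left h3 (by positivity)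
  have hff : ∀ P, f P = f₁ P + f₂ P := fun P => by simp [hf₂]
  have hs1 : ∑ P, adjSum f P * f P = ∑ P, adjSum f₁ P * f₁ P + ∑ P, adjSum f₂ P * f₂ P := by
    have : ∑ P, adjSum f P * f P = ∑ P, adjSum f₁ P * f₁ P + ∑ P, adjSum f₂ P * f₂ P +
        (∑ P, adjSum f₁ P * f₂ P + ∑ P, adjSum f₂ P * f₁ P) := by
      simp only [← Finset.sum_add_distrib]
      exact Finset.sum_congr rfl fun P _ => by rw [hsplit, hff P]; ring
    rw [this, h12, h21]; ring
  have hs2 : ∑ P, f P ^ 2 = ∑ P, f₁ P ^ 2 + ∑ P, f₂ P ^ 2 := by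
    have : ∑ P, f P ^ 2 = ∑ P, f₁ P ^ 2 + ∑ P, f₂ P ^ 2 + 2 * ∑ P, f₁ P * f₂ P := by
      simp only [Finset.mul_sum, ← Finset.sum_add_distrib]
      exact Finset.sum_congr rfl fun P _ => by rw [hff P]; ring
    rw [this, hort g]; ring
  rw [hs1, hs2]
  linarith

end SpectralBound

end Symplectic

namespace Symplectic

open LinearMap (BilinForm)
open TupleChain

/-! ### Orthogonal complements of frames -/

section Frames

variable {F V : Type*} [Field F] [AddCommGroup V] [Module F V] {Ψ : BilinForm F V}

/-- The orthogonal complement of the span of a set of planes. -/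
noncomputable def frameCompl (σ : Finset (NondegeneratePlane Ψ)) : Submodule F V :=
  Ψ.orthogonal (σ.sup fun P => P.1)

theorem le_frameCompl_iff (hΨ : Ψ.IsAlt) {σ : Finset (NondegeneratePlane Ψ)}
    {U : Submodule F V} : U ≤ frameCompl σ ↔ ∀ Q ∈ σ, Q.1 ≤ Ψ.orthogonal U := by
  have : U ≤ frameCompl σ ↔ (σ.sup fun P => P.1) ≤ Ψ.orthogonal U :=
    ⟨fun h x hx y hy => hΨ.isRefl _ _ (h hy x hx), fun h x hx y hy => hΨ.isRefl _ _ (h hy x hx)⟩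
  rw [this, Finset.sup_le_iff]

theorem adj_iff (hΨ : Ψ.IsAlt) {P Q : NondegeneratePlane Ψ} :
    (orthogonalityGraph Ψ hΨ).Adj P Q ↔ Q.1 ≤ Ψ.orthogonal P.1 :=
  ⟨fun h y hy x hx => h x hx y hy, fun h x hx _ hy => h hy x hx⟩

theorem mem_frameComplex (hΨ : Ψ.IsAlt) {σ : Finset (NondegeneratePlane Ψ)} :
    σ ∈ frameComplex Ψ hΨ ↔
      σ.Nonempty ∧ (orthogonalityGraph Ψ hΨ).IsClique (σ : Set (NondegeneratePlane Ψ)) := Iff.rfl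

theorem isSimplex_frameComplex (hΨ : Ψ.IsAlt) {σ : Finset (NondegeneratePlane Ψ)} :
    (frameComplex Ψ hΨ).IsSimplex σ ↔
      (orthogonalityGraph Ψ hΨ).IsClique (σ : Set (NondegeneratePlane Ψ)) := by
  rw [PreAbstractSimplicialComplex.IsSimplex, mem_frameComplex]
  rcases σ.eq_empty_or_nonempty with rfl | h
  · simp
  · simp [h, h.ne_empty]

variable [FiniteDimensional F V]

theorem plane_disjoint (hΨ : Ψ.IsAlt) (P : NondegeneratePlane Ψ) :
    Disjoint P.1 (Ψ.orthogonal P.1) := (nondegenerate_restrict_iff hΨ _).1 P.2.2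

/-- A new plane is non-degenerate and orthogonal to the previous span, so the sum stays direct and
meets its orthogonal complement trivially. -/
theorem frame_span (hΨ : Ψ.IsAlt) {σ : Finset (NondegeneratePlane Ψ)}
    (hσ : (orthogonalityGraph Ψ hΨ).IsClique (σ : Set (NondegeneratePlane Ψ))) :
    Disjoint (σ.sup fun P => P.1) (frameCompl σ) ∧
      Module.finrank F (σ.sup (fun P => P.1) : Submodule F V) = 2 * σ.card := by
  classical
  induction σ using Finset.induction_on with
  | empty => simp
  | insert P σ hP ih =>
    rw [Finset.coe_insert, SimpleGraph.isClique_insert] at hσ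
    obtain ⟨h1, h2⟩ := ih hσ.1
    have hle : P.1 ≤ frameCompl σ := (le_frameCompl_iff hΨ).2 fun Q hQ =>
      (adj_iff hΨ).1 (hσ.2 Q hQ fun h => hP (h ▸ hQ))
    have hPd := plane_disjoint hΨ P
    rw [Submodule.disjoint_def] at h1 hPd
    constructor
    · rw [frameCompl, Finset.sup_insert, orthogonal_sup, Submodule.disjoint_def]
      intro z hz hz'
      obtain ⟨p, hp, s, hs, rfl⟩ := Submodule.mem_sup.1 hz
      have hs' : s ∈ Ψ.orthogonal P.1 := fun x hx => hΨ.isRefl _ _ (hle hx s hs)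
      have hp0 : p = 0 := hPd p hp (by simpa using Submodule.sub_mem _ hz'.1 hs')
      have hs0 : s = 0 := h1 s hs (by
        have := Submodule.sub_mem _ hz'.2 (hle hp)
        rwa [add_sub_cancel_left] at this)
      rw [hp0, hs0, add_zero]
    · have h3 := Submodule.finrank_sup_add_finrank_inf_eq P.1 (σ.sup fun P => P.1)
      have h4 : P.1 ⊓ (σ.sup fun P => P.1) = ⊥ := by
        rw [eq_bot_iff]
        rintro x ⟨hx1, hx2⟩
        exact (Submodule.mem_bot F).2 (h1 x hx2 (hle hx1))
      rw [h4, finrank_bot, P.2.1, h2] at h3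
      rw [Finset.sup_insert, Finset.card_insert_of_notMem hP]
      omega

theorem finrank_frameCompl (hΨ : Ψ.IsAlt) (hnd : Ψ.Nondegenerate) {n : ℕ}
    (hV : Module.finrank F V = 2 * n) {σ : Finset (NondegeneratePlane Ψ)}
    (hσ : (frameComplex Ψ hΨ).IsSimplex σ) :
    σ.card ≤ n ∧ Module.finrank F (frameCompl σ) = 2 * (n - σ.card) := by
  have h1 := (frame_span hΨ ((isSimplex_frameComplex hΨ).1 hσ)).2
  have h2 := (σ.sup fun P => P.1 : Submodule F V).finrank_le
  have h3 := LinearMap.BilinForm.finrank_orthogonal hnd (σ.sup fun P => P.1)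
  rw [frameCompl, h3]
  omega

theorem frameCompl_disjoint (hΨ : Ψ.IsAlt) (hnd : Ψ.Nondegenerate)
    {σ : Finset (NondegeneratePlane Ψ)} (hσ : (frameComplex Ψ hΨ).IsSimplex σ) :
    Disjoint (frameCompl σ) (Ψ.orthogonal (frameCompl σ)) := by
  rw [frameCompl, LinearMap.BilinForm.orthogonal_orthogonal hnd hΨ.isRefl]
  exact (frame_span hΨ ((isSimplex_frameComplex hΨ).1 hσ)).1.symm

theorem mem_linkVertices_frameComplex [Fintype (NondegeneratePlane Ψ)]
    [DecidableEq (NondegeneratePlane Ψ)] (hΨ : Ψ.IsAlt) {σ : Finset (NondegeneratePlane Ψ)}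
    (hσ : (frameComplex Ψ hΨ).IsSimplex σ) {P : NondegeneratePlane Ψ} :
    P ∈ linkVertices (frameComplex Ψ hΨ) σ ↔ P.1 ≤ frameCompl σ := by
  rw [mem_linkVertices, mem_frameComplex, Finset.coe_insert, SimpleGraph.isClique_insert,
    le_frameCompl_iff hΨ]
  constructor
  · rintro ⟨h1, -, -, h2⟩ Q hQ
    exact (adj_iff hΨ).1 (h2 Q hQ fun h => h1 (h ▸ hQ))
  · intro h
    refine ⟨fun hP => ?_, Finset.insert_nonempty _ _, (isSimplex_frameComplex hΨ).1 hσ,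
      fun Q hQ _ => (adj_iff hΨ).2 (h Q hQ)⟩
    have h1 : P.1 = ⊥ := by
      have := plane_disjoint hΨ P
      rw [disjoint_iff, inf_eq_left.2 (h P hP)] at this
      exact this
    have h2 := P.2.1
    rw [h1, finrank_bot] at h2
    omega

variable [Finite F] [Fintype V] [Fintype (NondegeneratePlane Ψ)]
  [DecidableEq (NondegeneratePlane Ψ)]

/-- The number of vertices of the link of a frame. -/
theorem card_linkVertices_frameComplex (hΨ : Ψ.IsAlt) (hnd : Ψ.Nondegenerate) {n : ℕ}
    (hV : Module.finrank F V = 2 * n) {σ : Finset (NondegeneratePlane Ψ)}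
    (hσ : (frameComplex Ψ hΨ).IsSimplex σ) :
    (Nat.card F : ℚ) ^ 2 * ((Nat.card F : ℚ) ^ 2 - 1) *
        ((linkVertices (frameComplex Ψ hΨ) σ).card : ℚ) =
      (Nat.card F : ℚ) ^ (2 * (n - σ.card)) * ((Nat.card F : ℚ) ^ (2 * (n - σ.card)) - 1) := by
  have h := sum_planes_indLE hΨ (frameCompl σ)
  rw [(frameCompl_disjoint hΨ hnd hσ).eq_bot, card_submodule,
    (finrank_frameCompl hΨ hnd hV hσ).2] at h
  have h1 : (Nat.card (⊥ : Submodule F V) : ℚ) = 1 := by simp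
  rw [h1] at h
  rw [← h]
  congr 1
  classical
  simp only [indLE, Finset.sum_boole]
  congr 2
  ext P
  rw [mem_linkVertices_frameComplex hΨ hσ]
  simp

end Frames

/-! ### Planes of a non-degenerate subspace -/

section Subspace

variable {F V : Type*} [Field F] [AddCommGroup V] [Module F V] {Ψ : BilinForm F V}

theorem isAlt_restrict (hΨ : Ψ.IsAlt) (W : Submodule F V) : (Ψ.restrict W).IsAlt :=
  fun x => hΨ x.1

variable [FiniteDimensional F V]

/-- A non-degenerate plane of a subspace as a plane of the whole space. -/
def planeOfSubspace (hΨ : Ψ.IsAlt) (W : Submodule F V) (P : NondegeneratePlane (Ψ.restrict W)) :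
    NondegeneratePlane Ψ :=
  ⟨P.1.map W.subtype, by
    refine ⟨?_, ?_⟩
    · rw [Submodule.finrank_map_subtype_eq, P.2.1]
    · rw [nondegenerate_restrict_iff hΨ, Submodule.disjoint_def]
      rintro _ ⟨x, hx, rfl⟩ h
      have hd := plane_disjoint (isAlt_restrict hΨ W) P
      rw [Submodule.disjoint_def] at hd
      rw [hd x hx fun y hy => h _ ⟨y, hy, rfl⟩, map_zero]⟩

theorem planeOfSubspace_injective (hΨ : Ψ.IsAlt) (W : Submodule F V) :
    Function.Injective (planeOfSubspace hΨ W) := by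
  intro P Q h
  exact Subtype.ext (Submodule.map_injective_of_injective W.injective_subtype
    (congrArg Subtype.val h))

theorem mem_range_planeOfSubspace (hΨ : Ψ.IsAlt) {W : Submodule F V} {P : NondegeneratePlane Ψ}
    (hP : P.1 ≤ W) : P ∈ Set.range (planeOfSubspace hΨ W) := by
  have hmap : (P.1.comap W.subtype).map W.subtype = P.1 := by
    rw [Submodule.map_comap_subtype, inf_eq_right.2 hP]
  refine ⟨⟨P.1.comap W.subtype, ?_, ?_⟩, Subtype.ext hmap⟩
  · rw [← Submodule.finrank_map_subtype_eq, hmap, P.2.1]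
  · rw [nondegenerate_restrict_iff (isAlt_restrict hΨ W), Submodule.disjoint_def]
    intro x hx h
    have hd := plane_disjoint hΨ P
    rw [Submodule.disjoint_def] at hd
    exact Subtype.ext (hd x.1 hx fun y hy => h ⟨y, hP hy⟩ hy)

theorem indLE_planeOfSubspace (hΨ : Ψ.IsAlt) (W : Submodule F V)
    (P Q : NondegeneratePlane (Ψ.restrict W)) :
    indLE (planeOfSubspace hΨ W Q).1 (Ψ.orthogonal (planeOfSubspace hΨ W P).1) =
      indLE Q.1 ((Ψ.restrict W).orthogonal P.1) := by
  have hiff : (planeOfSubspace hΨ W Q).1 ≤ Ψ.orthogonal (planeOfSubspace hΨ W P).1 ↔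
      Q.1 ≤ (Ψ.restrict W).orthogonal P.1 := by
    constructor
    · intro h y hy x hx
      exact h ⟨y, hy, rfl⟩ x.1 ⟨x, hx, rfl⟩
    · rintro h _ ⟨y, hy, rfl⟩ _ ⟨x, hx, rfl⟩
      exact h hy x hx
  by_cases h : Q.1 ≤ (Ψ.restrict W).orthogonal P.1
  · rw [indLE_of_le h, indLE_of_le (hiff.2 h)]
  · rw [indLE_of_not_le h, indLE_of_not_le fun h' => h (hiff.1 h')]

variable [Finite F] [Fintype (NondegeneratePlane Ψ)]

/-- The spectral gap for the planes of a non-degenerate subspace. -/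
theorem sum_indLE_subspace_le (hΨ : Ψ.IsAlt) {W : Submodule F V}
    (hW : Disjoint W (Ψ.orthogonal W)) {m : ℕ} (hm : 3 ≤ m) (hWm : Module.finrank F W = 2 * m)
    {g : NondegeneratePlane Ψ → ℚ} (hg : ∀ P, ¬ P.1 ≤ W → g P = 0) (hsum : ∑ P, g P = 0) :
    ∑ P, ∑ Q, indLE Q.1 (Ψ.orthogonal P.1) * (g P * g Q) ≤
      (Nat.card F : ℚ) ^ (3 * m - 6) * ∑ P, g P ^ 2 := by
  have : Finite W := Module.finite_of_finite F
  have := Fintype.ofFinite W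
  have : Finite (NondegeneratePlane (Ψ.restrict W)) :=
    Finite.of_injective _ (planeOfSubspace_injective hΨ W)
  have := Fintype.ofFinite (NondegeneratePlane (Ψ.restrict W))
  -- Functions supported on planes inside `W` are functions on the planes of the symplectic space
  -- `W`, to which the bound applies.
  have hsum' : ∀ φ : NondegeneratePlane Ψ → ℚ, (∀ P, ¬ P.1 ≤ W → φ P = 0) →
      ∑ P, φ (planeOfSubspace hΨ W P) = ∑ P, φ P := by
    intro φ hφ
    refine Fintype.sum_of_injective _ (planeOfSubspace_injective hΨ W) _ _ (fun P hP => ?_)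
      fun P => rfl
    exact hφ P fun h => hP (mem_range_planeOfSubspace hΨ h)
  have h := sum_adjSum_mul_le (isAlt_restrict hΨ W) ((nondegenerate_restrict_iff hΨ W).2 hW) hm hWm
    (f := fun P => g (planeOfSubspace hΨ W P)) (by rw [hsum' g hg, hsum])
  rw [hsum' (fun P => g P ^ 2) fun P hP => by rw [hg P hP]; ring] at h
  refine le_trans (le_of_eq ?_) h
  symm
  rw [← hsum' (fun P => ∑ Q, indLE Q.1 (Ψ.orthogonal P.1) * (g P * g Q)) fun P hP => by
    simp [hg P hP]]
  refine Finset.sum_congr rfl fun P _ => ?_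
  rw [← hsum' (fun Q => indLE Q.1 (Ψ.orthogonal (planeOfSubspace hΨ W P).1) *
    (g (planeOfSubspace hΨ W P) * g Q)) fun Q hQ => by rw [hg Q hQ]; ring]
  rw [adjSum, Finset.sum_mul]
  refine Finset.sum_congr rfl fun Q _ => ?_
  rw [indLE_planeOfSubspace]; ring

end Subspace

/-! ### Connectivity of links in the frame complex -/

section Links

variable {F V : Type*} [Field F] [AddCommGroup V] [Module F V] [FiniteDimensional F V]
  {Ψ : BilinForm F V} [Finite F] [Fintype V] [Fintype (NondegeneratePlane Ψ)]
  [DecidableEq (NondegeneratePlane Ψ)]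

theorem linkVertices_frameComplex_nonempty (hΨ : Ψ.IsAlt) (hnd : Ψ.Nondegenerate) {n : ℕ}
    (hV : Module.finrank F V = 2 * n) {σ : Finset (NondegeneratePlane Ψ)}
    (hσ : (frameComplex Ψ hΨ).IsSimplex σ) (hσn : σ.card < n) :
    (linkVertices (frameComplex Ψ hΨ) σ).Nonempty := by
  rw [← Finset.card_pos]
  by_contra h0
  have h := card_linkVertices_frameComplex hΨ hnd hV hσ
  have hq1 : (1 : ℚ) < Nat.card F := one_lt_card
  have h1 : (1 : ℚ) < (Nat.card F : ℚ) ^ (2 * (n - σ.card)) := one_lt_pow₀ hq1 (by omega)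
  rw [Nat.eq_zero_of_not_pos h0, Nat.cast_zero, mul_zero] at h
  nlinarith

/-- Vanishing of the homology of the link of a frame by Garland's method. -/
theorem exactAt_link_frameComplex (hΨ : Ψ.IsAlt) (hnd : Ψ.Nondegenerate) {n q : ℕ}
    (hV : Module.finrank F V = 2 * n) (hq : Nat.card F = q) {s : Finset (NondegeneratePlane Ψ)}
    (hs : (frameComplex Ψ hΨ).IsSimplex s) {d m : ℕ} (hm : 3 ≤ m) (hsm : s.card + d + m = n)
    (hgap : (d + 1) * q ^ (m - 2) * q ^ 2 + 1 < (q ^ (m - 2)) ^ 2 * q ^ 2 + (d + 1) * q ^ (m - 2)) :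
    ExactAt ℚ (tuples ((frameComplex Ψ hΨ).link s)) (d + 1) := by
  set K := frameComplex Ψ hΨ with hK
  have hq1 : (1 : ℚ) < q := by rw [← hq]; exact one_lt_card
  have hcoef : (0 : ℚ) < (q : ℚ) ^ 2 * ((q : ℚ) ^ 2 - 1) := by
    have : (1 : ℚ) < (q : ℚ) ^ 2 := one_lt_pow₀ hq1 two_ne_zero
    have : (0 : ℚ) < (q : ℚ) ^ 2 - 1 := by linarith
    positivity
  have hcard : ∀ σ, (K.link s).IsSimplex σ → σ.card = d + 1 →
      (q : ℚ) ^ 2 * ((q : ℚ) ^ 2 - 1) * ((linkVertices (K.link s) σ).card : ℚ) =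
        (q : ℚ) ^ (2 * (m - 1)) * ((q : ℚ) ^ (2 * (m - 1)) - 1) := by
    intro σ hσ hσd
    obtain ⟨h1, h2⟩ := (isSimplex_link hs).1 hσ
    have h3 := card_linkVertices_frameComplex hΨ hnd hV h2
    rw [Finset.card_union_of_disjoint h1, hσd, hq, show n - (s.card + (d + 1)) = m - 1 by omega]
      at h3
    rw [linkVertices_link h1, h3]
  obtain ⟨D, hD, hDgap⟩ : ∃ D : ℕ, (∀ σ, (K.link s).IsSimplex σ → σ.card = d + 1 →
      (linkVertices (K.link s) σ).card = D) ∧ ((d : ℚ) + 1) * (q : ℚ) ^ (3 * m - 6) < D := by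
    by_cases hex : ∃ σ, (K.link s).IsSimplex σ ∧ σ.card = d + 1
    · obtain ⟨σ₀, hσ₀, hσ₀d⟩ := hex
      have h1 := hcard σ₀ hσ₀ hσ₀d
      refine ⟨(linkVertices (K.link s) σ₀).card, fun σ hσ hσd => ?_, ?_⟩
      · have := (hcard σ hσ hσd).trans h1.symm
        exact_mod_cast mul_left_cancel₀ hcoef.ne' this
      · refine lt_of_mul_lt_mul_left (a := (q : ℚ) ^ 2 * ((q : ℚ) ^ 2 - 1)) ?_ hcoef.le
        rw [h1]
        obtain ⟨a, rfl⟩ : ∃ a, m = a + 2 := ⟨m - 2, by omega⟩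
        rw [show 3 * (a + 2) - 6 = 3 * a by omega, show 2 * (a + 2 - 1) = 2 * a + 2 by omega]
        rw [Nat.add_sub_cancel] at hgap
        have hgap' : ((d : ℚ) + 1) * (q : ℚ) ^ a * (q : ℚ) ^ 2 + 1 <
            ((q : ℚ) ^ a) ^ 2 * (q : ℚ) ^ 2 + (d + 1) * (q : ℚ) ^ a := by exact_mod_cast hgap
        have hX : (0 : ℚ) < (q : ℚ) ^ a := by positivity
        have e1 : (q : ℚ) ^ (3 * a) = ((q : ℚ) ^ a) ^ 3 := by rw [← pow_mul, mul_comm]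
        have e2 : (q : ℚ) ^ (2 * a + 2) = ((q : ℚ) ^ a) ^ 2 * (q : ℚ) ^ 2 := by
          rw [pow_add, ← pow_mul, mul_comm 2 a]
        rw [e1, e2]
        have hpos : (0 : ℚ) < ((q : ℚ) ^ a) ^ 2 * (q : ℚ) ^ 2 := by positivity
        -- With `X = q ^ a`, after clearing the denominator of the plane count, the inequality `(d +
        -- 1) * X ^ 3 < D` is `hgap'` multiplied by `X ^ 2 * q ^ 2`.
        have := mul_lt_mul_of_pos_left hgap' hpos
        nlinarith
    -- Without simplices of this size the degree condition is vacuous and any large `D` serves.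
    · obtain ⟨D, hD⟩ := exists_nat_gt (((d : ℚ) + 1) * (q : ℚ) ^ (3 * m - 6))
      exact ⟨D, fun σ hσ hσd => absurd ⟨σ, hσ, hσd⟩ hex, hD⟩
  refine exactAt_of_link_gap (K.link s) d D ((q : ℚ) ^ (3 * m - 6)) hD ?_ hDgap
  intro τ hτ hτd g hg hsum
  obtain ⟨h1, h2⟩ := (isSimplex_link hs).1 hτ
  rw [linkVertices_link h1] at hg
  have hg' : ∀ P : NondegeneratePlane Ψ, ¬ P.1 ≤ frameCompl (s ∪ τ) → g P = 0 := fun P hP =>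
    hg P fun h => hP ((mem_linkVertices_frameComplex hΨ h2).1 h)
  have hfr := (finrank_frameCompl hΨ hnd hV h2).2
  rw [Finset.card_union_of_disjoint h1, hτd, show n - (s.card + d) = m by omega] at hfr
  have hle := sum_indLE_subspace_le hΨ (frameCompl_disjoint hΨ hnd h2) hm hfr hg' hsum
  rw [hq] at hle
  refine le_trans (le_of_eq ?_) hle
  refine Finset.sum_congr rfl fun P _ => ?_
  -- The neighbours of `P` in the link graph are the link vertices orthogonal to `P`; outside the
  -- link `g` vanishes, so the sum may run over all planes.
  by_cases hP : P ∈ linkVertices K (s ∪ τ)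
  · have hP' := mem_linkVertices.1 hP
    have hdis : Disjoint s (insert P τ) := Finset.disjoint_insert_right.2
      ⟨fun h => hP'.1 (Finset.mem_union_left _ h), h1⟩
    rw [linkVertices_link hdis, Finset.union_insert,
      ← Finset.sum_subset (Finset.subset_univ (linkVertices K (insert P (s ∪ τ))))]
    · refine Finset.sum_congr rfl fun Q hQ => ?_
      have := (le_frameCompl_iff hΨ).1
        ((mem_linkVertices_frameComplex hΨ (Or.inr hP'.2)).1 hQ) P (Finset.mem_insert_self _ _)
      rw [indLE_orthogonal_comm hΨ, indLE_of_le this, one_mul]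
    · intro Q _ hQ
      by_cases hQ' : Q.1 ≤ Ψ.orthogonal P.1
      · rw [hg' Q, mul_zero, mul_zero]
        intro hQ2
        apply hQ
        rw [mem_linkVertices_frameComplex hΨ (Or.inr hP'.2), le_frameCompl_iff hΨ]
        intro R hR
        rcases Finset.mem_insert.1 hR with rfl | hR
        · exact fun x hx y hy => hΨ.isRefl _ _ (hQ' hy x hx)
        · exact (le_frameCompl_iff hΨ).1 hQ2 R hR
      · rw [indLE_of_not_le hQ', zero_mul]
  · simp [hg P hP]

end Links

end Symplectic

namespace Symplectic

open LinearMap (BilinForm)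
open TupleChain

/-! ### Numerical ranges of connectivity, and removal of frames of size `n - 1` -/

section Connectivity

/-- Applied with `e = d + 1`, `X = q ^ (m - 2)` and `Q = q ^ 2`, this reduces Garland's inequality
to `d + 1 ≤ q ^ (m - 2)`. -/
theorem gap_of_le {e X Q : ℕ} (he : 1 ≤ e) (heX : e ≤ X) (hX : 2 ≤ X) :
    e * X * Q + 1 < X ^ 2 * Q + e * X := by
  have h1 : e * X * Q ≤ X ^ 2 * Q := Nat.mul_le_mul_right _ (by nlinarith)
  nlinarith

variable {F V : Type*} [Field F] [AddCommGroup V] [Module F V] [FiniteDimensional F V]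
  {Ψ : BilinForm F V} [Finite F] [Fintype V] [Fintype (NondegeneratePlane Ψ)]
  [DecidableEq (NondegeneratePlane Ψ)]

/-- Degree `-1` only asks for a vertex in the link, which `ht` provides; every degree `d ≥ 0` is
Garland's method over `ℚ` followed by a change of coefficients. -/
theorem acyclic_link_frameComplex {k : Type*} [Field k] [CharZero k] (hΨ : Ψ.IsAlt)
    (hnd : Ψ.Nondegenerate) {n q : ℕ} (hV : Module.finrank F V = 2 * n) (hq : Nat.card F = q)
    {s : Finset (NondegeneratePlane Ψ)} (hs : (frameComplex Ψ hΨ).IsSimplex s) {t : ℤ}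
    (ht : -1 ≤ t → s.card < n)
    (h : ∀ d : ℕ, (d : ℤ) ≤ t → ∃ m, 3 ≤ m ∧ s.card + d + m = n ∧
      (d + 1) * q ^ (m - 2) * q ^ 2 + 1 < (q ^ (m - 2)) ^ 2 * q ^ 2 + (d + 1) * q ^ (m - 2)) :
    Acyclic k (tuples ((frameComplex Ψ hΨ).link s)) t := by
  intro j hj
  cases j with
  | zero =>
    obtain ⟨x, hx⟩ := linkVertices_frameComplex_nonempty hΨ hnd hV hs (ht (by simpa using hj))
    have hx' := mem_linkVertices.1 hx
    intro z hz _
    refine ⟨cone k x 0 z, cone_mem_supported (fun v _ => ?_) hz, bd_cone_zero x z⟩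
    refine ⟨{x}, Or.inr (mem_link.2 ⟨Finset.singleton_nonempty x,
      Finset.disjoint_singleton_right.2 hx'.1, ?_⟩), fun i => ?_⟩
    · rw [Finset.union_comm]; exact hx'.2
    · rw [Fin.eq_zero i]; simp
  | succ d =>
    obtain ⟨m, hm, hsm, hgap⟩ := h d (by push_cast at hj; linarith)
    exact ExactAt.of_rat (exactAt_link_frameComplex hΨ hnd hV hq hs hm hsm hgap)

/-- The frame complex is `⌊n / 2⌋`-connected. -/
theorem acyclic_frameComplex {k : Type*} [Field k] [CharZero k] (hΨ : Ψ.IsAlt)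
    (hnd : Ψ.Nondegenerate) {n q : ℕ} (hV : Module.finrank F V = 2 * n) (hq : Nat.card F = q)
    (h : ((q = 2 ∨ q = 3) ∧ 7 ≤ n) ∨ (4 ≤ q ∧ 5 ≤ n)) :
    Acyclic k (tuples (frameComplex Ψ hΨ)) ((n / 2 : ℕ) : ℤ) := by
  rw [← tuples_link_empty]
  refine acyclic_link_frameComplex hΨ hnd hV hq (Or.inl rfl)
    (fun _ => by rw [Finset.card_empty]; omega) fun d hd => ?_
  have hd' : d ≤ n / 2 := by exact_mod_cast hd
  obtain ⟨b, hb⟩ : ∃ b, n - d = b + 2 := ⟨n - d - 2, by omega⟩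
  refine ⟨n - d, by omega, by rw [Finset.card_empty]; omega, ?_⟩
  rw [hb, Nat.add_sub_cancel]
  have hq2 : 2 ≤ q := by omega
  have hb1 : 1 ≤ b := by omega
  have hX : 2 ≤ q ^ b := hq2.trans (Nat.le_self_pow (by omega) q)
  -- This is the case `n = 8`: here `d + 1 = 5` exceeds `q ^ b = 4`, but the exact inequality still
  -- holds, as `81 < 84`.
  by_cases hsp : q = 2 ∧ b = 2 ∧ d = 4
  · obtain ⟨rfl, rfl, rfl⟩ := hsp
    norm_num
  refine gap_of_le (by omega) ?_ hX
  rcases Nat.lt_or_ge q 4 with hq4 | hq4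
  · have hb2 : 2 ≤ b := by omega
    rcases Nat.lt_or_ge b 3 with hb3 | hb3
    · obtain rfl : b = 2 := by omega
      have : q = 2 ∨ q = 3 := by omega
      rcases this with rfl | rfl <;> omega
    -- Since `2 * d ≤ n = d + b + 2`, one has `d + 1 ≤ b + 3`.
    · have : ∀ c, 3 ≤ c → c + 3 ≤ 2 ^ c := by
        intro c hc
        induction c, hc using Nat.le_induction with
        | base => norm_num
        | succ c hc ih => rw [pow_succ]; omega
      have h1 := this b hb3
      have h2 : 2 ^ b ≤ q ^ b := Nat.pow_le_pow_left hq2 b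
      omega
  · have : ∀ c, 1 ≤ c → c + 3 ≤ 4 ^ c := by
      intro c hc
      induction c, hc using Nat.le_induction with
      | base => norm_num
      | succ c hc ih => rw [pow_succ]; omega
    have h1 := this b hb1
    have h2 : 4 ^ b ≤ q ^ b := Nat.pow_le_pow_left hq4 b
    omega

theorem exists_superset_frame (hΨ : Ψ.IsAlt) (hnd : Ψ.Nondegenerate) {n : ℕ}
    (hV : Module.finrank F V = 2 * n) {s : Finset (NondegeneratePlane Ψ)}
    (hs : (frameComplex Ψ hΨ).IsSimplex s) :
    ∃ u, (frameComplex Ψ hΨ).IsSimplex u ∧ s ⊆ u ∧ u.card = n := by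
  induction hm : n - s.card generalizing s with
  | zero =>
    have := (finrank_frameCompl hΨ hnd hV hs).1
    exact ⟨s, hs, subset_rfl, by omega⟩
  | succ m ih =>
    obtain ⟨x, hx⟩ := linkVertices_frameComplex_nonempty hΨ hnd hV hs (by omega)
    obtain ⟨hxs, hx⟩ := mem_linkVertices.1 hx
    obtain ⟨u, hu, hsu, huc⟩ := ih (s := insert x s) (Or.inr hx)
      (by rw [Finset.card_insert_of_notMem hxs]; omega)
    exact ⟨u, hu, (Finset.subset_insert x s).trans hsu, huc⟩

/-- A frame of size `n - 1` lies in only one frame of size `n`. -/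
theorem eq_of_subset_frames (hΨ : Ψ.IsAlt) (hnd : Ψ.Nondegenerate) {n : ℕ}
    (hV : Module.finrank F V = 2 * n) {x u v : Finset (NondegeneratePlane Ψ)}
    (hx : x.card + 1 = n) (hu : (frameComplex Ψ hΨ).IsSimplex u)
    (hv : (frameComplex Ψ hΨ).IsSimplex v) (hxu : x ⊂ u) (hxv : x ⊂ v) : u = v := by
  have hxs := isSimplex_of_subset hu hxu.1
  -- The orthogonal complement of `x` is itself a non-degenerate plane, the only one it contains.
  have hcard : (linkVertices (frameComplex Ψ hΨ) x).card = 1 := by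
    have h := card_linkVertices_frameComplex hΨ hnd hV hxs
    have hq1 : (1 : ℚ) < Nat.card F := one_lt_card
    rw [show n - x.card = 1 by omega, mul_one] at h
    have h1 : (0 : ℚ) < (Nat.card F : ℚ) ^ 2 * ((Nat.card F : ℚ) ^ 2 - 1) := by
      have : (1 : ℚ) < (Nat.card F : ℚ) ^ 2 := one_lt_pow₀ hq1 two_ne_zero
      have : (0 : ℚ) < (Nat.card F : ℚ) ^ 2 - 1 := by linarith
      positivity
    exact_mod_cast mul_left_cancel₀ h1.ne' (h.trans (mul_one _).symm)
  obtain ⟨a, ha⟩ := Finset.card_eq_one.1 hcard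
  have key : ∀ w, (frameComplex Ψ hΨ).IsSimplex w → x ⊂ w → w = insert a x := by
    intro w hw hxw
    obtain ⟨b, hb, hbw⟩ := Finset.exists_of_ssubset hxw
    have hbx : insert b x ⊆ w := Finset.insert_subset hb hxw.1
    have hmem : b ∈ linkVertices (frameComplex Ψ hΨ) x :=
      mem_linkVertices.2 ⟨hbw, mem_of_subset hw hbx (Finset.insert_nonempty b x)⟩
    rw [ha, Finset.mem_singleton] at hmem
    subst hmem
    refine (Finset.eq_of_subset_of_card_le hbx ?_).symm
    rw [Finset.card_insert_of_notMem hbw, hx]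
    exact (finrank_frameCompl hΨ hnd hV hw).1
  rw [key u hu hxu, key v hv hxv]

/-- Removing the frames of size `n - 1` from the link of a chain without frames of size `n`. -/
theorem acyclic_chainLink_diff_of_small {k : Type*} [CommRing k] (hΨ : Ψ.IsAlt)
    (hnd : Ψ.Nondegenerate) {n : ℕ} (hV : Module.finrank F V = 2 * n)
    {c : Finset (Finset (NondegeneratePlane Ψ))} {t : ℤ}
    (hsmall : ∀ y ∈ c, y.card + 1 < n)
    (h : Acyclic k (chainTuples (chainLink (frameComplex Ψ hΨ) c)) t) :
    Acyclic k (chainTuples (chainLink (frameComplex Ψ hΨ) c \ {y | y.card + 1 = n})) t := by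
  classical
  set B := {y : Finset (NondegeneratePlane Ψ) |
    y ∈ chainLink (frameComplex Ψ hΨ) c ∧ y.card + 1 = n}.toFinite.toFinset with hB
  have hBmem : ∀ y, y ∈ B ↔ y ∈ chainLink (frameComplex Ψ hΨ) c ∧ y.card + 1 = n := by
    simp [hB]
  have hdiff : chainLink (frameComplex Ψ hΨ) c \ {y | y.card + 1 = n} =
      chainLink (frameComplex Ψ hΨ) c \ B := by
    ext y
    simp only [Set.mem_sdiff, Set.mem_ofPred_eq, Finset.mem_coe, hBmem]
    tauto
  rw [hdiff]
  refine acyclic_diff_antichain h B (fun x hx => ((hBmem x).1 hx).1) (fun x hx y hy hxy => ?_)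
    fun x hx => ?_
  · have := Finset.card_lt_card hxy
    have := ((hBmem x).1 hx).2
    have := ((hBmem y).1 hy).2
    omega
  · obtain ⟨⟨hxK, hxc⟩, hxn⟩ := (hBmem x).1 hx
    obtain ⟨u, hu, hxu, hun⟩ := exists_superset_frame hΨ hnd hV (Or.inr hxK)
    have hxu' : x ⊂ u := Finset.ssubset_iff_subset_ne.2 ⟨hxu, by rintro rfl; omega⟩
    have hcx : ∀ y ∈ c, y < x := fun y hy => (hxc y hy).resolve_left fun hlt => by
      have := Finset.card_lt_card hlt
      have := hsmall y hy
      omega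
    -- The unique full frame `u` above `x` is an apex for the link of `x`: it contains everything
    -- below `x` and is the only frame above `x`. So deleting `x` preserves acyclicity without loss
    -- of degree.
    refine acyclic_of_comparable (a := u) (by
      exact ⟨⟨mem_of_subset hu subset_rfl ((nonempty_of_mem hxK).mono hxu),
        fun y hy => Or.inr ((hcx y hy).trans hxu')⟩, Or.inr hxu'⟩) ?_ t
    rintro y ⟨⟨hyK, _⟩, hyx | hxy⟩
    · exact Or.inl (hyx.le.trans hxu)
    · exact Or.inl (eq_of_subset_frames hΨ hnd hV hxn (Or.inr hyK) hu hxy hxu').le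

end Connectivity

end Symplectic

namespace TupleChain

/-! ### Links in order complexes -/

section OrderComplexLinks

theorem isSimplex_orderComplex {P : Type*} [PartialOrder P] {c : Finset P} :
    (orderComplex P).IsSimplex c ↔ IsChain (· ≤ ·) (c : Set P) := by
  change c = ∅ ∨ (c.Nonempty ∧ IsChain (· ≤ ·) (c : Set P)) ↔ _
  rcases c.eq_empty_or_nonempty with rfl | h
  · simp [IsChain]
  · simp [h, h.ne_empty]

/-- This passes from the subtype to the ambient poset, where elements can be added and removed
freely; the arbitrary default in the retraction is never evaluated on relevant tuples. -/
theorem acyclic_link_orderComplex {k : Type*} [CommRing k] {P : Type*} [PartialOrder P]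
    {p : P → Prop} [Nonempty (Subtype p)] {c : Finset (Subtype p)}
    (hc : IsChain (· ≤ ·) (c : Set (Subtype p))) {t : ℤ}
    (h : Acyclic k (chainTuples {y | p y ∧ ∀ s ∈ c, y < s ∨ s < y}) t) :
    Acyclic k (tuples ((orderComplex (Subtype p)).link c)) t := by
  classical
  have hlink : ∀ σ, ((orderComplex (Subtype p)).link c).IsSimplex σ ↔
      Disjoint c σ ∧ IsChain (· ≤ ·) ((c ∪ σ : Finset (Subtype p)) : Set (Subtype p)) := fun σ => by
    rw [isSimplex_link (isSimplex_orderComplex.2 hc), isSimplex_orderComplex]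
  refine Acyclic.retract (Subtype.val : Subtype p → P)
    (fun y => if hy : p y then ⟨y, hy⟩ else Classical.arbitrary _) (fun x => dif_pos x.2) ?_ ?_ h
  · rintro j v ⟨σ, hσ, hv⟩
    obtain ⟨hd, hch⟩ := (hlink σ).1 hσ
    refine ⟨fun i => ⟨(v i).2, fun s hs => ?_⟩, fun i l => ?_⟩
    · have hne : (v i).1 ≠ s.1 := fun e => Finset.disjoint_left.1 hd hs (Subtype.ext e ▸ hv i)
      rcases hch.total (Finset.mem_coe.2 (Finset.mem_union_right c (hv i)))
        (Finset.mem_coe.2 (Finset.mem_union_left σ hs)) with h1 | h1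
      · exact Or.inl (lt_of_le_of_ne h1 hne)
      · exact Or.inr (lt_of_le_of_ne h1 hne.symm)
    · exact hch.total (Finset.mem_coe.2 (Finset.mem_union_right c (hv i)))
        (Finset.mem_coe.2 (Finset.mem_union_right c (hv l)))
  · rintro j v ⟨hv, hcomp⟩
    refine ⟨Finset.univ.image fun i => ⟨v i, (hv i).1⟩, (hlink _).2 ⟨?_, ?_⟩, fun i => ?_⟩
    · rw [Finset.disjoint_right]
      intro a ha hac
      obtain ⟨i, -, rfl⟩ := Finset.mem_image.1 ha
      rcases (hv i).2 _ hac with h1 | h1 <;> exact lt_irrefl _ h1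
    · intro a ha b hb _
      rw [Finset.mem_coe, Finset.mem_union, Finset.mem_image] at ha hb
      rcases ha with ha | ⟨i, -, rfl⟩ <;> rcases hb with hb | ⟨l, -, rfl⟩
      · exact hc.total ha hb
      · exact ((hv l).2 a ha).symm.imp (fun h => h.le) fun h => h.le
      · exact ((hv i).2 b hb).imp (fun h => h.le) fun h => h.le
      · exact hcomp i l
    · exact Finset.mem_image.2 ⟨i, Finset.mem_univ i, (dif_pos (hv i).1).symm⟩

theorem hasDimension_link {ι : Type*} {K : PreAbstractSimplicialComplex ι} {N : ℕ}
    (hK : ∀ σ, K.IsSimplex σ → σ.card ≤ N) {c u : Finset ι} (hu : K.IsSimplex u) (hcu : c ⊆ u)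
    (huN : u.card = N) : (K.link c).HasDimension ((N : ℤ) - 1 - c.card) := by
  classical
  have hc := isSimplex_of_subset hu hcu
  refine ⟨⟨u \ c, (isSimplex_link hc).2 ⟨Finset.disjoint_sdiff, ?_⟩, ?_⟩, ?_⟩
  · rwa [Finset.union_sdiff_of_subset hcu]
  · have := Finset.card_sdiff_add_card_eq_card hcu
    omega
  · rintro e ⟨τ, hτ, rfl⟩
    obtain ⟨h1, h2⟩ := (isSimplex_link hc).1 hτ
    have := hK _ h2
    rw [Finset.card_union_of_disjoint h1] at this
    omega

/-- A chain of simplices without a member of size `p` can be refined by a simplex of size `p`. -/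
theorem exists_refine_chain {ι : Type*} {K : PreAbstractSimplicialComplex ι} {n p : ℕ}
    (hK : ∀ s, K.IsSimplex s → ∃ u, K.IsSimplex u ∧ s ⊆ u ∧ u.card = n)
    {c : Finset (Finset ι)} (hcK : ∀ y ∈ c, y ∈ K) (hc : IsChain (· ≤ ·) (c : Set (Finset ι)))
    (hp : 1 ≤ p) (hpn : p ≤ n) (hpc : ∀ y ∈ c, y.card ≠ p) :
    ∃ y ∈ K, y.card = p ∧ ∀ s ∈ c, s < y ∨ y < s := by
  classical
  have hcomp : ∀ a ∈ c, ∀ b ∈ c, a.card ≤ b.card → a ⊆ b := by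
    intro a ha b hb hab
    rcases hc.total (Finset.mem_coe.2 ha) (Finset.mem_coe.2 hb) with h | h
    · exact h
    · exact (Finset.eq_of_subset_of_card_le h hab).ge
  -- `l` is the largest member of size below `p` (or `∅`) and `m` the smallest above it (or a
  -- simplex of size `n` containing `l`). Any set of size `p` between them refines the chain.
  obtain ⟨l, hl, hlp, hl1, hl2⟩ : ∃ l, K.IsSimplex l ∧ l.card ≤ p ∧
      (∀ s ∈ c, s.card < p → s ⊆ l) ∧ ∀ s ∈ c, p < s.card → l ⊆ s := by
    rcases (c.filter fun s => s.card < p).eq_empty_or_nonempty with h0 | h0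
    · refine ⟨∅, Or.inl rfl, by simp, fun s hs hsp => ?_, fun s _ _ => Finset.empty_subset s⟩
      exact absurd hsp (Finset.filter_eq_empty_iff.1 h0 hs)
    · obtain ⟨l, hl, hmax⟩ := Finset.exists_max_image _ Finset.card h0
      obtain ⟨hlc, hlp⟩ := Finset.mem_filter.1 hl
      exact ⟨l, Or.inr (hcK l hlc), hlp.le,
        fun s hs hsp => hcomp s hs l hlc (hmax s (Finset.mem_filter.2 ⟨hs, hsp⟩)),
        fun s hs hsp => hcomp l hlc s hs (by omega)⟩
  obtain ⟨m, hm, hpm, hlm, hm1⟩ : ∃ m, K.IsSimplex m ∧ p ≤ m.card ∧ l ⊆ m ∧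
      ∀ s ∈ c, p < s.card → m ⊆ s := by
    rcases (c.filter fun s => p < s.card).eq_empty_or_nonempty with h0 | h0
    · obtain ⟨u, hu, hlu, hun⟩ := hK l hl
      refine ⟨u, hu, by omega, hlu, fun s hs hsp => ?_⟩
      exact absurd hsp (Finset.filter_eq_empty_iff.1 h0 hs)
    · obtain ⟨m, hm, hmin⟩ := Finset.exists_min_image _ Finset.card h0
      obtain ⟨hmc, hmp⟩ := Finset.mem_filter.1 hm
      exact ⟨m, Or.inr (hcK m hmc), hmp.le, hl2 m hmc hmp,
        fun s hs hsp => hcomp m hmc s hs (hmin s (Finset.mem_filter.2 ⟨hs, hsp⟩))⟩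
  obtain ⟨y, hly, hym, hy⟩ := Finset.exists_subsuperset_card_eq hlm hlp hpm
  refine ⟨y, mem_of_subset hm hym (Finset.card_pos.1 (by omega)), hy, fun s hs => ?_⟩
  rcases lt_or_gt_of_ne (hpc s hs) with h | h
  · exact Or.inl (Finset.ssubset_iff_subset_ne.2
      ⟨(hl1 s hs h).trans hly, by rintro rfl; omega⟩)
  · exact Or.inr (Finset.ssubset_iff_subset_ne.2
      ⟨hym.trans (hm1 s hs h), by rintro rfl; omega⟩)

end OrderComplexLinks

end TupleChain

namespace Symplectic

open LinearMap (BilinForm)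
open TupleChain

/-! ### Links and dimension of the poset of frames -/

section FramePoset

variable {F V : Type*} [Field F] [AddCommGroup V] [Module F V] [FiniteDimensional F V]
  {Ψ : BilinForm F V}

/-- Members of a chain are told apart by their sizes, which range over `n - 1` values. This gives
the dimension `n - 2`. -/
theorem card_injOn_image_subset_of_isChain (hΨ : Ψ.IsAlt) (hnd : Ψ.Nondegenerate) {n : ℕ} (hn : 2 ≤ n)
    (hV : Module.finrank F V = 2 * n) {c : Finset (FramePoset Ψ hΨ)}
    (hc : IsChain (· ≤ ·) (c : Set (FramePoset Ψ hΨ))) :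
    Set.InjOn (fun a : FramePoset Ψ hΨ => a.1.card) c ∧
      (c.image fun a => a.1.card) ⊆ (Finset.Icc 1 n).erase (n - 1) := by
  constructor
  · intro a ha b hb hab
    rcases hc.total ha hb with h | h
    · exact Subtype.ext (Finset.eq_of_subset_of_card_le h hab.ge)
    · exact Subtype.ext (Finset.eq_of_subset_of_card_le h hab.le).symm
  · intro m hm
    obtain ⟨a, -, rfl⟩ := Finset.mem_image.1 hm
    have h1 := (finrank_frameCompl hΨ hnd hV (Or.inr a.2.1)).1
    have h2 := a.2.2
    have h3 := (nonempty_of_mem a.2.1).card_pos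
    rw [Finset.mem_erase, Finset.mem_Icc]
    omega

variable [Fintype (NondegeneratePlane Ψ)] [DecidableEq (NondegeneratePlane Ψ)]

/-- Removing the frames of size `n - 1` from the link of a chain with a frame of size `n`. -/
theorem acyclic_chainLink_diff_of_mem {k : Type*} [CommRing k] (hΨ : Ψ.IsAlt)
    (hnd : Ψ.Nondegenerate) {n : ℕ} (hV : Module.finrank F V = 2 * n)
    {c : Finset (Finset (NondegeneratePlane Ψ))} (hcK : ∀ y ∈ c, y ∈ frameComplex Ψ hΨ)
    (hc : IsChain (· ≤ ·) (c : Set (Finset (NondegeneratePlane Ψ))))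
    {s : Finset (NondegeneratePlane Ψ)} (hsc : s ∈ c) (hsn : s.card = n) :
    Acyclic k (chainTuples (chainLink (frameComplex Ψ hΨ) c \ {y | y.card + 1 = n}))
      ((n : ℤ) - 3 - c.card) := by
  classical
  have : Nonempty (NondegeneratePlane Ψ) := ⟨(nonempty_of_mem (hcK s hsc)).choose⟩
  have hle : ∀ y ∈ frameComplex Ψ hΨ, y.card ≤ n := fun y hy =>
    (finrank_frameCompl hΨ hnd hV (Or.inr hy)).1
  have hcs : ∀ y ∈ c, y ⊆ s := by
    intro y hy
    rcases hc.total (Finset.mem_coe.2 hy) (Finset.mem_coe.2 hsc) with h | h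
    · exact h
    · exact (Finset.eq_of_subset_of_card_le h (hsn ▸ hle y (hcK y hy))).ge
  -- There is nothing above a full frame, and `-2` is the vacuous degree. All connectivity comes
  -- from the Boolean intervals below `s`: degree `n - 2 - |c|` before the deletion, and one less
  -- for the links of the deleted frames.
  have hlink : Acyclic k (tuples ((frameComplex Ψ hΨ).link s)) (-2) := fun j hj => by omega
  set B := {y : Finset (NondegeneratePlane Ψ) |
    y ∈ chainLink (frameComplex Ψ hΨ) c ∧ y.card + 1 = n}.toFinite.toFinset with hB
  have hBmem : ∀ y, y ∈ B ↔ y ∈ chainLink (frameComplex Ψ hΨ) c ∧ y.card + 1 = n := by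
    simp [hB]
  have hdiff : chainLink (frameComplex Ψ hΨ) c \ {y | y.card + 1 = n} =
      chainLink (frameComplex Ψ hΨ) c \ B := by
    ext y
    simp only [Set.mem_sdiff, Set.mem_ofPred_eq, Finset.mem_coe, hBmem]
    tauto
  rw [hdiff]
  refine acyclic_diff_antichain ?_ B (fun x hx => ((hBmem x).1 hx).1) (fun x hx y hy hxy => ?_)
    fun x hx => ?_
  · exact (acyclic_chainLink hlink c (fun y hy => ⟨hcK y hy, hcs y hy⟩) hc (Or.inl hsc)).mono
      (by omega)
  · have := Finset.card_lt_card hxy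
    have := ((hBmem x).1 hx).2
    have := ((hBmem y).1 hy).2
    omega
  · obtain ⟨⟨hxK, hxc⟩, hxn⟩ := (hBmem x).1 hx
    have hxc' : x ∉ c := fun h => (hxc x h).elim (lt_irrefl x) (lt_irrefl x)
    have hxs : x ⊆ s := (hxc s hsc).elim (fun h => h.le) fun h => by
      have := Finset.card_lt_card h
      omega
    rw [sep_chainLink]
    refine (acyclic_chainLink hlink (insert x c) ?_ ?_
      (Or.inl (Finset.mem_insert_of_mem hsc))).mono ?_
    · intro y hy
      rcases Finset.mem_insert.1 hy with rfl | hy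
      · exact ⟨hxK, hxs⟩
      · exact ⟨hcK y hy, hcs y hy⟩
    · rw [Finset.coe_insert]
      exact hc.insert fun b hb _ => (hxc b hb).imp (fun h => h.le) fun h => h.le
    · rw [Finset.card_insert_of_notMem hxc']
      omega

variable [Finite F] [Fintype V]

theorem nonempty_framePoset (hΨ : Ψ.IsAlt) (hnd : Ψ.Nondegenerate) {n : ℕ} (hn : 1 ≤ n)
    (hV : Module.finrank F V = 2 * n) : Nonempty (FramePoset Ψ hΨ) := by
  obtain ⟨u, hu, -, hun⟩ := exists_superset_frame hΨ hnd hV (Or.inl rfl : _ ∨ _)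
  exact ⟨⟨u, mem_of_subset hu subset_rfl (Finset.card_pos.1 (by omega)), by omega⟩⟩

theorem nonempty_plane (hΨ : Ψ.IsAlt) (hnd : Ψ.Nondegenerate) {n : ℕ} (hn : 1 ≤ n)
    (hV : Module.finrank F V = 2 * n) : Nonempty (NondegeneratePlane Ψ) := by
  obtain ⟨x, -⟩ := linkVertices_frameComplex_nonempty hΨ hnd hV
    (Or.inl rfl : (frameComplex Ψ hΨ).IsSimplex ∅) (by rw [Finset.card_empty]; omega)
  exact ⟨x⟩

theorem acyclic_link_framePoset {k : Type*} [CommRing k] (hΨ : Ψ.IsAlt)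
    (hnd : Ψ.Nondegenerate) {n : ℕ} (hn : 1 ≤ n) (hV : Module.finrank F V = 2 * n)
    {c : Finset (FramePoset Ψ hΨ)} (hc : IsChain (· ≤ ·) (c : Set (FramePoset Ψ hΨ))) {t : ℤ}
    (h : Acyclic k (chainTuples (chainLink (frameComplex Ψ hΨ)
      (c.map (Function.Embedding.subtype _)) \ {y | y.card + 1 = n})) t) :
    Acyclic k (tuples ((orderComplex (FramePoset Ψ hΨ)).link c)) t := by
  have := nonempty_framePoset hΨ hnd hn hV
  refine acyclic_link_orderComplex hc ?_
  convert h using 2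
  ext y
  simp only [chainLink, Set.mem_sdiff, Set.mem_ofPred_eq, Finset.mem_map, hV,
    Nat.mul_div_cancel_left n two_pos]
  constructor
  · rintro ⟨⟨h1, h2⟩, h3⟩
    refine ⟨⟨h1, ?_⟩, h2⟩
    rintro s ⟨a, ha, rfl⟩
    exact h3 a ha
  · rintro ⟨⟨h1, h2⟩, h3⟩
    exact ⟨⟨h1, h3⟩, fun a ha => h2 _ ⟨a, ha, rfl⟩⟩

/-- The poset of frames of size `≠ 0, n - 1` is `(n - 4)`-connected if `n < q ^ 2 + 4`. -/
theorem acyclic_framePoset {k : Type*} [Field k] [CharZero k] (hΨ : Ψ.IsAlt)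
    (hnd : Ψ.Nondegenerate) {n q : ℕ} (hn : 4 ≤ n) (hV : Module.finrank F V = 2 * n)
    (hq : Nat.card F = q) (h : n < q ^ 2 + 4) :
    Acyclic k (tuples (orderComplex (FramePoset Ψ hΨ))) ((n : ℤ) - 4) := by
  classical
  have := nonempty_plane hΨ hnd (by omega) hV
  have hq2 : 2 ≤ q := by rw [← hq]; exact Finite.one_lt_card
  rw [← tuples_link_empty]
  refine acyclic_link_framePoset hΨ hnd (by omega) hV (by simp [IsChain]) ?_
  refine acyclic_chainLink_diff_of_small hΨ hnd hV (by simp) ?_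
  have hlink : Acyclic k (tuples ((frameComplex Ψ hΨ).link ∅)) ((n : ℤ) - 4) := by
    refine acyclic_link_frameComplex hΨ hnd hV hq (Or.inl rfl)
      (fun _ => by rw [Finset.card_empty]; omega) fun d hd => ?_
    refine ⟨n - d, by omega, by rw [Finset.card_empty]; omega, ?_⟩
    -- Degrees `d ≤ n - 4` leave exponent at least 2, and `d + 1 ≤ n - 3 ≤ q ^ 2`.
    have h1 : q ^ 2 ≤ q ^ (n - d - 2) := Nat.pow_le_pow_right (by omega) (by omega)
    exact gap_of_le (by omega) (by omega) (by nlinarith)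
  simpa using acyclic_chainLink hlink ∅ (by simp) (by simp [IsChain]) (Or.inr ⟨rfl, rfl⟩)

/-- If the chain has a full frame, only Boolean intervals occur. Otherwise the frame complex above
its top is one degree short of spherical, which suffices because deleting size `n - 1` lowers the
dimension by one. -/
theorem acyclic_link_framePoset_of_lt {k : Type*} [Field k] [CharZero k] (hΨ : Ψ.IsAlt)
    (hnd : Ψ.Nondegenerate) {n q : ℕ} (hn : 4 ≤ n) (hV : Module.finrank F V = 2 * n)
    (hq : Nat.card F = q) (h : n < q + 3) {c : Finset (FramePoset Ψ hΨ)}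
    (hc : IsChain (· ≤ ·) (c : Set (FramePoset Ψ hΨ))) :
    Acyclic k (tuples ((orderComplex (FramePoset Ψ hΨ)).link c)) ((n : ℤ) - 3 - c.card) := by
  classical
  have := nonempty_plane hΨ hnd (by omega) hV
  have hq2 : 2 ≤ q := by rw [← hq]; exact Finite.one_lt_card
  refine acyclic_link_framePoset hΨ hnd (by omega) hV hc ?_
  rw [← Finset.card_map (Function.Embedding.subtype _)]
  set c' := c.map (Function.Embedding.subtype _) with hc'
  have hcK : ∀ y ∈ c', y ∈ frameComplex Ψ hΨ ∧ y.card + 1 ≠ n := by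
    intro y hy
    obtain ⟨a, -, rfl⟩ := Finset.mem_map.1 hy
    have := a.2.2
    exact ⟨a.2.1, fun h : a.1.card + 1 = n => this (by omega)⟩
  have hch : IsChain (· ≤ ·) (c' : Set (Finset (NondegeneratePlane Ψ))) := by
    intro x hx y hy _
    obtain ⟨a, ha, rfl⟩ := Finset.mem_map.1 hx
    obtain ⟨b, hb, rfl⟩ := Finset.mem_map.1 hy
    exact hc.total ha hb
  by_cases hex : ∃ s ∈ c', s.card = n
  · obtain ⟨s, hs, hsn⟩ := hex
    exact acyclic_chainLink_diff_of_mem hΨ hnd hV (fun y hy => (hcK y hy).1) hch hs hsn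
  have hsmall : ∀ y ∈ c', y.card + 1 < n := by
    intro y hy
    have h1 := (finrank_frameCompl hΨ hnd hV (Or.inr (hcK y hy).1)).1
    have h2 := (hcK y hy).2
    have h3 : y.card ≠ n := fun h => hex ⟨y, hy, h⟩
    omega
  refine acyclic_chainLink_diff_of_small hΨ hnd hV hsmall ?_
  obtain ⟨s, hs, hcs, hsn⟩ : ∃ s, (s ∈ c' ∨ s = ∅ ∧ c' = ∅) ∧ (∀ y ∈ c', y ⊆ s) ∧
      s.card + 1 < n := by
    rcases c'.eq_empty_or_nonempty with h0 | h0
    · exact ⟨∅, Or.inr ⟨rfl, h0⟩, by simp [h0], by rw [Finset.card_empty]; omega⟩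
    · obtain ⟨s, hs, hmax⟩ := Finset.exists_max_image _ Finset.card h0
      refine ⟨s, Or.inl hs, fun y hy => ?_, hsmall s hs⟩
      rcases hch.total (Finset.mem_coe.2 hy) (Finset.mem_coe.2 hs) with h | h
      · exact h
      · exact (Finset.eq_of_subset_of_card_le h (hmax y hy)).ge
  have hsK : (frameComplex Ψ hΨ).IsSimplex s := hs.elim (fun h => Or.inr (hcK s h).1)
    fun h => Or.inl h.1
  have hlink : Acyclic k (tuples ((frameComplex Ψ hΨ).link s)) ((n : ℤ) - s.card - 3) := by
    refine acyclic_link_frameComplex hΨ hnd hV hq hsK (fun _ => by omega) fun d hd => ?_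
    refine ⟨n - s.card - d, by omega, by omega, ?_⟩
    -- Now `d ≤ n - |s| - 3` only leaves exponent at least 1, and `d + 1 ≤ n - 2 ≤ q`; this is the
    -- origin of the condition `n < q + 3`.
    have h1 : q ≤ q ^ (n - s.card - d - 2) := Nat.le_self_pow (by omega) q
    exact gap_of_le (by omega) (by omega) (by omega)
  exact (acyclic_chainLink hlink c' (fun y hy => ⟨(hcK y hy).1, hcs y hy⟩) hch hs).mono (by omega)

theorem card_erase_Icc {n : ℕ} (hn : 2 ≤ n) : ((Finset.Icc 1 n).erase (n - 1)).card = n - 1 := by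
  rw [Finset.card_erase_of_mem (Finset.mem_Icc.2 (by omega))]
  simp

/-- Purity of the order complex: any missing size can be filled in. It gives the exact dimension of
all links, not only their connectivity. -/
theorem exists_maximal_chain (hΨ : Ψ.IsAlt) (hnd : Ψ.Nondegenerate) {n : ℕ} (hn : 2 ≤ n)
    (hV : Module.finrank F V = 2 * n) {c : Finset (FramePoset Ψ hΨ)}
    (hc : IsChain (· ≤ ·) (c : Set (FramePoset Ψ hΨ))) :
    ∃ u : Finset (FramePoset Ψ hΨ), IsChain (· ≤ ·) (u : Set (FramePoset Ψ hΨ)) ∧ c ⊆ u ∧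
      u.card = n - 1 := by
  classical
  obtain ⟨hinj, hsub⟩ := card_injOn_image_subset_of_isChain hΨ hnd hn hV hc
  have hcard := Finset.card_image_of_injOn hinj
  have hle := Finset.card_le_card hsub
  rw [card_erase_Icc hn, hcard] at hle
  induction hm : n - 1 - c.card generalizing c with
  | zero => exact ⟨c, hc, subset_rfl, by omega⟩
  | succ m ih =>
    obtain ⟨p, hp, hpc⟩ := Finset.exists_of_ssubset (Finset.ssubset_iff_subset_ne.2 ⟨hsub, by
      intro h
      have h' := congrArg Finset.card h
      rw [card_erase_Icc hn, hcard] at h'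
      omega⟩)
    rw [Finset.mem_erase, Finset.mem_Icc] at hp
    obtain ⟨y, hyK, hyp, hy⟩ := exists_refine_chain (p := p)
      (fun s hs => exists_superset_frame hΨ hnd hV hs)
      (c := c.map (Function.Embedding.subtype _)) (by
        intro y hy
        obtain ⟨a, -, rfl⟩ := Finset.mem_map.1 hy
        exact a.2.1) (by
        intro x hx y hy _
        obtain ⟨a, ha, rfl⟩ := Finset.mem_map.1 hx
        obtain ⟨b, hb, rfl⟩ := Finset.mem_map.1 hy
        exact hc.total ha hb) (by omega) (by omega) (by
        intro y hy hyp
        obtain ⟨a, ha, rfl⟩ := Finset.mem_map.1 hy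
        exact hpc (Finset.mem_image.2 ⟨a, ha, hyp⟩))
    let z : FramePoset Ψ hΨ := ⟨y, hyK, by
      rw [hV, Nat.mul_div_cancel_left n two_pos]; omega⟩
    have hz : ∀ a ∈ c, a < z ∨ z < a := fun a ha => hy _ (Finset.mem_map.2 ⟨a, ha, rfl⟩)
    have hzc : z ∉ c := fun h => (hz z h).elim (lt_irrefl z) (lt_irrefl z)
    have hc' : IsChain (· ≤ ·) ((insert z c : Finset (FramePoset Ψ hΨ)) :
        Set (FramePoset Ψ hΨ)) := by
      rw [Finset.coe_insert]
      exact hc.insert fun b hb _ => (hz b hb).symm.imp (fun h => h.le) fun h => h.le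
    obtain ⟨hinj', hsub'⟩ := card_injOn_image_subset_of_isChain hΨ hnd hn hV hc'
    have hcard' := Finset.card_image_of_injOn hinj'
    have hle' := Finset.card_le_card hsub'
    rw [card_erase_Icc hn, hcard'] at hle'
    obtain ⟨u, hu, hcu, hun⟩ := ih hc' hinj' hsub' hcard' hle'
      (by rw [Finset.card_insert_of_notMem hzc]; omega)
    exact ⟨u, hu, (Finset.subset_insert z c).trans hcu, hun⟩

theorem isCohenMacaulay_framePoset {k : Type*} [Field k] [CharZero k] (hΨ : Ψ.IsAlt)
    (hnd : Ψ.Nondegenerate) {n q : ℕ} (hn : 4 ≤ n) (hV : Module.finrank F V = 2 * n)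
    (hq : Nat.card F = q) (h : n < q + 3) :
    (orderComplex (FramePoset Ψ hΨ)).IsCohenMacaulay k := by
  have hle : ∀ c : Finset (FramePoset Ψ hΨ), (orderComplex (FramePoset Ψ hΨ)).IsSimplex c →
      c.card ≤ n - 1 := by
    intro c hc
    obtain ⟨hinj, hsub⟩ := card_injOn_image_subset_of_isChain hΨ hnd (by omega) hV
      (isSimplex_orderComplex.1 hc)
    rw [← Finset.card_image_of_injOn hinj, ← card_erase_Icc (by omega)]
    exact Finset.card_le_card hsub
  refine ⟨(n : ℤ) - 2, ⟨?_, ?_⟩, fun c hc => ⟨?_, ?_⟩⟩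
  · obtain ⟨u, hu, -, hun⟩ := exists_maximal_chain hΨ hnd (n := n) (by omega) hV
      (c := (∅ : Finset (FramePoset Ψ hΨ))) (by simp [IsChain])
    exact ⟨u, isSimplex_orderComplex.2 hu, by omega⟩
  · rintro e ⟨σ, hσ, rfl⟩
    have := hle σ hσ
    omega
  · obtain ⟨u, hu, hcu, hun⟩ := exists_maximal_chain hΨ hnd (n := n) (by omega) hV
      (isSimplex_orderComplex.1 hc)
    have := hasDimension_link hle (isSimplex_orderComplex.2 hu) hcu hun
    rwa [show (n : ℤ) - 2 - c.card = ((n - 1 : ℕ) : ℤ) - 1 - c.card by omega]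
  · refine isConnectedOver_of_acyclic ((acyclic_link_framePoset_of_lt hΨ hnd hn hV hq h
      (isSimplex_orderComplex.1 hc)).mono (by omega))

end FramePoset

end Symplectic

theorem corollary8p3 {F V k : Type*} [Field F] [Finite F] [AddCommGroup V] [Module F V]
    [FiniteDimensional F V] [Field k] [CharZero k]
    (Ψ : LinearMap.BilinForm F V) (hΨ : Ψ.IsAlt) (hnd : Ψ.Nondegenerate)
    (n q : ℕ) (hn : 4 ≤ n) (hV : Module.finrank F V = 2 * n) (hq : Nat.card F = q) :
    (n < q + 3 →
      (orderComplex (Symplectic.FramePoset Ψ hΨ)).IsCohenMacaulay k) ∧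
    (n < q ^ 2 + 4 →
      (orderComplex (Symplectic.FramePoset Ψ hΨ)).IsConnectedOver k ((n : ℤ) - 4)) ∧
    (((q = 2 ∨ q = 3) ∧ 7 ≤ n) ∨ (4 ≤ q ∧ 5 ≤ n) →
      (Symplectic.frameComplex Ψ hΨ).IsConnectedOver k ((n / 2 : ℕ) : ℤ)) := by
  classical
  have : Finite V := Module.finite_of_finite F
  have : Fintype V := Fintype.ofFinite V
  have : Finite (Submodule F V) := Finite.of_injective (fun S : Submodule F V => (S : Set V))
    SetLike.coe_injective
  have : Fintype (Symplectic.NondegeneratePlane Ψ) := Fintype.ofFinite _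
  exact ⟨Symplectic.isCohenMacaulay_framePoset hΨ hnd hn hV hq,
    fun h => TupleChain.isConnectedOver_of_acyclic
      (Symplectic.acyclic_framePoset hΨ hnd hn hV hq h),
    fun h => TupleChain.isConnectedOver_of_acyclic
      (Symplectic.acyclic_frameComplex hΨ hnd hV hq h)⟩
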